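/- Let $p\ge 1$ be an integer and $\mathbb N=\{1,2,\dots\}$. For real $\beta$, let $\mathcal P_p(\beta)$ be the class of bounded operators $D$ on $\ell^2(\mathbb N)$ whose matrix $(d_{ij})_{i,j\ge1}$ in the standard basis has complex entries and satisfies: (i) $d_{ij}=0$ for $|i-j|>p$ and $d_{ij}\neq0$ for $|i-j|=p$ (i.e. $D$ is $p$-banded); (ii) $\lim_{i\to\infty}d_{i,i\pm p}=1$ and $\lim_{i\to\infty}d_{i,i+r}=0$ for every integer $r$ with $|r|<p$; (iii) there are constants $C_1,C_2>0$ such that for all $n\in\mathbb N$ $$|d_{n,n-p}-1|+\sum_{r=-p+1}^{p-1}|d_{n,n+r}|+|d_{n,n+p}-1|\le C_1\exp(-C_2n^\beta),$$ where, for $\min(i,j)\le0$, one puts $d_{ij}=1$ if $|i-j|=p$ and $d_{ij}=0$ otherwise. Let $\sigma_{\rm d}(D)$ be the discrete spectrum of $D$, i.e. the set of isolated points of the spectrum of $D$ that are eigenvalues of finite algebraic multiplicity, and let $E_D\subset\mathbb C$ be the set of accumulation points of $\sigma_{\rm d}(D)$. **Theorem.** For every $\varepsilon>0$ and arbitrary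 (not necessarily distinct) points $\nu_1,\dots,\nu_p\in(-2,2)$ there exists an operator $D\in\mathcal P_p(\tfrac12-\varepsilon)$ whose discrete spectrum $\sigma_{\rm d}(D)$ is infinite and whose limit set is $$E_D=\{\nu_1,\dots,\nu_p\}.$$ -/

import Mathlib

open Filter Topology
open scoped lp

noncomputable section

namespace BandedOperator

/-- The matrix entry `d i j = ⟨T e_j, e_i⟩` of a bounded operator `T` on `ℓ²` in the standard basis
`(e_n)`. Rows and columns are numbered `0, 1, 2, …`, so that row `n` here is row `n + 1` in the
numbering that starts from `1`. A bounded operator is determined by its matrix. -/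
def entry (T : ℓ²(ℕ, ℂ) →L[ℂ] ℓ²(ℕ, ℂ)) (i j : ℕ) : ℂ :=
  (T (lp.single 2 j (1 : ℂ)) : ℕ → ℂ) i

/-- The matrix entries of `T` extended to all integer indices by those of the standard banded
matrix of order `p`: if one of the indices is out of range, then
`d i j = 1` for `|i - j| = p` and `d i j = 0` otherwise. -/
def extEntry (p : ℕ) (T : ℓ²(ℕ, ℂ) →L[ℂ] ℓ²(ℕ, ℂ)) (i j : ℤ) : ℂ :=
  if 0 ≤ i ∧ 0 ≤ j then entry T i.toNat j.toNat
  else if |i - j| = (p : ℤ) then 1 else 0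

/-- `T` is given by a banded matrix of order `p`, with complex entries stabilizing to those of the
standard banded matrix `S ^ p + (S*) ^ p`: `d i j = 0` for `|i - j| > p`, `d i j ≠ 0` for
`|i - j| = p`, `d i (i ± p) → 1`, and `d i (i + r) → 0` for `|r| < p`. -/
structure IsBanded (p : ℕ) (T : ℓ²(ℕ, ℂ) →L[ℂ] ℓ²(ℕ, ℂ)) : Prop where
  eq_zero : ∀ i j : ℕ, (p : ℤ) < |(i : ℤ) - j| → entry T i j = 0
  ne_zero : ∀ i j : ℕ, |(i : ℤ) - j| = (p : ℤ) → entry T i j ≠ 0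
  tendsto_upper : Tendsto (fun i : ℕ => extEntry p T i (i + p)) atTop (𝓝 1)
  tendsto_lower : Tendsto (fun i : ℕ => extEntry p T i (i - p)) atTop (𝓝 1)
  tendsto_inner : ∀ r : ℤ, |r| < (p : ℤ) →
    Tendsto (fun i : ℕ => extEntry p T i (i + r)) atTop (𝓝 0)

/-- The deviation of row `n` from that of the standard banded matrix:
`|d n (n-p) - 1| + ∑_{r=-p+1}^{p-1} |d n (n+r)| + |d n (n+p) - 1|`. -/
def deviation (p : ℕ) (T : ℓ²(ℕ, ℂ) →L[ℂ] ℓ²(ℕ, ℂ)) (n : ℕ) : ℝ :=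
  ‖extEntry p T n (n - p) - 1‖ + ∑ r ∈ Finset.Ioo (-(p : ℤ)) p, ‖extEntry p T n (n + r)‖
    + ‖extEntry p T n (n + p) - 1‖

/-- The class `𝒫_p(β)`: banded of order `p`, and for some constants `C₁, C₂ > 0` the deviation of
the row with number `n + 1` (counted from `1`) is at most `C₁ exp (-C₂ (n + 1) ^ β)`. -/
def ClassP (p : ℕ) (β : ℝ) (T : ℓ²(ℕ, ℂ) →L[ℂ] ℓ²(ℕ, ℂ)) : Prop :=
  IsBanded p T ∧ ∃ C₁ C₂ : ℝ, 0 < C₁ ∧ 0 < C₂ ∧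
    ∀ n : ℕ, deviation p T n ≤ C₁ * Real.exp (-C₂ * ((n : ℝ) + 1) ^ β)

/-- The discrete spectrum: the isolated points of the spectrum that are eigenvalues of finite
algebraic multiplicity, i.e. with `⋃ k, ker (T - z) ^ k` of finite dimension. -/
def discreteSpectrum (T : ℓ²(ℕ, ℂ) →L[ℂ] ℓ²(ℕ, ℂ)) : Set ℂ :=
  {z | z ∈ spectrum ℂ T ∧ ¬ AccPt z (𝓟 (spectrum ℂ T)) ∧
    Module.End.HasEigenvalue (T : Module.End ℂ ℓ²(ℕ, ℂ)) z ∧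
    FiniteDimensional ℂ (Module.End.maxGenEigenspace (T : Module.End ℂ ℓ²(ℕ, ℂ)) z)}

/-- The limit set of the discrete spectrum: the set of its accumulation points in `ℂ`. -/
def limitSet (T : ℓ²(ℕ, ℂ) →L[ℂ] ℓ²(ℕ, ℂ)) : Set ℂ :=
  derivedSet (discreteSpectrum T)

end BandedOperator

end

/-! The operator is `D = α R + b + c L` with three diagonals, where `R` and `L` are the forward and
backward shift by `p`, so that `D` splits into `p` Jacobi matrices, one for each residue of the
index mod `p`. It has to be a rapidly decaying perturbation of `R + L`, whose spectrum is `[-2, 2]`,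
with infinitely many eigenvalues `z + z⁻¹`, `‖z‖ < 1`, close to the points `ν k = ζ k + (ζ k)⁻¹`,
`‖ζ k‖ = 1`.

*The zeros.* The eigenvalues are prescribed through a function `f`, holomorphic in the unit disc,
with infinitely many zeros that accumulate only at `1`, but smooth enough at `1` to have Taylor
coefficients `O (exp (-c n ^ β))`, for a given `β < 1 / 2`. Such a function is
`(1 - z) ^ 2 Φ (δ (1 - z) ^ (-s)) / Φ δ` with `Φ w = exp (-w) cos (σ w)` and `s = β / (1 - β) < 1`;
since `s < 1`, there is room for a `σ > 0` for which `Φ` still decays in the sector of the values of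
`(1 - z) ^ (-s)`, while `cos` has infinitely many zeros. As `δ → 0`, and then `c → 0`, the function
tends to `(1 - z) ^ 2`, from the term of degree `2` on also in the norm of a weighted space `ℓ¹(ω)`
of coefficients, for the weight `ω k = (1 + k) ^ (5 / 4) * exp (c (1 + k) ^ β)`
(`exists_flat_function`).

*The expansion.* The coefficients of the `k`-th Jacobi matrix are obtained from `f (ζ z) / z` by a
continued fraction: if `z + z⁻¹ - b₀ - d * m 0 z = f (ζ z) / z`, `d = 1 - ζ ^ 2`, then `m 0` is
expanded as `m i z = A i / (z + z⁻¹ - B i - m (i + 1) z)`. With `m i z = z (1 + g i z)`, the step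
from `g i` to `g (i + 1)` is a shift by two of `g i / (1 + g i)`, up to a factor. So the norms of
the `g i`, in the spaces with the shifted weights `ω (k + 2 i) / ω (2 i)`, which are again
submultiplicative, decay like `1 / ω (2 i)`, and a small `g 0` makes the expansion run forever
(`IsGoodWeight.exists_expansion`). Its coefficients have the decay that the class `𝒫_p(β)` requires.

*The spectrum.* For `lam = z + z⁻¹` with `0 < ‖z‖ < 1` the expansion gives the factorization
`D - lam = (c L - N) (1 - R M)` with diagonal `M`, `N`, where the first `p` entries of `N` are the
values `f (ζ k z) / z`, and the others stay away from `0`. After a conjugation with a bounded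
diagonal weight, the shift parts are contractions. Hence `D - lam` is invertible unless one of the
`f (ζ k z)` vanishes, in which case `lam` is an eigenvalue; and the resolvent grows at most like a
negative power of the distance to `lam`, so that the algebraic multiplicity is finite. All of
`[-2, 2]` is in the spectrum, by approximate eigenvectors, and none of its points is isolated. So
the discrete spectrum consists of the `z + z⁻¹` with `f (ζ k z) = 0` for some `k < p`, and it
accumulates exactly at `z = (ζ k)⁻¹`, that is, at the points `ν k`. -/

noncomputable section

namespace BandedOperator

section Operators

/-! ### Weighted composition operators on `ℓ²` -/

/-- Diagonal operators and weighted shifts in either direction are all of the form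
`(T x) n = w n * x (φ n)`. Injectivity of `φ` is needed only where `w` does not vanish, so that
`φ n = n - p` with `w n = 0` for `n < p` is allowed. -/
theorem exists_weightedComp (w : ℕ → ℂ) (φ : ℕ → ℕ) (C : ℝ) (hC : ∀ n, ‖w n‖ ≤ C)
    (hφ : Set.InjOn φ {n | w n ≠ 0}) :
    ∃ T : ℓ²(ℕ, ℂ) →L[ℂ] ℓ²(ℕ, ℂ), (∀ x n, T x n = w n * x (φ n)) ∧ ‖T‖ ≤ C := by
  have hC0 : 0 ≤ C := (norm_nonneg _).trans (hC 0)
  have h2 : (0 : ℝ) < (2 : ENNReal).toReal := by norm_num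
  have key : ∀ (x : ℓ²(ℕ, ℂ)) (s : Finset ℕ),
      ∑ n ∈ s, ‖w n * x (φ n)‖ ^ (2 : ENNReal).toReal ≤ (C * ‖x‖) ^ (2 : ENNReal).toReal := by
    intro x s
    have h1 : ∑ n ∈ s, ‖w n * x (φ n)‖ ^ (2 : ENNReal).toReal
        = ∑ n ∈ s with w n ≠ 0, ‖w n * x (φ n)‖ ^ (2 : ENNReal).toReal := by
      symm
      apply Finset.sum_filter_of_ne
      intro n _ hn h0
      apply hn
      rw [h0]
      simp
    have h3 : ∑ n ∈ s with w n ≠ 0, ‖x (φ n)‖ ^ (2 : ENNReal).toReal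
        = ∑ k ∈ (s.filter (fun n => w n ≠ 0)).image φ, ‖x k‖ ^ (2 : ENNReal).toReal := by
      rw [Finset.sum_image]
      intro a ha b hb hab
      exact hφ (Finset.mem_filter.1 ha).2 (Finset.mem_filter.1 hb).2 hab
    rw [h1, Real.mul_rpow hC0 (norm_nonneg _)]
    calc _ ≤ ∑ n ∈ s with w n ≠ 0,
          C ^ (2 : ENNReal).toReal * ‖x (φ n)‖ ^ (2 : ENNReal).toReal := by
          refine Finset.sum_le_sum fun n _ => ?_
          rw [norm_mul, Real.mul_rpow (norm_nonneg _) (norm_nonneg _)]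
          gcongr
          exact hC n
      _ ≤ _ := by
          rw [← Finset.mul_sum, h3]
          gcongr
          exact lp.sum_rpow_le_norm_rpow h2 x _
  let L : ℓ²(ℕ, ℂ) →ₗ[ℂ] ℓ²(ℕ, ℂ) :=
    { toFun := fun x => ⟨fun n => w n * x (φ n), memℓp_gen' (key x)⟩
      map_add' := by
        intro x y
        ext n
        change w n * (x (φ n) + y (φ n)) = w n * x (φ n) + w n * y (φ n)
        ring
      map_smul' := by
        intro a x
        ext n
        change w n * (a * x (φ n)) = a * (w n * x (φ n))
        ring }
  have hL : ∀ x, ‖L x‖ ≤ C * ‖x‖ := fun x =>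
    lp.norm_le_of_forall_sum_le h2 (by positivity) (key x)
  exact ⟨L.mkContinuous C hL, fun x n => rfl, L.mkContinuous_norm_le hC0 hL⟩

/-- Inversion of `1 - T` for a weighted composition operator `T` that becomes a strict contraction
after conjugation by the diagonal operator with entries `s n`. -/
theorem exists_inverse_one_sub_weightedComp (w : ℕ → ℂ) (φ : ℕ → ℕ)
    (hφ : Set.InjOn φ {n | w n ≠ 0}) (T : ℓ²(ℕ, ℂ) →L[ℂ] ℓ²(ℕ, ℂ))
    (hT : ∀ x n, T x n = w n * x (φ n)) (s : ℕ → ℝ) (K r : ℝ) (hr : r < 1)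
    (hs : ∀ n, 1 ≤ s n) (hK : ∀ n, s n ≤ K) (hw : ∀ n, ‖w n‖ * s (φ n) ≤ r * s n) :
    ∃ U : ℓ²(ℕ, ℂ) →L[ℂ] ℓ²(ℕ, ℂ), U * (1 - T) = 1 ∧ (1 - T) * U = 1 ∧ ‖U‖ ≤ K / (1 - r) := by
  have hs0 : ∀ n, (s n : ℂ) ≠ 0 := fun n => by
    have := hs n
    exact_mod_cast (by linarith : s n ≠ 0)
  have hspos : ∀ n, 0 < s n := fun n => by linarith [hs n]
  obtain ⟨S, hS, hSK⟩ := exists_weightedComp (fun n => (s n : ℂ)) id K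
    (fun n => by rw [Complex.norm_real, Real.norm_of_nonneg (hspos n).le]; exact hK n)
    (Function.injective_id.injOn)
  obtain ⟨S', hS', hSK'⟩ := exists_weightedComp (fun n => (s n : ℂ)⁻¹) id 1
    (fun n => by
      rw [norm_inv, Complex.norm_real, Real.norm_of_nonneg (hspos n).le]
      exact inv_le_one_of_one_le₀ (hs n))
    (Function.injective_id.injOn)
  obtain ⟨T', hT', hTr⟩ := exists_weightedComp (fun n => w n * s (φ n) / s n) φ r
    (fun n => by
      rw [norm_div, norm_mul, Complex.norm_real, Complex.norm_real,
        Real.norm_of_nonneg (hspos n).le, Real.norm_of_nonneg (hspos _).le,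
        div_le_iff₀ (hspos n)]
      exact hw n)
    (hφ.mono fun n (hn : _ ≠ 0) (h0 : w n = 0) => hn (by simp [h0]))
  have hSS' : S * S' = 1 := by
    ext x n
    change S (S' x) n = x n
    rw [hS, hS']
    exact mul_inv_cancel_left₀ (hs0 n) _
  have hS'S : S' * S = 1 := by
    ext x n
    change S' (S x) n = x n
    rw [hS', hS]
    exact inv_mul_cancel_left₀ (hs0 n) _
  have hTT : T = S * T' * S' := by
    ext x n
    change T x n = S (T' (S' x)) n
    rw [hT, hS, hT', hS']
    change w n * x (φ n) = s n * (w n * s (φ n) / s n * ((s (φ n) : ℂ)⁻¹ * x (φ n)))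
    field_simp [hs0 n, hs0 (φ n)]
  have h1T : 1 - T = S * (1 - T') * S' := by
    rw [hTT, mul_sub, sub_mul, mul_one, hSS']
  have hT1 : ‖T'‖ < 1 := hTr.trans_lt hr
  refine ⟨S * (∑' i : ℕ, T' ^ i) * S', ?_, ?_, ?_⟩
  · calc S * (∑' i : ℕ, T' ^ i) * S' * (1 - T)
        = S * ((∑' i : ℕ, T' ^ i) * ((S' * S) * (1 - T'))) * S' := by
          rw [h1T]; simp only [mul_assoc]
      _ = 1 := by rw [hS'S, one_mul, geom_series_mul_neg _ hT1, mul_one, hSS']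
  · calc (1 - T) * (S * (∑' i : ℕ, T' ^ i) * S')
        = S * ((1 - T') * ((S' * S) * (∑' i : ℕ, T' ^ i))) * S' := by
          rw [h1T]; simp only [mul_assoc]
      _ = 1 := by rw [hS'S, one_mul, mul_neg_geom_series _ hT1, mul_one, hSS']
  · have hgeo : ‖∑' i : ℕ, T' ^ i‖ ≤ 1 / (1 - r) := by
      refine (tsum_geometric_le_of_norm_lt_one T' hT1).trans ?_
      have : ‖(1 : ℓ²(ℕ, ℂ) →L[ℂ] ℓ²(ℕ, ℂ))‖ ≤ 1 := ContinuousLinearMap.norm_id_le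
      have h2 : (1 - ‖T'‖)⁻¹ ≤ 1 / (1 - r) := by
        rw [one_div]
        exact inv_anti₀ (by linarith) (by linarith)
      linarith
    have hK0 : 0 ≤ K := by linarith [hs 0, hK 0]
    have h1r : 0 ≤ 1 / (1 - r) := by
      have : 0 < 1 - r := by linarith
      positivity
    calc ‖S * (∑' i : ℕ, T' ^ i) * S'‖ ≤ ‖S‖ * ‖∑' i : ℕ, T' ^ i‖ * ‖S'‖ :=
          (norm_mul_le _ _).trans (by gcongr; exact norm_mul_le _ _)
      _ ≤ K * (1 / (1 - r)) * 1 := by gcongr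
      _ = K / (1 - r) := by ring

/-! ### Banded operators with three diagonals -/

/-- `D` is the three-diagonal operator
`(D x) n = α n * x (n - p) + b n * x n + c n * x (n + p)`, the first term being absent for
`n < p`. -/
def IsThreeDiag (p : ℕ) (α b c : ℕ → ℂ) (D : ℓ²(ℕ, ℂ) →L[ℂ] ℓ²(ℕ, ℂ)) : Prop :=
  ∀ x n, D x n = (if p ≤ n then α n * x (n - p) else 0) + b n * x n + c n * x (n + p)

theorem injOn_ite_sub (p : ℕ) (w : ℕ → ℂ) :
    Set.InjOn (fun n => n - p) {n | (if p ≤ n then w n else 0) ≠ 0} := by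
  intro i hi j hj hij
  have hi' : p ≤ i := by by_contra h; simp [h] at hi
  have hj' : p ≤ j := by by_contra h; simp [h] at hj
  simp only at hij
  omega

theorem exists_isThreeDiag (p : ℕ) (α b c : ℕ → ℂ) (C : ℝ) (hα : ∀ n, ‖α n‖ ≤ C)
    (hb : ∀ n, ‖b n‖ ≤ C) (hc : ∀ n, ‖c n‖ ≤ C) :
    ∃ D : ℓ²(ℕ, ℂ) →L[ℂ] ℓ²(ℕ, ℂ), IsThreeDiag p α b c D := by
  have hC0 : 0 ≤ C := (norm_nonneg _).trans (hb 0)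
  obtain ⟨A, hA, -⟩ := exists_weightedComp (fun n => if p ≤ n then α n else 0) (fun n => n - p) C
    (fun n => by
      split_ifs
      · exact hα n
      · simpa using hC0) (injOn_ite_sub p α)
  obtain ⟨B, hB, -⟩ := exists_weightedComp b id C hb Function.injective_id.injOn
  obtain ⟨E, hE, -⟩ := exists_weightedComp c (fun n => n + p) C hc
    ((add_left_injective p).injOn)
  refine ⟨A + B + E, fun x n => ?_⟩
  change A x n + B x n + E x n = _
  rw [hA, hB, hE, ite_mul, zero_mul]
  rfl

variable {p : ℕ} {α b c : ℕ → ℂ} {D : ℓ²(ℕ, ℂ) →L[ℂ] ℓ²(ℕ, ℂ)}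

/-- The right factor `1 - R M` of `D - lam`, where `R` is the shift by `p` and `M` is diagonal. -/
theorem exists_right_factor (m : ℕ → ℂ) (Bm : ℝ) (hm : ∀ n, ‖m n‖ ≤ Bm) (s : ℕ → ℝ)
    (K r : ℝ) (hr : r < 1) (hs : ∀ n, 1 ≤ s n) (hK : ∀ n, s n ≤ K) (hr0 : 0 ≤ r)
    (hw : ∀ n, ‖m n‖ * s n ≤ r * s (n + p)) :
    ∃ Q U : ℓ²(ℕ, ℂ) →L[ℂ] ℓ²(ℕ, ℂ),
      (∀ x n, Q x n = x n - if p ≤ n then m (n - p) * x (n - p) else 0) ∧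
      U * Q = 1 ∧ Q * U = 1 ∧ ‖U‖ ≤ K / (1 - r) := by
  have hB0 : 0 ≤ Bm := (norm_nonneg _).trans (hm 0)
  have hinj := injOn_ite_sub p (fun n => m (n - p))
  obtain ⟨T, hT, -⟩ := exists_weightedComp (fun n => if p ≤ n then m (n - p) else 0)
    (fun n => n - p) Bm
    (fun n => by
      split_ifs
      · exact hm _
      · simpa using hB0) hinj
  obtain ⟨U, h1, h2, h3⟩ := exists_inverse_one_sub_weightedComp _ _ hinj T hT s K r hr hs hK
    (fun n => by
      split_ifs with h
      · have := hw (n - p)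
        rwa [Nat.sub_add_cancel h] at this
      · have := hs n
        simp only [norm_zero, zero_mul]
        positivity)
  refine ⟨1 - T, U, fun x n => ?_, h1, h2, h3⟩
  change x n - T x n = _
  rw [hT, ite_mul, zero_mul]

/-- Coordinatewise form of the factorization `D - lam = (c L - N) (1 - R M)`, where `L` is the
backward and `R` the forward shift by `p`. -/
theorem IsThreeDiag.sub_apply_eq (hD : IsThreeDiag p α b c D) (lam : ℂ) (m N : ℕ → ℂ)
    (hN : ∀ n, N n = lam - b n - c n * m n) (hα : ∀ n, p ≤ n → α n = N n * m (n - p))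
    (Q : ℓ²(ℕ, ℂ) →L[ℂ] ℓ²(ℕ, ℂ))
    (hQ : ∀ x n, Q x n = x n - if p ≤ n then m (n - p) * x (n - p) else 0)
    (x : ℓ²(ℕ, ℂ)) (n : ℕ) :
    D x n - lam * x n = c n * Q x (n + p) - N n * Q x n := by
  rw [hD, hQ, hQ, if_pos (Nat.le_add_left p n), Nat.add_sub_cancel]
  split_ifs with h
  · rw [hα n h, hN n]
    ring
  · rw [hN n]
    ring

theorem IsThreeDiag.exists_resolvent (hD : IsThreeDiag p α b c D) (lam : ℂ) (m N : ℕ → ℂ)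
    (hN : ∀ n, N n = lam - b n - c n * m n) (hα : ∀ n, p ≤ n → α n = N n * m (n - p))
    (Bm : ℝ) (hm : ∀ n, ‖m n‖ ≤ Bm) (s t : ℕ → ℝ)
    (K K' r κ : ℝ) (hr0 : 0 ≤ r) (hr : r < 1) (hs : ∀ n, 1 ≤ s n) (hK : ∀ n, s n ≤ K)
    (ht : ∀ n, 1 ≤ t n) (hK' : ∀ n, t n ≤ K')
    (hw : ∀ n, ‖m n‖ * s n ≤ r * s (n + p))
    (hw' : ∀ n, ‖c n‖ * t (n + p) ≤ r * t n * ‖N n‖)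
    (hκ : 0 < κ) (hNκ : ∀ n, κ ≤ ‖N n‖) (BN : ℝ) (hBN : ∀ n, ‖N n‖ ≤ BN) :
    ∃ U : ℓ²(ℕ, ℂ) →L[ℂ] ℓ²(ℕ, ℂ), U * (D - lam • 1) = 1 ∧ (D - lam • 1) * U = 1 ∧
      ‖U‖ ≤ K / (1 - r) * (K' / (1 - r)) * κ⁻¹ := by
  obtain ⟨Q, U₁, hQ, hU₁, hU₁', hn₁⟩ := exists_right_factor (p := p) m Bm hm s K r hr hs hK hr0 hw
  have hN0 : ∀ n, N n ≠ 0 := fun n => norm_pos_iff.1 (hκ.trans_le (hNκ n))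
  obtain ⟨Nd, hNd, -⟩ := exists_weightedComp N id BN hBN Function.injective_id.injOn
  obtain ⟨Ni, hNi, hNin⟩ := exists_weightedComp (fun n => (N n)⁻¹) id κ⁻¹
    (fun n => by rw [norm_inv]; exact inv_anti₀ hκ (hNκ n)) Function.injective_id.injOn
  have hwc : ∀ n, ‖c n / N n‖ * t (n + p) ≤ r * t n := fun n => by
    rw [norm_div, div_mul_eq_mul_div, div_le_iff₀ (norm_pos_iff.2 (hN0 n))]
    exact hw' n
  obtain ⟨T, hT, -⟩ := exists_weightedComp (fun n => c n / N n) (fun n => n + p) K'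
    (fun n => by
      have h1 := hwc n
      have h2 := ht (n + p)
      have h3 := hK' n
      have h4 := ht n
      have h5 : 0 ≤ ‖c n / N n‖ := norm_nonneg _
      nlinarith) ((add_left_injective p).injOn)
  obtain ⟨U₂, hU₂, hU₂', hn₂⟩ := exists_inverse_one_sub_weightedComp _ _
    ((add_left_injective p).injOn) T hT t K' r hr ht hK' hwc
  have hfac : D - lam • 1 = -(Nd * (1 - T) * Q) := by
    ext x n
    change D x n - lam * x n = -(Nd (Q x - T (Q x)) n)
    rw [hD.sub_apply_eq lam m N hN hα Q hQ, hNd]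
    change _ = -(N n * (Q x n - T (Q x) n))
    rw [hT]
    field_simp [hN0 n]
    ring
  have hNN : Nd * Ni = 1 := by
    ext x n
    change Nd (Ni x) n = x n
    rw [hNd, hNi]
    exact mul_inv_cancel_left₀ (hN0 n) _
  have hNN' : Ni * Nd = 1 := by
    ext x n
    change Ni (Nd x) n = x n
    rw [hNi, hNd]
    exact inv_mul_cancel_left₀ (hN0 n) _
  refine ⟨-(U₁ * U₂ * Ni), ?_, ?_, ?_⟩
  · calc -(U₁ * U₂ * Ni) * (D - lam • 1) = U₁ * (U₂ * ((Ni * Nd) * (1 - T))) * Q := by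
          rw [hfac, neg_mul_neg]; simp only [mul_assoc]
      _ = 1 := by rw [hNN', one_mul, hU₂, mul_one, hU₁]
  · calc (D - lam • 1) * -(U₁ * U₂ * Ni) = Nd * ((1 - T) * ((Q * U₁) * U₂)) * Ni := by
          rw [hfac, neg_mul_neg]; simp only [mul_assoc]
      _ = 1 := by rw [hU₁', one_mul, hU₂', mul_one, hNN]
  · have h1 : 0 < 1 - r := by linarith
    have hK0 : 0 ≤ K := by linarith [hs 0, hK 0]
    have hK0' : 0 ≤ K' := by linarith [ht 0, hK' 0]
    rw [norm_neg]
    calc ‖U₁ * U₂ * Ni‖ ≤ ‖U₁‖ * ‖U₂‖ * ‖Ni‖ :=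
          (norm_mul_le _ _).trans (by gcongr; exact norm_mul_le _ _)
      _ ≤ _ := by gcongr

/-- If one of the first `p` diagonal entries of the left factor vanishes, then the corresponding
basis vector is in its kernel, and the right factor is invertible. -/
theorem IsThreeDiag.exists_eigenvector (hD : IsThreeDiag p α b c D) (lam : ℂ) (m N : ℕ → ℂ)
    (hN : ∀ n, N n = lam - b n - c n * m n) (hα : ∀ n, p ≤ n → α n = N n * m (n - p))
    (Bm : ℝ) (hm : ∀ n, ‖m n‖ ≤ Bm) (s : ℕ → ℝ)
    (K r : ℝ) (hr0 : 0 ≤ r) (hr : r < 1) (hs : ∀ n, 1 ≤ s n) (hK : ∀ n, s n ≤ K)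
    (hw : ∀ n, ‖m n‖ * s n ≤ r * s (n + p)) (k : ℕ) (hk : k < p) (hNk : N k = 0) :
    ∃ x : ℓ²(ℕ, ℂ), x ≠ 0 ∧ D x = lam • x := by
  obtain ⟨Q, U, hQ, hU, hU', -⟩ := exists_right_factor (p := p) m Bm hm s K r hr hs hK hr0 hw
  have hQx : Q (U (lp.single 2 k (1 : ℂ))) = lp.single 2 k (1 : ℂ) :=
    congrArg (fun T : ℓ²(ℕ, ℂ) →L[ℂ] ℓ²(ℕ, ℂ) => T (lp.single 2 k (1 : ℂ))) hU'
  refine ⟨U (lp.single 2 k (1 : ℂ)), fun h0 => ?_, ?_⟩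
  · rw [h0, map_zero] at hQx
    have := congrArg (fun x : ℓ²(ℕ, ℂ) => x k) hQx
    simp at this
  · ext n
    rw [← sub_eq_zero]
    change _ - lam * _ = 0
    rw [hD.sub_apply_eq lam m N hN hα Q hQ, hQx]
    have h1 : (lp.single 2 k (1 : ℂ) : ℓ²(ℕ, ℂ)) (n + p) = 0 :=
      lp.single_apply_ne _ _ _ (by omega)
    rw [h1, mul_zero, zero_sub, neg_eq_zero]
    by_cases hn : n = k
    · rw [hn, hNk, zero_mul]
    · rw [lp.single_apply_ne _ _ _ hn, mul_zero]

/-- A vector in the kernel of `D - lam` is determined by its first `p` coordinates. -/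
theorem IsThreeDiag.finiteDimensional_ker (hD : IsThreeDiag p α b c D) (hp : 1 ≤ p)
    (hc : ∀ n, c n ≠ 0) (lam : ℂ) :
    FiniteDimensional ℂ (LinearMap.ker ((D - lam • 1 : ℓ²(ℕ, ℂ) →L[ℂ] ℓ²(ℕ, ℂ)) :
      Module.End ℂ ℓ²(ℕ, ℂ))) := by
  set V := LinearMap.ker ((D - lam • 1 : ℓ²(ℕ, ℂ) →L[ℂ] ℓ²(ℕ, ℂ)) : Module.End ℂ ℓ²(ℕ, ℂ)) with hV
  let P : V →ₗ[ℂ] (Fin p → ℂ) :=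
    { toFun := fun x i => (x : ℓ²(ℕ, ℂ)) i
      map_add' := fun x y => rfl
      map_smul' := fun a x => rfl }
  refine FiniteDimensional.of_injective P ?_
  rw [injective_iff_map_eq_zero]
  rintro ⟨x, hx⟩ h0
  have hx' : ∀ n, D x n = lam * x n := fun n => by
    have h1 : D x - lam • x = 0 := hx
    have := congrArg (fun y : ℓ²(ℕ, ℂ) => y n) h1
    change D x n - lam * x n = 0 at this
    exact sub_eq_zero.1 this
  have hz : ∀ n, x n = 0 := by
    intro n
    induction n using Nat.strong_induction_on with
    | _ n ih =>
      rcases lt_or_ge n p with h | h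
      · exact congrFun h0 ⟨n, h⟩
      · obtain ⟨k, rfl⟩ := Nat.exists_eq_add_of_le' h
        have h1 := hx' k
        rw [hD, ih k (by omega)] at h1
        have h2 : (if p ≤ k then α k * x (k - p) else 0) = 0 := by
          split_ifs with h3
          · rw [ih (k - p) (by omega), mul_zero]
          · rfl
        rw [h2] at h1
        simpa [hc k] using h1
  ext n
  exact hz n

/-! ### Finite algebraic multiplicity -/

theorem finiteDimensional_ker_pow {V : Type*} [AddCommGroup V] [Module ℂ V] (T : Module.End ℂ V)
    [FiniteDimensional ℂ (LinearMap.ker T)] (n : ℕ) :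
    FiniteDimensional ℂ (LinearMap.ker (T ^ n)) := by
  induction n with
  | zero =>
    rw [pow_zero]
    have : LinearMap.ker (1 : Module.End ℂ V) = ⊥ := LinearMap.ker_id
    rw [this]
    infer_instance
  | succ n ih =>
    let g : LinearMap.ker (T ^ (n + 1)) →ₗ[ℂ] LinearMap.ker (T ^ n) :=
      T.restrict (fun x hx => by
        rw [LinearMap.mem_ker] at hx ⊢
        rwa [pow_succ] at hx)
    have hk : FiniteDimensional ℂ (LinearMap.ker g) := by
      let h : LinearMap.ker g →ₗ[ℂ] LinearMap.ker T :=
        { toFun := fun x => ⟨x.1.1, by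
            have := congrArg Subtype.val (LinearMap.mem_ker.1 x.2)
            exact this⟩
          map_add' := fun x y => rfl
          map_smul' := fun a x => rfl }
      refine FiniteDimensional.of_injective h ?_
      intro x y hxy
      apply Subtype.ext
      apply Subtype.ext
      exact congrArg (fun z : LinearMap.ker T => (z : V)) hxy
    have hq : FiniteDimensional ℂ (LinearMap.ker (T ^ (n + 1)) ⧸ LinearMap.ker g) :=
      Module.Finite.equiv g.quotKerEquivRange.symm
    exact Module.Finite.of_submodule_quotient (LinearMap.ker g)

/-- If `D - mu` is bounded below by a constant multiple of `‖mu - lam‖ ^ m` for some `mu ≠ lam`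
arbitrarily close to `lam`, then Jordan chains of `D` at `lam` have length at most `m`: on a vector
with `(D - lam) ^ k x = 0` the operator `D - mu` takes `∑ (mu - lam) ^ (k - 1 - j) (D - lam) ^ j x`
to `-(mu - lam) ^ k x`. -/
theorem finiteDimensional_maxGenEigenspace (D : ℓ²(ℕ, ℂ) →L[ℂ] ℓ²(ℕ, ℂ)) (lam : ℂ)
    (hker : FiniteDimensional ℂ (LinearMap.ker ((D - lam • 1 : ℓ²(ℕ, ℂ) →L[ℂ] ℓ²(ℕ, ℂ)) :
      Module.End ℂ ℓ²(ℕ, ℂ)))) (m : ℕ) (C : ℝ)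
    (h : ∃ᶠ mu in 𝓝[≠] lam, ∀ x : ℓ²(ℕ, ℂ), ‖mu - lam‖ ^ m * ‖x‖ ≤ C * ‖(D - mu • 1) x‖) :
    FiniteDimensional ℂ (Module.End.maxGenEigenspace (D : Module.End ℂ ℓ²(ℕ, ℂ)) lam) := by
  set T : ℓ²(ℕ, ℂ) →L[ℂ] ℓ²(ℕ, ℂ) := D - lam • 1 with hT
  have hstep : ∀ (k : ℕ) (x : ℓ²(ℕ, ℂ)), (T ^ (m + k + 1)) x = 0 → (T ^ (m + k)) x = 0 := by
    intro k x hx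
    set y : ℂ → ℓ²(ℕ, ℂ) := fun mu =>
      ∑ j ∈ Finset.range (m + k + 1), (mu - lam) ^ (m + k - j) • (T ^ j) x with hy
    have hyD : ∀ mu, (D - mu • 1) (y mu) = -((mu - lam) ^ (m + k + 1) • x) := by
      intro mu
      have hc : Commute T ((mu - lam) • (1 : ℓ²(ℕ, ℂ) →L[ℂ] ℓ²(ℕ, ℂ))) :=
        (Commute.one_right T).smul_right _
      have hg := hc.mul_geom_sum₂ (m + k + 1)
      have h1 : D - mu • (1 : ℓ²(ℕ, ℂ) →L[ℂ] ℓ²(ℕ, ℂ)) = T - (mu - lam) • 1 := by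
        rw [hT, sub_smul]; abel
      have h2 := congrArg (fun S : ℓ²(ℕ, ℂ) →L[ℂ] ℓ²(ℕ, ℂ) => S x) hg
      rw [← h1] at h2
      simp only [sub_apply, hx, smul_pow, one_pow, zero_sub,
        smul_apply, one_apply_eq_self] at h2
      have hyS : y mu = (∑ j ∈ Finset.range (m + k + 1), T ^ j *
          (mu - lam) ^ (m + k + 1 - 1 - j) • (1 : ℓ²(ℕ, ℂ) →L[ℂ] ℓ²(ℕ, ℂ))) x := by
        rw [sum_apply]
        refine Finset.sum_congr rfl fun j _ => ?_
        rw [mul_smul_comm, mul_one, Nat.add_sub_cancel]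
        rfl
      rw [← h2, hyS]
      rfl
    have hlim : Tendsto y (𝓝[≠] lam) (𝓝 ((T ^ (m + k)) x)) := by
      have hcont : Continuous y := by
        rw [hy]
        fun_prop
      have h0 : y lam = (T ^ (m + k)) x := by
        rw [hy]
        simp only [sub_self]
        rw [Finset.sum_range_succ, Finset.sum_eq_zero]
        · simp
        · intro j hj
          rw [zero_pow (by have := Finset.mem_range.1 hj; omega), zero_smul]
      rw [← h0]
      exact hcont.continuousAt.tendsto.mono_left nhdsWithin_le_nhds
    have hlim2 : Tendsto (fun mu : ℂ => |C| * (‖mu - lam‖ ^ (k + 1) * ‖x‖)) (𝓝[≠] lam) (𝓝 0) := by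
      have hcont : Continuous (fun mu : ℂ => |C| * (‖mu - lam‖ ^ (k + 1) * ‖x‖)) := by fun_prop
      have := hcont.continuousAt (x := lam)
      have h3 := this.tendsto.mono_left (nhdsWithin_le_nhds (s := {lam}ᶜ))
      simpa using h3
    have hle : ∃ᶠ mu in 𝓝[≠] lam, ‖y mu‖ ≤ |C| * (‖mu - lam‖ ^ (k + 1) * ‖x‖) := by
      refine (h.and_eventually self_mem_nhdsWithin).mono ?_
      rintro mu ⟨h1, h2⟩
      have hpos : 0 < ‖mu - lam‖ := norm_pos_iff.2 (sub_ne_zero.2 h2)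
      have h3 := h1 (y mu)
      rw [hyD, norm_neg, norm_smul, norm_pow] at h3
      have h4 : C * (‖mu - lam‖ ^ (m + k + 1) * ‖x‖)
          ≤ ‖mu - lam‖ ^ m * (|C| * (‖mu - lam‖ ^ (k + 1) * ‖x‖)) := by
        calc C * (‖mu - lam‖ ^ (m + k + 1) * ‖x‖) ≤ |C| * (‖mu - lam‖ ^ (m + k + 1) * ‖x‖) := by
              gcongr; exact le_abs_self C
          _ = _ := by ring
      exact le_of_mul_le_mul_left (h3.trans h4) (by positivity)
    have hz : ‖(T ^ (m + k)) x‖ ≤ 0 := le_of_tendsto_of_tendsto_of_frequently hlim.norm hlim2 hle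
    exact norm_le_zero_iff.1 hz
  have hpow : ∀ (k : ℕ) (x : ℓ²(ℕ, ℂ)), (T ^ (m + k)) x = 0 → (T ^ m) x = 0 := by
    intro k
    induction k with
    | zero => exact fun x hx => hx
    | succ k ih => exact fun x hx => ih x (hstep k x hx)
  have hTE : ∀ (k : ℕ) (x : ℓ²(ℕ, ℂ)),
      (((D : Module.End ℂ ℓ²(ℕ, ℂ)) - lam • (1 : Module.End ℂ ℓ²(ℕ, ℂ))) ^ k) x = (T ^ k) x := by
    intro k
    induction k with
    | zero => exact fun x => rfl
    | succ k ih =>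
      intro x
      rw [pow_succ, pow_succ]
      exact ih (T x)
  have hfin := finiteDimensional_ker_pow ((T : Module.End ℂ ℓ²(ℕ, ℂ))) m
  refine Submodule.finiteDimensional_of_le
    (S₂ := LinearMap.ker ((T : Module.End ℂ ℓ²(ℕ, ℂ)) ^ m)) ?_
  intro x hx
  rw [Module.End.mem_maxGenEigenspace] at hx
  obtain ⟨k, hk⟩ := hx
  rw [LinearMap.mem_ker]
  have h1 : (T ^ k) x = 0 := by rw [← hTE]; exact hk
  have h2 : (T ^ (m + k)) x = 0 := by
    rw [pow_add]
    change (T ^ m) ((T ^ k) x) = 0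
    rw [h1, map_zero]
  have h3 := hpow k x h2
  rw [← hTE] at h3
  exact h3

end Operators

section Expansion

/-! ### Weighted norms of power series -/

/-- The partial sums `∑_{k < K} ‖g_k‖ v k` of a weighted `ℓ¹` norm of the coefficients. Working with
partial sums avoids summability side conditions in estimates of inverses. -/
def wnorm (v : ℕ → ℝ) (K : ℕ) (g : PowerSeries ℂ) : ℝ :=
  ∑ k ∈ Finset.range K, ‖PowerSeries.coeff k g‖ * v k

theorem wnorm_nonneg {v : ℕ → ℝ} (hv : ∀ k, 0 ≤ v k) (K : ℕ) (g : PowerSeries ℂ) :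
    0 ≤ wnorm v K g :=
  Finset.sum_nonneg fun k _ => mul_nonneg (norm_nonneg _) (hv k)

theorem wnorm_sub_le {v : ℕ → ℝ} (hv : ∀ k, 0 ≤ v k) (K : ℕ) (g h : PowerSeries ℂ) :
    wnorm v K (g - h) ≤ wnorm v K g + wnorm v K h := by
  unfold wnorm
  rw [← Finset.sum_add_distrib]
  refine Finset.sum_le_sum fun k _ => ?_
  rw [map_sub, ← add_mul]
  exact mul_le_mul_of_nonneg_right (norm_sub_le _ _) (hv k)

theorem wnorm_mul_le {v : ℕ → ℝ} (hv : ∀ k, 0 ≤ v k) (hmul : ∀ j k, v (j + k) ≤ v j * v k)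
    (K : ℕ) (g h : PowerSeries ℂ) : wnorm v K (g * h) ≤ wnorm v K g * wnorm v K h := by
  set F : ℕ × ℕ → ℝ := fun q =>
    (‖PowerSeries.coeff q.1 g‖ * v q.1) * (‖PowerSeries.coeff q.2 h‖ * v q.2) with hF
  have hF0 : ∀ q, 0 ≤ F q := fun q =>
    mul_nonneg (mul_nonneg (norm_nonneg _) (hv _)) (mul_nonneg (norm_nonneg _) (hv _))
  have h1 : wnorm v K (g * h) ≤ ∑ k ∈ Finset.range K,
      ∑ q ∈ Finset.range K ×ˢ Finset.range K with q.1 + q.2 = k, F q := by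
    refine Finset.sum_le_sum fun k hk => ?_
    have hset : Finset.HasAntidiagonal.antidiagonal k
        = (Finset.range K ×ˢ Finset.range K).filter (fun q => q.1 + q.2 = k) := by
      ext q
      have := Finset.mem_range.1 hk
      simp only [Finset.HasAntidiagonal.mem_antidiagonal, Finset.mem_filter,
        Finset.mem_product, Finset.mem_range]
      omega
    rw [← hset, PowerSeries.coeff_mul]
    calc _ ≤ (∑ q ∈ Finset.HasAntidiagonal.antidiagonal k,
          ‖PowerSeries.coeff q.1 g * PowerSeries.coeff q.2 h‖) * v k :=
          mul_le_mul_of_nonneg_right (norm_sum_le _ _) (hv k)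
      _ ≤ _ := by
          rw [Finset.sum_mul]
          refine Finset.sum_le_sum fun q hq => ?_
          rw [← Finset.HasAntidiagonal.mem_antidiagonal.1 hq, norm_mul, hF]
          calc _ ≤ ‖PowerSeries.coeff q.1 g‖ * ‖PowerSeries.coeff q.2 h‖ * (v q.1 * v q.2) := by
                gcongr
                exact hmul _ _
            _ = _ := by ring
  refine h1.trans ?_
  have h2 : wnorm v K g * wnorm v K h = ∑ q ∈ Finset.range K ×ˢ Finset.range K, F q := by
    rw [wnorm, wnorm, Finset.sum_mul_sum, Finset.sum_product]
  rw [h2]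
  exact Finset.sum_fiberwise_le_sum_of_sum_fiber_nonneg
    (fun k _ => Finset.sum_nonneg fun q _ => hF0 q)

/-- `g / (1 + g)`, as a formal power series. -/
def quot (g : PowerSeries ℂ) : PowerSeries ℂ := 1 - (1 + g)⁻¹

theorem one_add_mul_one_sub_quot (g : PowerSeries ℂ) (hg : 1 + PowerSeries.coeff 0 g ≠ 0) :
    (1 + g) * (1 - quot g) = 1 := by
  rw [quot, sub_sub_cancel]
  apply PowerSeries.mul_inv_cancel
  rw [map_add, map_one, ← PowerSeries.coeff_zero_eq_constantCoeff_apply]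
  exact hg

theorem wnorm_quot_le {v : ℕ → ℝ} (hv : ∀ k, 0 ≤ v k) (hmul : ∀ j k, v (j + k) ≤ v j * v k)
    (g : PowerSeries ℂ) (hg : 1 + PowerSeries.coeff 0 g ≠ 0) (K : ℕ) (x : ℝ) (hx : x < 1)
    (hgx : wnorm v K g ≤ x) : wnorm v K (quot g) ≤ x / (1 - x) := by
  have h1 : quot g = g - g * quot g := by
    have := one_add_mul_one_sub_quot g hg
    linear_combination -this
  have h2 : wnorm v K (quot g) ≤ x + x * wnorm v K (quot g) := by
    calc wnorm v K (quot g) = wnorm v K (g - g * quot g) := by rw [← h1]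
      _ ≤ wnorm v K g + wnorm v K (g * quot g) := wnorm_sub_le hv _ _ _
      _ ≤ x + x * wnorm v K (quot g) := by
          gcongr
          exact (wnorm_mul_le hv hmul _ _ _).trans
            (mul_le_mul_of_nonneg_right hgx (wnorm_nonneg hv _ _))
  rw [le_div_iff₀ (by linarith)]
  linarith

/-! ### Continued fraction expansion of a perturbation of the free Jacobi matrix -/

/-- One step of the expansion: if `m = z (1 + g)` then
`(1 + g_0) / m = z + 1 / z - b - z (1 + g')` with a number `b` and the power series
`g' = schurStep g`. To first order in `g` the step discards the first two coefficients. -/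
def schurStep (g : PowerSeries ℂ) : PowerSeries ℂ :=
  PowerSeries.mk fun k => (1 + PowerSeries.coeff 0 g) * PowerSeries.coeff (k + 2) (quot g)

/-- The iterates of `schurStep`. -/
def schurSeq (g : PowerSeries ℂ) : ℕ → PowerSeries ℂ
  | 0 => g
  | n + 1 => schurStep (schurSeq g n)

/-- The properties of a weight on which the estimates rest. The inequality `mul_le` says that all
the shifted weights `k ↦ ω (k + N) / ω N` are submultiplicative. -/
structure IsGoodWeight (ω : ℕ → ℝ) : Prop where
  one_le : ∀ n, 1 ≤ ω n
  mono : Monotone ω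
  mul_le : ∀ j k N, ω (j + k + N) * ω N ≤ ω (j + N) * ω (k + N)

/-- The weight used for the `n`-th iterate. -/
def shiftWeight (ω : ℕ → ℝ) (n k : ℕ) : ℝ := ω (k + 2 * n) / ω (2 * n)

variable {ω : ℕ → ℝ}

theorem IsGoodWeight.pos (hω : IsGoodWeight ω) (n : ℕ) : 0 < ω n :=
  zero_lt_one.trans_le (hω.one_le n)

theorem IsGoodWeight.one_le_shiftWeight (hω : IsGoodWeight ω) (n k : ℕ) :
    1 ≤ shiftWeight ω n k := by
  rw [shiftWeight, le_div_iff₀ (hω.pos _), one_mul]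
  exact hω.mono (by omega)

theorem IsGoodWeight.shiftWeight_nonneg (hω : IsGoodWeight ω) (n k : ℕ) :
    0 ≤ shiftWeight ω n k :=
  zero_le_one.trans (hω.one_le_shiftWeight n k)

theorem IsGoodWeight.shiftWeight_mul (hω : IsGoodWeight ω) (n j k : ℕ) :
    shiftWeight ω n (j + k) ≤ shiftWeight ω n j * shiftWeight ω n k := by
  have h := hω.pos (2 * n)
  rw [shiftWeight, shiftWeight, shiftWeight, div_mul_div_comm, div_le_div_iff₀ h (by positivity)]
  nlinarith [hω.mul_le j k (2 * n)]

theorem IsGoodWeight.norm_coeff_zero_le (hω : IsGoodWeight ω) (n : ℕ) (g : PowerSeries ℂ) (x : ℝ)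
    (hg : ∀ K, wnorm (shiftWeight ω n) K g ≤ x) (k : ℕ) : ‖PowerSeries.coeff k g‖ ≤ x := by
  refine le_trans ?_ (hg (k + 1))
  calc ‖PowerSeries.coeff k g‖ ≤ ‖PowerSeries.coeff k g‖ * shiftWeight ω n k :=
        le_mul_of_one_le_right (norm_nonneg _) (hω.one_le_shiftWeight n k)
    _ ≤ _ := Finset.single_le_sum (f := fun k => ‖PowerSeries.coeff k g‖ * shiftWeight ω n k)
        (fun i _ => mul_nonneg (norm_nonneg _) (hω.shiftWeight_nonneg n i)) (by simp)

theorem one_add_ne_zero_of_norm_lt {a : ℂ} (ha : ‖a‖ < 1) : 1 + a ≠ 0 := by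
  intro h
  have : a = -1 := by linear_combination h
  rw [this] at ha
  simp at ha

theorem IsGoodWeight.wnorm_schurStep_le (hω : IsGoodWeight ω) (n : ℕ) (g : PowerSeries ℂ) (x : ℝ)
    (hx : x < 1) (hg : ∀ K, wnorm (shiftWeight ω n) K g ≤ x) (K : ℕ) :
    wnorm (shiftWeight ω (n + 1)) K (schurStep g)
      ≤ (1 + x) * (x / (1 - x)) * (ω (2 * n) / ω (2 * (n + 1))) := by
  have hv := hω.shiftWeight_nonneg n
  have hx0 : 0 ≤ x := (wnorm_nonneg hv 0 g).trans (hg 0)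
  have h0 := hω.norm_coeff_zero_le n g x hg 0
  have hq := wnorm_quot_le hv (hω.shiftWeight_mul n) g
    (one_add_ne_zero_of_norm_lt (h0.trans_lt hx)) (2 + K) x hx (hg _)
  have hr : 0 ≤ ω (2 * n) / ω (2 * (n + 1)) := (div_pos (hω.pos _) (hω.pos _)).le
  have h1 : ∑ k ∈ Finset.range K, ‖PowerSeries.coeff (k + 2) (quot g)‖ * shiftWeight ω n (k + 2)
      ≤ x / (1 - x) := by
    refine le_trans ?_ hq
    rw [wnorm, Finset.sum_range_add]
    have : 0 ≤ ∑ k ∈ Finset.range 2, ‖PowerSeries.coeff k (quot g)‖ * shiftWeight ω n k :=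
      Finset.sum_nonneg fun i _ => mul_nonneg (norm_nonneg _) (hv i)
    simp only [add_comm 2]
    linarith
  have h2 : wnorm (shiftWeight ω (n + 1)) K (schurStep g)
      = ‖1 + PowerSeries.coeff 0 g‖ * (∑ k ∈ Finset.range K,
        ‖PowerSeries.coeff (k + 2) (quot g)‖ * shiftWeight ω n (k + 2))
        * (ω (2 * n) / ω (2 * (n + 1))) := by
    rw [wnorm, Finset.mul_sum, Finset.sum_mul]
    refine Finset.sum_congr rfl fun k _ => ?_
    rw [schurStep, PowerSeries.coeff_mk, norm_mul, shiftWeight, shiftWeight]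
    have h3 := (hω.pos (2 * n)).ne'
    have h4 := (hω.pos (2 * (n + 1))).ne'
    rw [show k + 2 + 2 * n = k + 2 * (n + 1) by ring]
    field_simp
  rw [h2]
  have h5 : ‖1 + PowerSeries.coeff 0 g‖ ≤ 1 + x := by
    refine (norm_add_le _ _).trans ?_
    rw [norm_one]
    linarith
  have h6 : 0 ≤ x / (1 - x) := div_nonneg hx0 (by linarith)
  gcongr
  exact Finset.sum_nonneg fun i _ => mul_nonneg (norm_nonneg _) (hv _)

theorem one_add_div_one_sub_le_exp (x : ℝ) (hx0 : 0 ≤ x) (hx : x ≤ 1 / 2) :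
    (1 + x) / (1 - x) ≤ Real.exp (3 * x) := by
  rw [div_le_iff₀ (by linarith), show 3 * x = x + 2 * x by ring, Real.exp_add]
  have h1 : 1 + x ≤ Real.exp x := by linarith [Real.add_one_le_exp x]
  have h2 : 1 + 2 * x ≤ Real.exp (2 * x) := by linarith [Real.add_one_le_exp (2 * x)]
  have h3 : 1 ≤ Real.exp (2 * x) * (1 - x) := by nlinarith
  nlinarith [Real.exp_pos x]

/-- The norms of the iterates decay like `1 / ω (2 n)`: each step gains exactly the quotient of two
successive values, up to a factor `exp (3 x)` with `x` of the size of the iterate itself, and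
the product of these factors converges. -/
theorem IsGoodWeight.wnorm_schurSeq_le (hω : IsGoodWeight ω) (S y : ℝ)
    (hS : ∀ n, ∑ j ∈ Finset.range n, (ω (2 * j))⁻¹ ≤ S) (hy0 : 0 ≤ y) (hy : y ≤ 1 / 4)
    (hyS : Real.exp (6 * y * S) ≤ 2) (g : PowerSeries ℂ)
    (hg : ∀ K, wnorm (shiftWeight ω 0) K g ≤ y / ω 0) (n K : ℕ) :
    wnorm (shiftWeight ω n) K (schurSeq g n) ≤ 2 * y / ω (2 * n) := by
  have hE : ∀ n, Real.exp (6 * y * ∑ j ∈ Finset.range n, (ω (2 * j))⁻¹) ≤ 2 := fun n =>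
    (Real.exp_le_exp.2 (by gcongr; exact hS n)).trans hyS
  have key : ∀ n K, wnorm (shiftWeight ω n) K (schurSeq g n)
      ≤ y / ω (2 * n) * Real.exp (6 * y * ∑ j ∈ Finset.range n, (ω (2 * j))⁻¹) := by
    intro n
    induction n with
    | zero => intro K; simpa [schurSeq] using hg K
    | succ n ih =>
      intro K
      set e := Real.exp (6 * y * ∑ j ∈ Finset.range n, (ω (2 * j))⁻¹) with he
      set x := y / ω (2 * n) * e with hxdef
      have hωn := hω.pos (2 * n)
      have hωn' := hω.pos (2 * (n + 1))
      have he0 : 0 < e := Real.exp_pos _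
      have hx0 : 0 ≤ x := by positivity
      have hx2 : x ≤ 2 * y / ω (2 * n) := by
        rw [hxdef, mul_comm 2 y, mul_div_right_comm]
        gcongr
        exact hE n
      have hyw : y / ω (2 * n) ≤ y := div_le_self hy0 (hω.one_le _)
      have hxh : x ≤ 1 / 2 := by
        have : 2 * y / ω (2 * n) = 2 * (y / ω (2 * n)) := by ring
        linarith
      have h1 := hω.wnorm_schurStep_le n (schurSeq g n) x (by linarith) ih K
      have h2 : (1 + x) * (x / (1 - x)) ≤ x * Real.exp (3 * x) := by
        have := mul_le_mul_of_nonneg_left (one_add_div_one_sub_le_exp x hx0 hxh) hx0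
        calc _ = x * ((1 + x) / (1 - x)) := by ring
          _ ≤ _ := this
      have h3 : Real.exp (3 * x) ≤ Real.exp (6 * y * (ω (2 * n))⁻¹) := by
        apply Real.exp_le_exp.2
        calc 3 * x ≤ 3 * (2 * y / ω (2 * n)) := by linarith
          _ = _ := by ring
      have hr : 0 ≤ ω (2 * n) / ω (2 * (n + 1)) := by positivity
      calc wnorm (shiftWeight ω (n + 1)) K (schurSeq g (n + 1))
          ≤ (1 + x) * (x / (1 - x)) * (ω (2 * n) / ω (2 * (n + 1))) := h1
        _ ≤ x * Real.exp (6 * y * (ω (2 * n))⁻¹) * (ω (2 * n) / ω (2 * (n + 1))) := by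
            refine mul_le_mul_of_nonneg_right (h2.trans ?_) hr
            exact mul_le_mul_of_nonneg_left h3 hx0
        _ = y / ω (2 * (n + 1)) *
            Real.exp (6 * y * ∑ j ∈ Finset.range (n + 1), (ω (2 * j))⁻¹) := by
            rw [Finset.sum_range_succ, mul_add (6 * y), Real.exp_add, hxdef, he]
            field_simp
  refine (key n K).trans ?_
  rw [mul_comm 2 y, mul_div_right_comm]
  have := hω.pos (2 * n)
  gcongr
  exact hE n

/-! ### Values of the power series in the closed disc -/

/-- The sum of a power series. It is used for absolutely summable coefficients and `‖z‖ ≤ 1`. -/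
def evalSeries (g : PowerSeries ℂ) (z : ℂ) : ℂ := ∑' k, PowerSeries.coeff k g * z ^ k

/-- Absolute summability of the coefficients. -/
def AbsSummable (g : PowerSeries ℂ) : Prop := Summable fun k => ‖PowerSeries.coeff k g‖

theorem AbsSummable.summable_norm {g : PowerSeries ℂ} (hg : AbsSummable g) {z : ℂ}
    (hz : ‖z‖ ≤ 1) : Summable fun k => ‖PowerSeries.coeff k g * z ^ k‖ := by
  refine Summable.of_nonneg_of_le (fun _ => norm_nonneg _) (fun k => ?_) hg
  rw [norm_mul, norm_pow]
  exact mul_le_of_le_one_right (norm_nonneg _) (pow_le_one₀ (norm_nonneg _) hz)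

theorem AbsSummable.one : AbsSummable 1 := by
  refine summable_of_ne_finset_zero (s := {0}) fun k hk => ?_
  rw [PowerSeries.coeff_one, if_neg (by simpa using hk), norm_zero]

theorem evalSeries_one (z : ℂ) : evalSeries 1 z = 1 := by
  rw [evalSeries, tsum_eq_single 0]
  · simp
  · intro k hk
    rw [PowerSeries.coeff_one, if_neg hk, zero_mul]

theorem AbsSummable.add {g h : PowerSeries ℂ} (hg : AbsSummable g) (hh : AbsSummable h) :
    AbsSummable (g + h) :=
  Summable.of_nonneg_of_le (fun _ => norm_nonneg _)
    (fun k => by rw [map_add]; exact norm_add_le _ _) (Summable.add hg hh)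

theorem AbsSummable.sub {g h : PowerSeries ℂ} (hg : AbsSummable g) (hh : AbsSummable h) :
    AbsSummable (g - h) :=
  Summable.of_nonneg_of_le (fun _ => norm_nonneg _)
    (fun k => by rw [map_sub]; exact norm_sub_le _ _) (Summable.add hg hh)

theorem evalSeries_add {g h : PowerSeries ℂ} (hg : AbsSummable g) (hh : AbsSummable h) {z : ℂ}
    (hz : ‖z‖ ≤ 1) : evalSeries (g + h) z = evalSeries g z + evalSeries h z := by
  rw [evalSeries, evalSeries, evalSeries,
    ← (hg.summable_norm hz).of_norm.tsum_add (hh.summable_norm hz).of_norm]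
  simp only [map_add, add_mul]

theorem evalSeries_sub {g h : PowerSeries ℂ} (hg : AbsSummable g) (hh : AbsSummable h) {z : ℂ}
    (hz : ‖z‖ ≤ 1) : evalSeries (g - h) z = evalSeries g z - evalSeries h z := by
  rw [evalSeries, evalSeries, evalSeries,
    ← (hg.summable_norm hz).of_norm.tsum_sub (hh.summable_norm hz).of_norm]
  simp only [map_sub, sub_mul]

theorem evalSeries_mul {g h : PowerSeries ℂ} (hg : AbsSummable g) (hh : AbsSummable h) {z : ℂ}
    (hz : ‖z‖ ≤ 1) : evalSeries (g * h) z = evalSeries g z * evalSeries h z := by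
  rw [evalSeries, evalSeries, evalSeries, tsum_mul_tsum_eq_tsum_sum_antidiagonal_of_summable_norm
    (hg.summable_norm hz) (hh.summable_norm hz)]
  refine tsum_congr fun k => ?_
  rw [PowerSeries.coeff_mul, Finset.sum_mul]
  refine Finset.sum_congr rfl fun q hq => ?_
  rw [← Finset.HasAntidiagonal.mem_antidiagonal.1 hq, pow_add]
  ring

theorem IsGoodWeight.absSummable (hω : IsGoodWeight ω) (n : ℕ) (g : PowerSeries ℂ) (x : ℝ)
    (hg : ∀ K, wnorm (shiftWeight ω n) K g ≤ x) : AbsSummable g := by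
  refine summable_of_sum_range_le (c := x) (fun _ => norm_nonneg _) fun K => le_trans ?_ (hg K)
  exact Finset.sum_le_sum fun k _ =>
    le_mul_of_one_le_right (norm_nonneg _) (hω.one_le_shiftWeight n k)

theorem IsGoodWeight.norm_evalSeries_le (hω : IsGoodWeight ω) (n : ℕ) (g : PowerSeries ℂ) (x : ℝ)
    (hg : ∀ K, wnorm (shiftWeight ω n) K g ≤ x) {z : ℂ} (hz : ‖z‖ ≤ 1) :
    ‖evalSeries g z‖ ≤ x := by
  have hs := hω.absSummable n g x hg
  refine (norm_tsum_le_tsum_norm (hs.summable_norm hz)).trans ?_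
  refine (hs.summable_norm hz).tsum_le_of_sum_range_le fun K => le_trans ?_ (hg K)
  refine Finset.sum_le_sum fun k _ => ?_
  rw [norm_mul, norm_pow]
  calc _ ≤ ‖PowerSeries.coeff k g‖ :=
        mul_le_of_le_one_right (norm_nonneg _) (pow_le_one₀ (norm_nonneg _) hz)
    _ ≤ _ := le_mul_of_one_le_right (norm_nonneg _) (hω.one_le_shiftWeight n k)

/-- The functional equation of one step of the continued fraction expansion. -/
theorem schurStep_equation (g : PowerSeries ℂ) (hg0 : 1 + PowerSeries.coeff 0 g ≠ 0)
    (hg : AbsSummable g) (hq : AbsSummable (quot g)) {z : ℂ} (hz0 : z ≠ 0) (hz : ‖z‖ ≤ 1) :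
    1 + PowerSeries.coeff 0 g
      = (z + z⁻¹ - (1 + PowerSeries.coeff 0 g) * PowerSeries.coeff 1 (quot g)
          - z * (1 + evalSeries (schurStep g) z)) * (z * (1 + evalSeries g z)) := by
  set a := 1 + PowerSeries.coeff 0 g with ha
  have h1 : (1 + evalSeries g z) * (1 - evalSeries (quot g) z) = 1 := by
    have := congrArg (fun h => evalSeries h z) (one_add_mul_one_sub_quot g hg0)
    simp only [evalSeries_one] at this
    rwa [evalSeries_mul (AbsSummable.one.add hg) (AbsSummable.one.sub hq) hz,
      evalSeries_add AbsSummable.one hg hz, evalSeries_sub AbsSummable.one hq hz,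
      evalSeries_one] at this
  have h2 : a * (1 - PowerSeries.coeff 0 (quot g)) = 1 := by
    have := congrArg PowerSeries.constantCoeff (one_add_mul_one_sub_quot g hg0)
    simpa [ha] using this
  have h3 : evalSeries (quot g) z = PowerSeries.coeff 0 (quot g) + PowerSeries.coeff 1 (quot g) * z
      + z ^ 2 * ∑' k, PowerSeries.coeff (k + 2) (quot g) * z ^ k := by
    rw [evalSeries, ← (hq.summable_norm hz).of_norm.sum_add_tsum_nat_add 2, ← tsum_mul_left]
    simp only [Finset.sum_range_succ, Finset.sum_range_zero, pow_zero, pow_one, mul_one, zero_add]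
    congr 1
    refine tsum_congr fun k => ?_
    ring
  have h4 : evalSeries (schurStep g) z
      = a * ∑' k, PowerSeries.coeff (k + 2) (quot g) * z ^ k := by
    rw [evalSeries, ← tsum_mul_left]
    refine tsum_congr fun k => ?_
    rw [schurStep, PowerSeries.coeff_mk, mul_assoc]
  rw [h4]
  set t := ∑' k, PowerSeries.coeff (k + 2) (quot g) * z ^ k
  rw [h3] at h1
  field_simp
  linear_combination (-a) * h1 + (1 + evalSeries g z) * h2

/-- **Jacobi parameters from a small power series.** The function `z (1 + g z)` is expanded into an
infinite continued fraction whose parameters approach the free ones at the rate `1 / ω (2 n)`. -/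
theorem IsGoodWeight.exists_expansion (hω : IsGoodWeight ω) (S y : ℝ)
    (hS : ∀ n, ∑ j ∈ Finset.range n, (ω (2 * j))⁻¹ ≤ S) (hy0 : 0 ≤ y) (hy : y ≤ 1 / 8)
    (hyS : Real.exp (6 * y * S) ≤ 2) (g : PowerSeries ℂ)
    (hg : ∀ K, wnorm (shiftWeight ω 0) K g ≤ y / ω 0) :
    ∃ (a b : ℕ → ℂ) (u : ℕ → ℂ → ℂ), (∀ z, u 0 z = evalSeries g z) ∧
      (∀ n z, ‖z‖ ≤ 1 → ‖u n z‖ ≤ 2 * y / ω (2 * n)) ∧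
      (∀ n, ‖a n - 1‖ ≤ 2 * y / ω (2 * n)) ∧ (∀ n, ‖b n‖ ≤ 6 * y / ω (2 * n)) ∧
      ∀ n z, z ≠ 0 → ‖z‖ ≤ 1 →
        a n = (z + z⁻¹ - b n - z * (1 + u (n + 1) z)) * (z * (1 + u n z)) := by
  have hx := hω.wnorm_schurSeq_le S y hS hy0 (by linarith) hyS g hg
  have hx4 : ∀ n, 2 * y / ω (2 * n) ≤ 1 / 4 := fun n =>
    (div_le_self (by linarith) (hω.one_le _)).trans (by linarith)
  have hx0 : ∀ n, 0 ≤ 2 * y / ω (2 * n) := fun n => div_nonneg (by linarith) (hω.pos _).le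
  have h0 : ∀ n, ‖PowerSeries.coeff 0 (schurSeq g n)‖ ≤ 2 * y / ω (2 * n) := fun n =>
    hω.norm_coeff_zero_le n _ _ (hx n) 0
  have hne : ∀ n, 1 + PowerSeries.coeff 0 (schurSeq g n) ≠ 0 := fun n =>
    one_add_ne_zero_of_norm_lt ((h0 n).trans_lt (by linarith [hx4 n]))
  have hq : ∀ n K, wnorm (shiftWeight ω n) K (quot (schurSeq g n))
      ≤ 2 * y / ω (2 * n) / (1 - 2 * y / ω (2 * n)) := fun n K =>
    wnorm_quot_le (hω.shiftWeight_nonneg n) (hω.shiftWeight_mul n) _ (hne n) K _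
      (by linarith [hx4 n]) (hx n K)
  refine ⟨fun n => 1 + PowerSeries.coeff 0 (schurSeq g n),
    fun n => (1 + PowerSeries.coeff 0 (schurSeq g n)) * PowerSeries.coeff 1 (quot (schurSeq g n)),
    fun n z => evalSeries (schurSeq g n) z, fun z => rfl,
    fun n z hz => hω.norm_evalSeries_le n _ _ (hx n) hz, fun n => ?_, fun n => ?_,
    fun n z hz0 hz => ?_⟩
  · simpa using h0 n
  · have h1 := hω.norm_coeff_zero_le n _ _ (hq n) 1
    have h2 : 2 * y / ω (2 * n) / (1 - 2 * y / ω (2 * n)) ≤ 2 * (2 * y / ω (2 * n)) := by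
      rw [div_le_iff₀ (by linarith [hx4 n])]
      nlinarith [hx4 n, hx0 n]
    have h3 : ‖1 + PowerSeries.coeff 0 (schurSeq g n)‖ ≤ 3 / 2 := by
      refine (norm_add_le _ _).trans ?_
      rw [norm_one]
      linarith [h0 n, hx4 n]
    rw [norm_mul]
    calc _ ≤ 3 / 2 * (2 * (2 * y / ω (2 * n))) := by gcongr; exact h1.trans h2
      _ = 6 * y / ω (2 * n) := by ring
  · exact schurStep_equation _ (hne n) (hω.absSummable n _ _ (hx n))
      (hω.absSummable n _ _ (hq n)) hz0 hz

end Expansion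

/-! ### Estimates of Taylor coefficients -/

/-- The Taylor coefficients at the origin. -/
def taylorCoeff (f : ℂ → ℂ) (n : ℕ) : ℂ := (n.factorial : ℂ)⁻¹ * iteratedDeriv n f 0

theorem iteratedDeriv_add_apply (f : ℂ → ℂ) (j k : ℕ) :
    iteratedDeriv (j + k) f = iteratedDeriv j (iteratedDeriv k f) := by
  rw [iteratedDeriv_eq_iterate, iteratedDeriv_eq_iterate, iteratedDeriv_eq_iterate,
    Function.iterate_add_apply]

theorem differentiableOn_iteratedDeriv {f : ℂ → ℂ} {U : Set ℂ} (hU : IsOpen U)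
    (hf : DifferentiableOn ℂ f U) (k : ℕ) : DifferentiableOn ℂ (iteratedDeriv k f) U := by
  induction k with
  | zero => simpa using hf
  | succ k ih =>
    rw [iteratedDeriv_succ]
    exact ih.deriv hU

theorem diffContOnCl_ball {f : ℂ → ℂ} (hf : DifferentiableOn ℂ f (Metric.ball 0 1)) {r : ℝ}
    (hr : r < 1) : DiffContOnCl ℂ f (Metric.ball 0 r) :=
  (hf.mono ((Metric.closure_ball_subset_closedBall).trans
    (Metric.closedBall_subset_ball hr))).diffContOnCl

/-- A bound for the `k`-th derivative in the open unit disc gives a bound for all later Taylor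
coefficients. -/
theorem norm_taylorCoeff_mul_le {f : ℂ → ℂ} (hf : DifferentiableOn ℂ f (Metric.ball 0 1))
    (j k : ℕ) (B : ℝ) (hB : ∀ z ∈ Metric.ball (0 : ℂ) 1, ‖iteratedDeriv k f z‖ ≤ B) :
    ‖taylorCoeff f (j + k)‖ * ((j + k).descFactorial k : ℝ) ≤ B := by
  have hB0 : 0 ≤ B := (norm_nonneg _).trans (hB 0 (by simp))
  have hd := differentiableOn_iteratedDeriv Metric.isOpen_ball hf k
  have h1 : ∀ r : ℝ, 0 < r → r < 1 → ‖iteratedDeriv (j + k) f 0‖ * r ^ j ≤ j.factorial * B := by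
    intro r hr0 hr1
    rw [iteratedDeriv_add_apply]
    have := Complex.norm_iteratedDeriv_le_of_forall_mem_sphere_norm_le j hr0
      (diffContOnCl_ball hd hr1) (C := B) (fun z hz => hB z (by
        rw [mem_sphere_zero_iff_norm] at hz
        rw [mem_ball_zero_iff, hz]
        exact hr1))
    rwa [le_div_iff₀ (by positivity)] at this
  have h2 : ‖iteratedDeriv (j + k) f 0‖ ≤ j.factorial * B := by
    have ht : Tendsto (fun r : ℝ => ‖iteratedDeriv (j + k) f 0‖ * r ^ j) (𝓝[<] 1)
        (𝓝 (‖iteratedDeriv (j + k) f 0‖ * 1 ^ j)) := by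
      have : Continuous (fun r : ℝ => ‖iteratedDeriv (j + k) f 0‖ * r ^ j) := by fun_prop
      exact this.continuousAt.tendsto.mono_left nhdsWithin_le_nhds
    rw [one_pow, mul_one] at ht
    refine le_of_tendsto ht ?_
    filter_upwards [Ioo_mem_nhdsLT (zero_lt_one (α := ℝ))] with r hr
    exact h1 r hr.1 hr.2
  have h3 : ((j + k).factorial : ℝ) = j.factorial * ((j + k).descFactorial k : ℝ) := by
    have := Nat.factorial_mul_descFactorial (Nat.le_add_left k j)
    rw [Nat.add_sub_cancel] at this
    exact_mod_cast this.symm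
  have h4 : (0 : ℝ) < j.factorial := by exact_mod_cast Nat.factorial_pos j
  have h5 : (0 : ℝ) < (j + k).factorial := by exact_mod_cast Nat.factorial_pos _
  rw [taylorCoeff, norm_mul, norm_inv, RCLike.norm_natCast, inv_mul_eq_div, div_mul_eq_mul_div,
    div_le_iff₀ h5]
  calc ‖iteratedDeriv (j + k) f 0‖ * ((j + k).descFactorial k : ℝ)
      ≤ j.factorial * B * ((j + k).descFactorial k : ℝ) := by gcongr
    _ = _ := by rw [h3]; ring

theorem taylorCoeff_eq_circleAverage {F : ℂ → ℂ} (hF : DifferentiableOn ℂ F (Metric.ball 0 1))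
    (n : ℕ) {r : ℝ} (hr0 : 0 < r) (hr1 : r < 1) :
    taylorCoeff F n = Real.circleAverage (fun z => (z ^ n)⁻¹ * F z) 0 r := by
  rw [Real.circleAverage_eq_circleIntegral hr0.ne']
  have h := (diffContOnCl_ball hF hr1).circleIntegral_one_div_sub_center_pow_smul hr0 n
  have h2 : (∮ z in C(0, r), (z - 0)⁻¹ • ((z ^ n)⁻¹ * F z))
      = ∮ z in C(0, r), (1 / (z - 0) ^ (n + 1)) • F z := by
    congr 1
    ext z
    simp only [sub_zero, smul_eq_mul, pow_succ, one_div, mul_inv]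
    ring
  rw [h2, h, taylorCoeff, smul_eq_mul, smul_eq_mul]
  have : (2 * (Real.pi : ℂ) * Complex.I) ≠ 0 := Complex.two_pi_I_ne_zero
  field_simp

/-- The mean value of `‖1 - z‖ ^ (-2)` over the circle of radius `r < 1` is `1 / (1 - r ^ 2)`. -/
theorem circleAverage_inv_norm_sq {r : ℝ} (hr0 : 0 < r) (hr1 : r < 1) :
    Real.circleAverage (fun z : ℂ => (‖1 - z‖ ^ 2)⁻¹) 0 r = (1 - r ^ 2)⁻¹ := by
  have hne : ∀ z ∈ Metric.closedBall (0 : ℂ) r, 1 - z ≠ 0 := by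
    intro z hz h
    rw [mem_closedBall_zero_iff] at hz
    rw [← sub_eq_zero.1 h, norm_one] at hz
    linarith
  have hd : DifferentiableOn ℂ (fun z : ℂ => (1 + z) / (1 - z)) (Metric.closedBall 0 r) := by
    intro z hz
    have := hne z hz
    exact ((by fun_prop : DifferentiableAt ℂ (fun z : ℂ => 1 + z) z).div (by fun_prop)
      this).differentiableWithinAt
  have hav : Real.circleAverage (fun z : ℂ => (1 + z) / (1 - z)) 0 r = 1 := by
    have hdc : DiffContOnCl ℂ (fun z : ℂ => (1 + z) / (1 - z)) (Metric.ball 0 |r|) := by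
      rw [abs_of_pos hr0]
      exact (hd.mono Metric.closure_ball_subset_closedBall).diffContOnCl
    rw [hdc.circleAverage]
    simp
  have hci : CircleIntegrable (fun z : ℂ => (1 + z) / (1 - z)) 0 r :=
    (hd.continuousOn.mono Metric.sphere_subset_closedBall).circleIntegrable hr0.le
  have hre : Real.circleAverage (fun z : ℂ => (1 - r ^ 2) • (‖1 - z‖ ^ 2)⁻¹) 0 r = 1 := by
    have h1 : Real.circleAverage (Complex.reCLM ∘ fun z : ℂ => (1 + z) / (1 - z)) 0 r = 1 := by
      rw [Complex.reCLM.circleAverage_comp_comm hci, hav, Complex.reCLM_apply, Complex.one_re]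
    refine Eq.trans ?_ h1
    apply Real.circleAverage_congr_sphere
    intro z hz
    rw [abs_of_pos hr0, mem_sphere_zero_iff_norm] at hz
    have h2 : ‖1 - z‖ ^ 2 ≠ 0 := by
      have := norm_pos_iff.2 (hne z (by rw [mem_closedBall_zero_iff, hz]))
      positivity
    simp only [Function.comp_apply, Complex.reCLM_apply, smul_eq_mul, Complex.div_re]
    rw [← hz, Complex.normSq_eq_norm_sq, Complex.sq_norm z, Complex.normSq_apply]
    field_simp
    simp
    ring
  rw [Real.circleAverage_fun_smul, smul_eq_mul] at hre
  have : 1 - r ^ 2 ≠ 0 := by nlinarith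
  exact eq_inv_of_mul_eq_one_right hre

/-- A function that is `O(1 / ‖1 - z‖)` in the unit disc has Taylor coefficients `O(√n)`. -/
theorem norm_taylorCoeff_le_sqrt {F : ℂ → ℂ} (hF : DifferentiableOn ℂ F (Metric.ball 0 1)) (A : ℝ)
    (hA : ∀ z ∈ Metric.ball (0 : ℂ) 1, ‖F z‖ ≤ A / ‖1 - z‖) (n : ℕ) (hn : 1 ≤ n) :
    ‖taylorCoeff F n‖ ≤ 4 * A * Real.sqrt (n + 1) := by
  set r : ℝ := n / (n + 1) with hr
  have hn0 : (1 : ℝ) ≤ n := by exact_mod_cast hn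
  have hr0 : 0 < r := by positivity
  have hr1 : r < 1 := by rw [hr, div_lt_one (by positivity)]; linarith
  have hA0 : 0 ≤ A := by
    have := (norm_nonneg _).trans (hA 0 (by simp))
    simpa using this
  set τ := Real.sqrt (n + 1) with hτ
  have hτ0 : 0 < τ := Real.sqrt_pos.2 (by positivity)
  have hτ2 : τ ^ 2 = n + 1 := Real.sq_sqrt (by positivity)
  have hrn : (r ^ n)⁻¹ ≤ 4 := by
    have h1 : r⁻¹ ≤ Real.exp (1 / n) := by
      have : r⁻¹ = 1 / n + 1 := by rw [hr]; field_simp; ring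
      rw [this]
      exact Real.add_one_le_exp _
    have h2 : Real.exp (1 / n) ^ n = Real.exp 1 := by
      rw [← Real.exp_nat_mul]
      congr 1
      field_simp
    rw [← inv_pow]
    calc r⁻¹ ^ n ≤ Real.exp (1 / n) ^ n := by gcongr
      _ ≤ 4 := by rw [h2]; linarith [Real.exp_one_lt_d9]
  have hcont : ContinuousOn F (Metric.sphere 0 r) :=
    hF.continuousOn.mono (fun z hz => by
      rw [mem_sphere_zero_iff_norm] at hz
      rw [mem_ball_zero_iff, hz]
      exact hr1)
  have hne : ∀ z ∈ Metric.sphere (0 : ℂ) r, 0 < ‖1 - z‖ := by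
    intro z hz
    rw [mem_sphere_zero_iff_norm] at hz
    refine norm_pos_iff.2 fun h => ?_
    rw [← sub_eq_zero.1 h, norm_one] at hz
    linarith
  have hc2 : ContinuousOn (fun z : ℂ => (‖1 - z‖ ^ 2)⁻¹) (Metric.sphere 0 r) :=
    ContinuousOn.inv₀ (by fun_prop) (fun z hz => by have := hne z hz; positivity)
  have hci2 : CircleIntegrable (fun z : ℂ => (‖1 - z‖ ^ 2)⁻¹) 0 r := hc2.circleIntegrable hr0.le
  rw [taylorCoeff_eq_circleAverage hF n hr0 hr1]
  have h1 : ‖Real.circleAverage (fun z => (z ^ n)⁻¹ * F z) 0 r‖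
      ≤ Real.circleAverage (fun z => ‖(z ^ n)⁻¹ * F z‖) 0 r := by
    rw [Real.circleAverage_def, Real.circleAverage_def, norm_smul, smul_eq_mul,
      Real.norm_of_nonneg (by positivity)]
    gcongr
    exact intervalIntegral.norm_integral_le_integral_norm Real.two_pi_pos.le
  have h2 : Real.circleAverage (fun z => ‖(z ^ n)⁻¹ * F z‖) 0 r
      ≤ Real.circleAverage (fun z : ℂ => 2 * A * τ + (2 * A * τ⁻¹) • (‖1 - z‖ ^ 2)⁻¹) 0 r := by
    refine Real.circleAverage_mono ?_ ?_ ?_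
    · refine ContinuousOn.circleIntegrable hr0.le (ContinuousOn.norm (ContinuousOn.mul ?_ hcont))
      refine ContinuousOn.inv₀ (by fun_prop) fun z hz => ?_
      rw [mem_sphere_zero_iff_norm] at hz
      exact pow_ne_zero _ (norm_pos_iff.1 (by rw [hz]; exact hr0))
    · exact (circleIntegrable_const _ _ _).add (hci2.const_smul)
    · intro z hz
      rw [abs_of_pos hr0] at hz
      have h3 := hne z hz
      rw [mem_sphere_zero_iff_norm] at hz
      have h4 := hA z (by rw [mem_ball_zero_iff, hz]; exact hr1)
      rw [norm_mul, norm_inv, norm_pow, hz, smul_eq_mul]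
      have h5 : A / ‖1 - z‖ ≤ (A * τ + A * τ⁻¹ * (‖1 - z‖ ^ 2)⁻¹) / 2 := by
        have h6 : 0 ≤ A * τ * (1 - τ⁻¹ * ‖1 - z‖⁻¹) ^ 2 := by positivity
        have h7 : A * τ * (1 - τ⁻¹ * ‖1 - z‖⁻¹) ^ 2
            = A * τ + A * τ⁻¹ * (‖1 - z‖ ^ 2)⁻¹ - 2 * (A / ‖1 - z‖) := by
          field_simp
          ring
        linarith
      calc (r ^ n)⁻¹ * ‖F z‖ ≤ 4 * (A / ‖1 - z‖) := by gcongr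
        _ ≤ 4 * ((A * τ + A * τ⁻¹ * (‖1 - z‖ ^ 2)⁻¹) / 2) := by gcongr
        _ = _ := by ring
  refine h1.trans (h2.trans ?_)
  rw [Real.circleAverage_fun_add (f₁ := fun _ => 2 * A * τ)
    (f₂ := fun z : ℂ => (2 * A * τ⁻¹) • (‖1 - z‖ ^ 2)⁻¹) (circleIntegrable_const _ _ _)
    hci2.const_smul,
    Real.circleAverage_const, Real.circleAverage_fun_smul, circleAverage_inv_norm_sq hr0 hr1,
    smul_eq_mul]
  have h8 : (1 - r ^ 2)⁻¹ ≤ τ ^ 2 := by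
    rw [hτ2, inv_le_comm₀ (by nlinarith) (by positivity), hr]
    rw [div_pow, inv_eq_one_div, le_sub_iff_add_le, div_add_div _ _ (by positivity) (by positivity),
      div_le_one (by positivity)]
    nlinarith
  calc 2 * A * τ + 2 * A * τ⁻¹ * (1 - r ^ 2)⁻¹ ≤ 2 * A * τ + 2 * A * τ⁻¹ * τ ^ 2 := by gcongr
    _ = 4 * A * τ := by field_simp; ring

/-- Cauchy's estimate on discs whose radius is proportional to the distance to the point `1`. -/
theorem norm_iteratedDeriv_le_of_cone {f : ℂ → ℂ} {ρ : ℝ} (hρ : 0 < ρ) (B : ℝ → ℝ)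
    (hd : ∀ z ∈ Metric.ball (0 : ℂ) 1, ∀ z', ‖z' - z‖ ≤ ρ * ‖1 - z‖ → DifferentiableAt ℂ f z')
    (hB : ∀ z ∈ Metric.ball (0 : ℂ) 1, ∀ z', ‖z' - z‖ ≤ ρ * ‖1 - z‖ → ‖f z'‖ ≤ B ‖1 - z‖)
    (k : ℕ) {z : ℂ} (hz : z ∈ Metric.ball (0 : ℂ) 1) :
    ‖iteratedDeriv k f z‖ ≤ k.factorial * B ‖1 - z‖ / (ρ * ‖1 - z‖) ^ k := by
  have h0 : 0 < ‖1 - z‖ := by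
    refine norm_pos_iff.2 fun h => ?_
    rw [mem_ball_zero_iff, ← sub_eq_zero.1 h, norm_one] at hz
    exact lt_irrefl _ hz
  refine Complex.norm_iteratedDeriv_le_of_forall_mem_sphere_norm_le k (by positivity) ?_ ?_
  · refine DifferentiableOn.diffContOnCl fun z' hz' => ?_
    have := Metric.closure_ball_subset_closedBall hz'
    rw [mem_closedBall_iff_norm] at this
    exact (hd z hz z' this).differentiableWithinAt
  · intro z' hz'
    rw [mem_sphere_iff_norm] at hz'
    exact hB z hz z' hz'.le

theorem rpow_mul_exp_neg_le {X q t : ℝ} (hX : 0 < X) (hq : 0 < q) (ht : 0 ≤ t) :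
    X ^ t * Real.exp (-q * X) ≤ (t / q) ^ t := by
  rcases ht.eq_or_lt with rfl | ht
  · simpa using (mul_pos hq hX).le
  set Y := q * X / t with hY
  have hY0 : 0 < Y := by positivity
  have hXY : X = t / q * Y := by rw [hY]; field_simp
  have h1 : Y ≤ Real.exp (Y - 1) := by linarith [Real.add_one_le_exp (Y - 1)]
  have h2 : Y ^ t ≤ Real.exp ((Y - 1) * t) := by
    rw [Real.exp_mul]
    exact Real.rpow_le_rpow hY0.le h1 ht.le
  have h3 : (Y - 1) * t ≤ q * X := by
    have : Y * t = q * X := by rw [hY]; field_simp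
    nlinarith
  have h4 : X ^ t = (t / q) ^ t * Y ^ t := by
    rw [hXY, Real.mul_rpow (by positivity) hY0.le]
  have h5 : Y ^ t * Real.exp (-q * X) ≤ 1 := by
    calc Y ^ t * Real.exp (-q * X) ≤ Real.exp (q * X) * Real.exp (-q * X) := by
          gcongr
          exact h2.trans (Real.exp_le_exp.2 h3)
      _ = 1 := by rw [← Real.exp_add]; simp
  rw [h4, mul_assoc]
  exact mul_le_of_le_one_right (by positivity) h5

/-- A function that is flat of order `exp (- q ‖1 - z‖ ^ (-s))` at the point `1`, in a domain that
contains discs of radius `ρ ‖1 - z‖` around all points of the unit disc, has Taylor coefficients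
`O(exp (- c n ^ β))` with `β = s / (1 + s)`. The `k`-th derivative is of size
`A ^ k k ^ (k / β)`, and `k` is chosen proportional to `n ^ β`. -/
theorem exists_norm_taylorCoeff_le_exp {f : ℂ → ℂ} {ρ M q β : ℝ} (hρ : 0 < ρ) (hM : 0 ≤ M)
    (hq : 0 < q) (hβ : 0 < β) (hβ1 : β < 1)
    (hd : ∀ z ∈ Metric.ball (0 : ℂ) 1, ∀ z', ‖z' - z‖ ≤ ρ * ‖1 - z‖ → DifferentiableAt ℂ f z')
    (hB : ∀ z ∈ Metric.ball (0 : ℂ) 1, ∀ z', ‖z' - z‖ ≤ ρ * ‖1 - z‖ →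
      ‖f z'‖ ≤ M * Real.exp (-q * ‖1 - z‖ ^ (-(β / (1 - β))))) :
    ∃ c, 0 < c ∧ ∀ n : ℕ, ‖taylorCoeff f n‖ ≤ M * Real.exp 1 * Real.exp (-c * (n : ℝ) ^ β) := by
  set s := β / (1 - β) with hs
  have hs0 : 0 < s := div_pos hβ (by linarith)
  have hsβ : 1 + 1 / s = 1 / β := by rw [hs]; field_simp; ring
  have hf : DifferentiableOn ℂ f (Metric.ball 0 1) := fun z hz =>
    (hd z hz z (by simp; positivity)).differentiableWithinAt
  have hderiv : ∀ (k : ℕ), ∀ z ∈ Metric.ball (0 : ℂ) 1, ‖iteratedDeriv k f z‖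
      ≤ M * (k * ((k / (s * q)) ^ (1 / s)) / ρ) ^ k := by
    intro k z hz
    have h0 : 0 < ‖1 - z‖ := by
      refine norm_pos_iff.2 fun h => ?_
      rw [mem_ball_zero_iff, ← sub_eq_zero.1 h, norm_one] at hz
      exact lt_irrefl _ hz
    have h1 := norm_iteratedDeriv_le_of_cone hρ (fun x => M * Real.exp (-q * x ^ (-s))) hd hB k hz
    set x := ‖1 - z‖ with hx
    have h2 := rpow_mul_exp_neg_le (X := x ^ (-s)) (q := q) (t := k / s) (by positivity) hq
      (by positivity)
    have h3 : (x ^ (-s)) ^ ((k : ℝ) / s) = (x ^ k)⁻¹ := by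
      rw [← Real.rpow_mul h0.le, show -s * ((k : ℝ) / s) = -k by field_simp,
        Real.rpow_neg h0.le, Real.rpow_natCast]
    have h4 : ((k : ℝ) / s / q) ^ ((k : ℝ) / s) = ((k / (s * q)) ^ (1 / s)) ^ k := by
      rw [← Real.rpow_natCast, ← Real.rpow_mul (by positivity)]
      congr 1
      · field_simp
      · ring
    rw [h3, h4] at h2
    have h5 : (k.factorial : ℝ) ≤ (k : ℝ) ^ k := by exact_mod_cast Nat.factorial_le_pow k
    refine h1.trans ?_
    calc k.factorial * (M * Real.exp (-q * x ^ (-s))) / (ρ * x) ^ k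
        = M * k.factorial * ((x ^ k)⁻¹ * Real.exp (-q * x ^ (-s))) * (ρ ^ k)⁻¹ := by
          rw [mul_pow]; field_simp
      _ ≤ M * (k : ℝ) ^ k * ((k / (s * q)) ^ (1 / s)) ^ k * (ρ ^ k)⁻¹ := by gcongr
      _ = _ := by rw [div_pow, mul_pow]; field_simp
  set B₀ := max 1 (2 * ((s * q) ^ (1 / s))⁻¹ / ρ) with hB₀
  have hB1 : 1 ≤ B₀ := le_max_left _ _
  have hB2 : 2 * ((s * q) ^ (1 / s))⁻¹ / ρ ≤ B₀ := le_max_right _ _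
  have he : 2 ≤ Real.exp 1 := by linarith [Real.add_one_le_exp 1]
  have heB : 2 ≤ Real.exp 1 * B₀ := by nlinarith
  refine ⟨((Real.exp 1 * B₀) ^ β)⁻¹, by positivity, fun n => ?_⟩
  have hcoef : ∀ j k : ℕ, n = j + k → 2 * k ≤ n →
      ‖taylorCoeff f n‖ * ((n : ℝ) / 2) ^ k ≤ M * (k * ((k / (s * q)) ^ (1 / s)) / ρ) ^ k := by
    rintro j k hjk h2k
    have h1 := norm_taylorCoeff_mul_le hf j k _ (hderiv k)
    rw [← hjk] at h1
    refine le_trans ?_ h1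
    gcongr
    have h2 := Nat.pow_sub_le_descFactorial n k
    have h3 : ((n + 1 - k : ℕ) : ℝ) ^ k ≤ (n.descFactorial k : ℝ) := by exact_mod_cast h2
    refine le_trans ?_ h3
    gcongr
    rw [Nat.cast_sub (by omega)]
    have : (2 : ℝ) * k ≤ n := by exact_mod_cast h2k
    push_cast
    linarith
  rcases Nat.eq_zero_or_pos n with hn | hn
  · have h1 := hcoef n 0 rfl (by omega)
    rw [hn, Nat.cast_zero, Real.zero_rpow hβ.ne']
    rw [hn] at h1
    simp only [pow_zero, mul_one] at h1
    simp only [mul_zero, Real.exp_zero, mul_one]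
    nlinarith
  have hn0 : (0 : ℝ) < n := by exact_mod_cast hn
  set y := (n : ℝ) / (Real.exp 1 * B₀) with hy
  have hy0 : 0 < y := by positivity
  set k := ⌊y ^ β⌋₊ with hk
  have hky : (k : ℝ) ≤ y ^ β := Nat.floor_le (by positivity)
  have hky' : (k : ℝ) ^ (1 / β) ≤ y := by
    calc (k : ℝ) ^ (1 / β) ≤ (y ^ β) ^ (1 / β) := by gcongr
      _ = y := by
        rw [← Real.rpow_mul hy0.le]
        field_simp
        exact Real.rpow_one y
  have hyn : y ≤ n / 2 := by
    rw [hy]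
    gcongr
  have h2k : 2 * k ≤ n := by
    rcases Nat.eq_zero_or_pos k with h | h
    · omega
    · have h1 : (1 : ℝ) ≤ k := by exact_mod_cast h
      have h2 : (k : ℝ) ≤ (k : ℝ) ^ (1 / β) := by
        calc (k : ℝ) = (k : ℝ) ^ (1 : ℝ) := (Real.rpow_one _).symm
          _ ≤ _ := Real.rpow_le_rpow_of_exponent_le h1 (by rw [le_div_iff₀ hβ]; linarith)
      have h3 : 2 * (k : ℝ) ≤ n := by linarith
      exact_mod_cast h3
  have h1 := hcoef (n - k) k (by omega) h2k
  have h2 : (k : ℝ) * ((k / (s * q)) ^ (1 / s)) / ρ ≤ (n / 2) * Real.exp (-1) := by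
    have h3 : (k : ℝ) * ((k / (s * q)) ^ (1 / s)) / ρ
        = (k : ℝ) ^ (1 / β) * (((s * q) ^ (1 / s))⁻¹ / ρ) := by
      rw [Real.div_rpow (by positivity) (by positivity), ← hsβ]
      rcases Nat.eq_zero_or_pos k with h | h
      · rw [h, Nat.cast_zero, Real.zero_rpow (x := 1 + 1 / s) (by positivity)]
        ring
      · rw [Real.rpow_add (by exact_mod_cast h), Real.rpow_one]
        field_simp
    rw [h3]
    calc (k : ℝ) ^ (1 / β) * (((s * q) ^ (1 / s))⁻¹ / ρ) ≤ y * (B₀ / 2) := by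
          refine mul_le_mul hky' ?_ (by positivity) hy0.le
          linarith [hB2,
            (by ring : 2 * ((s * q) ^ (1 / s))⁻¹ / ρ = 2 * (((s * q) ^ (1 / s))⁻¹ / ρ))]
      _ = (n / 2) * Real.exp (-1) := by
          rw [hy, Real.exp_neg]
          field_simp
  have h4 : ‖taylorCoeff f n‖ * ((n : ℝ) / 2) ^ k ≤ M * Real.exp (-k) * ((n : ℝ) / 2) ^ k := by
    refine h1.trans ?_
    calc M * (k * ((k / (s * q)) ^ (1 / s)) / ρ) ^ k ≤ M * ((n / 2) * Real.exp (-1)) ^ k := by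
          gcongr
      _ = _ := by
        rw [mul_pow, ← Real.exp_nat_mul]
        ring_nf
  have h5 : ‖taylorCoeff f n‖ ≤ M * Real.exp (-k) := le_of_mul_le_mul_right h4 (by positivity)
  refine h5.trans ?_
  rw [mul_assoc, ← Real.exp_add]
  gcongr
  have h6 : y ^ β < k + 1 := Nat.lt_floor_add_one _
  have h7 : ((Real.exp 1 * B₀) ^ β)⁻¹ * (n : ℝ) ^ β = y ^ β := by
    rw [hy, Real.div_rpow (by positivity) (by positivity)]
    field_simp
  linarith

/-! ### A flat function with infinitely many zeros -/

/-- For `0 < s < 1` the map `w ↦ w ^ (-s)` takes a sector slightly larger than the right half-plane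
to a sector strictly smaller than it. -/
theorem exists_sector (s : ℝ) (hs : 0 < s) (hs1 : s < 1) : ∃ ρ κ : ℝ, 0 < ρ ∧ ρ ≤ 1 / 2 ∧ 0 < κ ∧
    ∀ w w' : ℂ, 0 < w.re → ‖w' - w‖ ≤ ρ * ‖w‖ →
      w' ∈ Complex.slitPlane ∧ 2 * κ * ‖w'‖ ^ (-s) ≤ (w' ^ (-(s : ℂ))).re := by
  have hpi := Real.pi_pos
  set θ := Real.pi * (3 - s) / 4 with hθ
  have hθ1 : Real.pi / 2 < θ := by rw [hθ]; nlinarith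
  have hθ2 : θ < Real.pi := by rw [hθ]; nlinarith
  have hθ3 : s * θ < Real.pi / 2 := by
    have : s * (3 - s) < 2 := by nlinarith
    rw [hθ]
    nlinarith
  have hcθ : Real.cos θ < 0 := Real.cos_neg_of_pi_div_two_lt_of_lt hθ1 (by linarith)
  have hcsθ : 0 < Real.cos (s * θ) := Real.cos_pos_of_mem_Ioo ⟨by nlinarith, hθ3⟩
  refine ⟨min (1 / 2) (-Real.cos θ / 2), Real.cos (s * θ) / 2, lt_min (by norm_num) (by linarith),
    min_le_left _ _, by linarith, fun w w' hw hww => ?_⟩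
  set ρ := min (1 / 2) (-Real.cos θ / 2) with hρ
  have hρ1 : ρ ≤ 1 / 2 := min_le_left _ _
  have hρ2 : ρ ≤ -Real.cos θ / 2 := min_le_right _ _
  have hw0 : 0 < ‖w‖ := norm_pos_iff.2 fun h => by rw [h] at hw; simp at hw
  have hn : ‖w‖ ≤ 2 * ‖w'‖ := by
    have h1 : ‖w‖ ≤ ‖w'‖ + ‖w' - w‖ := by
      have := norm_sub_le w' (w' - w)
      rwa [sub_sub_cancel] at this
    nlinarith
  have hw'0 : 0 < ‖w'‖ := by linarith
  have hre : Real.cos θ * ‖w'‖ < w'.re := by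
    have h1 : |(w' - w).re| ≤ ‖w' - w‖ := Complex.abs_re_le_norm _
    rw [Complex.sub_re] at h1
    have h2 := (abs_le.1 h1).1
    have h3 : ρ * ‖w‖ ≤ -Real.cos θ / 2 * (2 * ‖w'‖) := by
      have : 0 ≤ -Real.cos θ / 2 := by linarith
      gcongr
    linarith
  have hw'ne : w' ≠ 0 := norm_pos_iff.1 hw'0
  have harg : |w'.arg| < θ := by
    by_contra hcon
    push Not at hcon
    have h1 := Real.cos_le_cos_of_nonneg_of_le_pi (by linarith) (Complex.abs_arg_le_pi w') hcon
    rw [Real.cos_abs, Complex.cos_arg hw'ne, div_le_iff₀ hw'0] at h1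
    linarith
  refine ⟨?_, ?_⟩
  · rw [Complex.mem_slitPlane_iff_arg]
    refine ⟨fun h => ?_, hw'ne⟩
    rw [h, abs_of_pos hpi] at harg
    linarith
  · have h1 : (w' ^ (-(s : ℂ))).re = ‖w'‖ ^ (-s) * Real.cos (s * w'.arg) := by
      rw [Complex.cpow_def_of_ne_zero hw'ne, Complex.exp_re]
      have h2 : (Complex.log w' * -(s : ℂ)).re = Real.log ‖w'‖ * -s := by
        rw [← Complex.ofReal_neg, Complex.re_mul_ofReal, Complex.log_re]
      have h3 : (Complex.log w' * -(s : ℂ)).im = -(s * w'.arg) := by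
        rw [← Complex.ofReal_neg, Complex.im_mul_ofReal, Complex.log_im]
        ring
      rw [h2, h3, Real.cos_neg, Real.rpow_def_of_pos hw'0]
    have h4 : Real.cos (s * θ) ≤ Real.cos (s * w'.arg) := by
      rw [← Real.cos_abs (s * w'.arg), abs_mul, abs_of_pos hs]
      refine Real.cos_le_cos_of_nonneg_of_le_pi (by positivity) (by linarith) ?_
      gcongr
    rw [h1, show 2 * (Real.cos (s * θ) / 2) = Real.cos (s * θ) by ring, mul_comm]
    gcongr

/-- The function `exp (-x) * cos (σ x)`: it decays along a sector around the positive half-axis and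
has infinitely many zeros there. -/
def profile (σ : ℝ) (x : ℂ) : ℂ := Complex.exp (-x) * Complex.cos (σ * x)

theorem differentiable_profile (σ : ℝ) : Differentiable ℂ (profile σ) := by
  unfold profile
  fun_prop

theorem norm_profile_le (σ : ℝ) (hσ : 0 ≤ σ) (x : ℂ) :
    ‖profile σ x‖ ≤ Real.exp (-x.re + σ * |x.im|) := by
  have h1 : ‖Complex.cos (σ * x)‖ ≤ Real.exp (σ * |x.im|) := by
    rw [Complex.cos]
    have h2 : ‖Complex.exp (σ * x * Complex.I)‖ ≤ Real.exp (σ * |x.im|) := by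
      rw [Complex.norm_exp]
      apply Real.exp_le_exp.2
      rw [Complex.mul_I_re, Complex.im_ofReal_mul]
      have := mul_le_mul_of_nonneg_left (neg_abs_le x.im) hσ
      linarith
    have h3 : ‖Complex.exp (-(σ * x) * Complex.I)‖ ≤ Real.exp (σ * |x.im|) := by
      rw [Complex.norm_exp]
      apply Real.exp_le_exp.2
      rw [Complex.mul_I_re, Complex.neg_im, Complex.im_ofReal_mul]
      have := mul_le_mul_of_nonneg_left (le_abs_self x.im) hσ
      linarith
    rw [norm_div, Complex.norm_ofNat, div_le_iff₀ (by norm_num)]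
    exact (norm_add_le _ _).trans (by linarith)
  rw [profile, norm_mul, Complex.norm_exp, Complex.neg_re, Real.exp_add]
  gcongr

/-- A function of the unit disc, with value `1` at `0`, that has infinitely many zeros near the
point `1` and is flat there. For small `δ` it is a small perturbation of `(1 - z) ^ 2`. -/
def flatFun (s σ δ : ℝ) (z : ℂ) : ℂ :=
  (1 - z) ^ 2 * (profile σ (δ * (1 - z) ^ (-(s : ℂ))) / profile σ δ)

theorem one_sub_re_pos {z : ℂ} (hz : z ∈ Metric.ball (0 : ℂ) 1) : 0 < (1 - z).re := by
  rw [mem_ball_zero_iff] at hz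
  rw [Complex.sub_re, Complex.one_re]
  linarith [Complex.re_le_norm z]

theorem one_sub_norm_pos {z : ℂ} (hz : z ∈ Metric.ball (0 : ℂ) 1) : 0 < ‖1 - z‖ :=
  norm_pos_iff.2 fun h => by have := one_sub_re_pos hz; rw [h] at this; simp at this

/-- The zeros of `flatFun` in the unit disc accumulate at the point `1` only. -/
theorem finite_zeros_flatFun {s σ δ : ℝ} (hs : 0 < s) (hs1 : s < 1) (hσ : 0 < σ) (hδ : 0 < δ)
    (h0 : profile σ δ ≠ 0) (r : ℝ) (hr : 0 < r) :
    {z : ℂ | z ∈ Metric.ball (0 : ℂ) 1 ∧ flatFun s σ δ z = 0 ∧ r ≤ ‖1 - z‖}.Finite := by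
  set N : ℤ := ⌈σ * δ * r ^ (-s)⌉ with hN
  refine ((Set.finite_Icc (-N - 1) N).image (fun k : ℤ =>
    1 - Complex.exp (-(1 / s : ℂ) * Complex.log ((2 * k + 1) * Real.pi / 2 / (σ * δ))))).subset ?_
  rintro z ⟨hz, hf, hrz⟩
  have hw := one_sub_norm_pos hz
  have hwne : 1 - z ≠ 0 := norm_pos_iff.1 hw
  have hsne : (s : ℂ) ≠ 0 := by exact_mod_cast hs.ne'
  have hσne : (σ : ℂ) ≠ 0 := by exact_mod_cast hσ.ne'
  have hδne : (δ : ℂ) ≠ 0 := by exact_mod_cast hδ.ne'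
  rw [flatFun, mul_eq_zero, div_eq_zero_iff, profile, mul_eq_zero] at hf
  have hcos : Complex.cos (σ * (δ * (1 - z) ^ (-(s : ℂ)))) = 0 := by
    rcases hf with h | (h | h) | h
    · exact absurd h (pow_ne_zero 2 hwne)
    · exact absurd h (Complex.exp_ne_zero _)
    · exact h
    · exact absurd h h0
  obtain ⟨k, hk⟩ := Complex.cos_eq_zero_iff.1 hcos
  have hW : (1 - z) ^ (-(s : ℂ)) = (2 * k + 1) * Real.pi / 2 / (σ * δ) := by
    rw [← hk]
    field_simp
  refine ⟨k, ?_, ?_⟩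
  · have h1 : |(2 * k + 1 : ℝ)| * Real.pi / 2 ≤ σ * δ * r ^ (-s) := by
      have h2 := congrArg norm hk
      rw [norm_mul, norm_mul, Complex.norm_real, Complex.norm_real, ← Complex.ofReal_neg,
        Complex.norm_cpow_real, Real.norm_of_nonneg hσ.le, Real.norm_of_nonneg hδ.le] at h2
      have h3 : ‖(2 * k + 1 : ℂ) * Real.pi / 2‖ = |(2 * k + 1 : ℝ)| * Real.pi / 2 := by
        rw [show (2 * k + 1 : ℂ) * Real.pi / 2 =
            (((2 * k + 1) * Real.pi / 2 : ℝ) : ℂ) by push_cast; ring,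
          Complex.norm_real, Real.norm_eq_abs, abs_div, abs_mul, abs_of_pos Real.pi_pos]
        norm_num
      have h4 : ‖1 - z‖ ^ (-s) ≤ r ^ (-s) :=
        Real.rpow_le_rpow_of_nonpos hr hrz (by linarith)
      rw [← h3, ← h2, ← mul_assoc]
      exact mul_le_mul_of_nonneg_left h4 (mul_pos hσ hδ).le
    have h4 : |(2 * k + 1 : ℝ)| ≤ N := by
      have h5 : σ * δ * r ^ (-s) ≤ N := Int.le_ceil _
      have h6 : |(2 * k + 1 : ℝ)| ≤ |(2 * k + 1 : ℝ)| * Real.pi / 2 := by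
        have := abs_nonneg (2 * k + 1 : ℝ)
        nlinarith [Real.two_le_pi]
      linarith
    have h7 : |2 * k + 1| ≤ N := by exact_mod_cast h4
    rw [abs_le] at h7
    constructor <;> omega
  · have h1 : Complex.log ((1 - z) ^ (-(s : ℂ))) = Complex.log (1 - z) * -(s : ℂ) := by
      rw [Complex.cpow_def_of_ne_zero hwne]
      have him : (Complex.log (1 - z) * -(s : ℂ)).im = -(s * (1 - z).arg) := by
        rw [← Complex.ofReal_neg, Complex.im_mul_ofReal, Complex.log_im]
        ring
      have habs : |s * (1 - z).arg| < Real.pi := by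
        rw [abs_mul, abs_of_pos hs]
        have := Complex.abs_arg_le_pi (1 - z)
        nlinarith [Real.pi_pos, abs_nonneg (1 - z).arg]
      apply Complex.log_exp
      · rw [him]; linarith [(abs_lt.1 habs).2]
      · rw [him]; linarith [(abs_lt.1 habs).1]
    simp only
    rw [← hW, h1, show -(1 / s : ℂ) * (Complex.log (1 - z) * -(s : ℂ)) = Complex.log (1 - z) by
      field_simp, Complex.exp_log hwne]
    ring

theorem infinite_zeros_flatFun {s σ δ : ℝ} (hs : 0 < s) (hσ : 0 < σ) (hδ : 0 < δ) :
    {z : ℂ | z ∈ Metric.ball (0 : ℂ) 1 ∧ flatFun s σ δ z = 0}.Infinite := by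
  have hσδ : 0 < σ * δ := mul_pos hσ hδ
  obtain ⟨m₀, hm₀⟩ := exists_nat_gt (σ * δ)
  set Y : ℕ → ℝ := fun m => (2 * ((m + m₀ : ℕ) : ℝ) + 1) * Real.pi / 2 / (σ * δ) with hY
  have hY1 : ∀ m, 1 < Y m := by
    intro m
    rw [hY]
    simp only
    rw [one_lt_div hσδ]
    push_cast
    have : (0 : ℝ) ≤ m := Nat.cast_nonneg m
    nlinarith [Real.two_le_pi]
  have hY0 : ∀ m, 0 < Y m := fun m => zero_lt_one.trans (hY1 m)
  set w : ℕ → ℝ := fun m => Y m ^ (-(1 / s)) with hw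
  have hw0 : ∀ m, 0 < w m := fun m => Real.rpow_pos_of_pos (hY0 m) _
  have hw1 : ∀ m, w m < 1 := fun m => Real.rpow_lt_one_of_one_lt_of_neg (hY1 m)
    (by have : 0 < 1 / s := by positivity
        linarith)
  have hwY : ∀ m, w m ^ (-s) = Y m := by
    intro m
    rw [hw]
    simp only
    rw [← Real.rpow_mul (hY0 m).le, show -(1 / s) * -s = 1 by field_simp, Real.rpow_one]
  refine Set.infinite_of_injective_forall_mem (f := fun m : ℕ => (1 - (w m : ℂ))) ?_ ?_
  · intro m n hmn
    simp only [sub_right_inj] at hmn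
    have h1 : w m = w n := by exact_mod_cast hmn
    have h2 : Y m = Y n := by rw [← hwY, ← hwY, h1]
    rw [hY] at h2
    simp only at h2
    rw [div_left_inj' hσδ.ne', div_left_inj' two_ne_zero, mul_left_inj' Real.pi_pos.ne'] at h2
    have h3 : ((m + m₀ : ℕ) : ℝ) = ((n + m₀ : ℕ) : ℝ) := by linarith
    have h4 : m + m₀ = n + m₀ := by exact_mod_cast h3
    omega
  · intro m
    refine ⟨?_, ?_⟩
    · rw [mem_ball_zero_iff, ← Complex.ofReal_one, ← Complex.ofReal_sub, Complex.norm_real,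
        Real.norm_of_nonneg (by linarith [hw1 m])]
      linarith [hw0 m]
    · rw [flatFun, sub_sub_cancel, profile]
      have h1 : (w m : ℂ) ^ (-(s : ℂ)) = (Y m : ℂ) := by
        rw [← hwY m, Complex.ofReal_cpow (hw0 m).le, Complex.ofReal_neg]
      have h2 : Complex.cos (σ * (δ * (w m : ℂ) ^ (-(s : ℂ)))) = 0 := by
        rw [h1, Complex.cos_eq_zero_iff]
        refine ⟨((m + m₀ : ℕ) : ℤ), ?_⟩
        have hσne : (σ : ℂ) ≠ 0 := by exact_mod_cast hσ.ne'
        have hδne : (δ : ℂ) ≠ 0 := by exact_mod_cast hδ.ne'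
        rw [hY]
        push_cast
        field_simp
      rw [h2]
      simp

/-- The number `ρ` and the decay rate `κ` in the sector are those of `exists_sector`. -/
theorem norm_flatFun_le {s κ ρ : ℝ} (hs : 0 < s) (hκ : 0 < κ) (hρ : 0 < ρ)
    (hρ2 : ρ ≤ 1 / 2)
    (hsec : ∀ w w' : ℂ, 0 < w.re → ‖w' - w‖ ≤ ρ * ‖w‖ →
      w' ∈ Complex.slitPlane ∧ 2 * κ * ‖w'‖ ^ (-s) ≤ (w' ^ (-(s : ℂ))).re)
    {δ : ℝ} (hδ : 0 < δ) (h0 : 1 / 2 ≤ ‖profile κ δ‖) {z z' : ℂ}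
    (hz : z ∈ Metric.ball (0 : ℂ) 1) (hzz : ‖z' - z‖ ≤ ρ * ‖1 - z‖) :
    DifferentiableAt ℂ (flatFun s κ δ) z' ∧ ‖flatFun s κ δ z'‖
      ≤ 9 / 2 * ‖1 - z‖ ^ 2 * Real.exp (-(κ * δ * (3 / 2) ^ (-s)) * ‖1 - z‖ ^ (-s)) := by
  have hw := one_sub_norm_pos hz
  have hn : ‖(1 - z') - (1 - z)‖ ≤ ρ * ‖1 - z‖ := by
    rw [sub_sub_sub_cancel_left, norm_sub_rev]
    exact hzz
  obtain ⟨hslit, hre⟩ := hsec (1 - z) (1 - z') (one_sub_re_pos hz) hn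
  have hw' : 1 - z' ≠ 0 := Complex.slitPlane_ne_zero hslit
  have hw'0 : 0 < ‖1 - z'‖ := norm_pos_iff.2 hw'
  have hle : ‖1 - z'‖ ≤ 3 / 2 * ‖1 - z‖ := by
    have h1 : ‖1 - z'‖ ≤ ‖1 - z‖ + ‖(1 - z') - (1 - z)‖ := by
      have := norm_add_le (1 - z) ((1 - z') - (1 - z))
      rwa [add_sub_cancel] at this
    nlinarith
  refine ⟨?_, ?_⟩
  · have h1 : DifferentiableAt ℂ (fun z : ℂ => (1 - z) ^ (-(s : ℂ))) z' :=
      DifferentiableAt.cpow_const (by fun_prop) hslit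
    have h2 : DifferentiableAt ℂ (fun z : ℂ => profile κ (δ * (1 - z) ^ (-(s : ℂ)))) z' :=
      (differentiable_profile κ).differentiableAt.comp z' (h1.const_mul _)
    exact DifferentiableAt.mul (by fun_prop) (h2.div_const _)
  · set R := ‖1 - z'‖ ^ (-s) with hR
    have hR0 : 0 < R := Real.rpow_pos_of_pos hw'0 _
    have hnormW : ‖(1 - z') ^ (-(s : ℂ))‖ = R := by
      rw [← Complex.ofReal_neg, Complex.norm_cpow_real]
    have h1 : ‖profile κ (δ * (1 - z') ^ (-(s : ℂ)))‖ ≤ Real.exp (-(κ * δ) * R) := by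
      refine (norm_profile_le κ hκ.le _).trans (Real.exp_le_exp.2 ?_)
      rw [Complex.re_ofReal_mul, Complex.im_ofReal_mul, abs_mul, abs_of_pos hδ]
      have h2 := Complex.abs_im_le_norm ((1 - z') ^ (-(s : ℂ)))
      rw [hnormW] at h2
      have h3 := mul_le_mul_of_nonneg_left hre hδ.le
      have h4 := mul_le_mul_of_nonneg_left h2 (mul_pos hκ hδ).le
      linarith
    have h2 : (3 / 2) ^ (-s) * ‖1 - z‖ ^ (-s) ≤ R := by
      rw [← Real.mul_rpow (by norm_num) hw.le]
      exact Real.rpow_le_rpow_of_nonpos hw'0 hle (by linarith)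
    have h3 : Real.exp (-(κ * δ) * R)
        ≤ Real.exp (-(κ * δ * (3 / 2) ^ (-s)) * ‖1 - z‖ ^ (-s)) := by
      apply Real.exp_le_exp.2
      have := mul_le_mul_of_nonneg_left h2 (mul_pos hκ hδ).le
      linarith
    rw [flatFun, norm_mul, norm_div, norm_pow]
    have h4 : ‖1 - z'‖ ^ 2 ≤ 9 / 4 * ‖1 - z‖ ^ 2 := by nlinarith
    have h5 : ‖profile κ (δ * (1 - z') ^ (-(s : ℂ)))‖ / ‖profile κ δ‖
        ≤ 2 * Real.exp (-(κ * δ * (3 / 2) ^ (-s)) * ‖1 - z‖ ^ (-s)) := by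
      rw [div_le_iff₀ (by linarith)]
      have h6 := h1.trans h3
      have h7 := Real.exp_pos (-(κ * δ * (3 / 2) ^ (-s)) * ‖1 - z‖ ^ (-s))
      nlinarith
    calc _ ≤ 9 / 4 * ‖1 - z‖ ^ 2 *
          (2 * Real.exp (-(κ * δ * (3 / 2) ^ (-s)) * ‖1 - z‖ ^ (-s))) := by gcongr
      _ = _ := by ring

/-- The Taylor coefficients of `flatFun` from the second one on, compared with those of
`(1 - z) ^ 2`. -/
def flatDiff (s σ δ : ℝ) (k : ℕ) : ℂ :=
  taylorCoeff (flatFun s σ δ) (k + 2) - if k = 0 then 1 else 0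

theorem taylorCoeff_one_sub_sq (k : ℕ) :
    taylorCoeff (fun z => (1 - z) ^ 2) (k + 2) = if k = 0 then 1 else 0 := by
  have h1 : deriv (fun z : ℂ => (1 - z) ^ 2) = fun z => -2 * (1 - z) := by
    ext z
    have : HasDerivAt (fun z : ℂ => (1 - z) ^ 2) (2 * (1 - z) ^ 1 * (-1)) z :=
      ((hasDerivAt_id z).const_sub 1).pow 2
    rw [this.deriv]
    ring
  have h2 : deriv (fun z : ℂ => -2 * (1 - z)) = fun _ => 2 := by
    ext z
    have : HasDerivAt (fun z : ℂ => -2 * (1 - z)) (-2 * (-1)) z :=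
      ((hasDerivAt_id z).const_sub 1).const_mul (-2)
    rw [this.deriv]
    ring
  rw [taylorCoeff, iteratedDeriv_succ', iteratedDeriv_succ', h1, h2, iteratedDeriv_const]
  split_ifs with h
  · subst h
    norm_num
  · rw [mul_zero]

theorem tendsto_profile_one (σ : ℝ) : Tendsto (profile σ) (𝓝 0) (𝓝 1) := by
  have h := (differentiable_profile σ).continuous.tendsto 0
  have h0 : profile σ 0 = 1 := by simp [profile]
  rwa [h0] at h

/-! ### The weight -/

/-- The weight `(1 + k) ^ (5 / 4) * exp (c (1 + k) ^ β)`. The exponent `5 / 4` is larger than `1`,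
so that the reciprocals have a finite sum, uniformly in `c`, and smaller than `3 / 2`, so that
coefficients `O(k ^ (-5 / 2))` remain summable. -/
def weight (c β : ℝ) (k : ℕ) : ℝ := (1 + k : ℝ) ^ (5 / 4 : ℝ) * Real.exp (c * (1 + k : ℝ) ^ β)

theorem rpow_add_rpow_le {β a x y : ℝ} (hβ : 0 ≤ β) (hβ1 : β ≤ 1) (ha : 0 ≤ a) (hx : 0 ≤ x)
    (hy : 0 ≤ y) : (a + x + y) ^ β + a ^ β ≤ (a + x) ^ β + (a + y) ^ β := by
  rcases (add_nonneg hx hy).eq_or_lt with h | h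
  · have hx0 : x = 0 := by linarith
    have hy0 : y = 0 := by linarith
    simp [hx0, hy0]
  have hc := Real.concaveOn_rpow hβ hβ1
  have hm1 : a + x + y ∈ Set.Ici (0 : ℝ) := Set.mem_Ici.2 (by linarith)
  have hm2 : a ∈ Set.Ici (0 : ℝ) := Set.mem_Ici.2 ha
  have hxs : 0 ≤ x / (x + y) := by positivity
  have hys : 0 ≤ y / (x + y) := by positivity
  have hst : x / (x + y) + y / (x + y) = 1 := by field_simp
  have h1 := hc.2 hm1 hm2 hxs hys hst
  have h2 := hc.2 hm1 hm2 hys hxs (by rw [add_comm]; exact hst)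
  simp only [smul_eq_mul] at h1 h2
  rw [show x / (x + y) * (a + x + y) + y / (x + y) * a = a + x by field_simp; ring] at h1
  rw [show y / (x + y) * (a + x + y) + x / (x + y) * a = a + y by field_simp; ring] at h2
  have h3 : x / (x + y) * (a + x + y) ^ β + y / (x + y) * a ^ β
      + (y / (x + y) * (a + x + y) ^ β + x / (x + y) * a ^ β) = (a + x + y) ^ β + a ^ β := by
    field_simp
    ring
  linarith

theorem isGoodWeight_weight {c β : ℝ} (hc : 0 ≤ c) (hβ : 0 ≤ β) (hβ1 : β ≤ 1) :
    IsGoodWeight (weight c β) where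
  one_le n := by
    have h1 : (1 : ℝ) ≤ 1 + n := by simp
    have h2 : 1 ≤ (1 + n : ℝ) ^ (5 / 4 : ℝ) := Real.one_le_rpow h1 (by norm_num)
    have h3 : 1 ≤ Real.exp (c * (1 + n : ℝ) ^ β) := Real.one_le_exp (by positivity)
    exact one_le_mul_of_one_le_of_one_le h2 h3
  mono m n hmn := by
    unfold weight
    gcongr
  mul_le j k N := by
    unfold weight
    have h1 : (1 + (j + k + N : ℕ) : ℝ) ^ (5 / 4 : ℝ) * (1 + N : ℝ) ^ (5 / 4 : ℝ)
        ≤ (1 + (j + N : ℕ) : ℝ) ^ (5 / 4 : ℝ) * (1 + (k + N : ℕ) : ℝ) ^ (5 / 4 : ℝ) := by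
      rw [← Real.mul_rpow (by positivity) (by positivity),
        ← Real.mul_rpow (by positivity) (by positivity)]
      apply Real.rpow_le_rpow (by positivity) _ (by norm_num)
      push_cast
      have : (0 : ℝ) ≤ j * k := by positivity
      nlinarith
    have h2 := rpow_add_rpow_le hβ hβ1 (a := 1 + N) (x := j) (y := k) (by positivity)
      (by positivity) (by positivity)
    have h3 : Real.exp (c * (1 + (j + k + N : ℕ) : ℝ) ^ β) * Real.exp (c * (1 + N : ℝ) ^ β)
        ≤ Real.exp (c * (1 + (j + N : ℕ) : ℝ) ^ β) * Real.exp (c * (1 + (k + N : ℕ) : ℝ) ^ β) := by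
      rw [← Real.exp_add, ← Real.exp_add, ← mul_add, ← mul_add]
      apply Real.exp_le_exp.2
      apply mul_le_mul_of_nonneg_left _ hc
      push_cast
      rw [show (1 + (j + k + N) : ℝ) = 1 + N + j + k by ring,
        show (1 + (j + N) : ℝ) = 1 + N + j by ring, show (1 + (k + N) : ℝ) = 1 + N + k by ring]
      exact h2
    calc _ = ((1 + (j + k + N : ℕ) : ℝ) ^ (5 / 4 : ℝ) * (1 + N : ℝ) ^ (5 / 4 : ℝ))
          * (Real.exp (c * (1 + (j + k + N : ℕ) : ℝ) ^ β) * Real.exp (c * (1 + N : ℝ) ^ β)) := by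
          ring
      _ ≤ _ := mul_le_mul h1 h3 (by positivity) (by positivity)
      _ = _ := by ring

theorem summable_one_add_rpow {a : ℝ} (ha : a < -1) : Summable fun k : ℕ => (1 + k : ℝ) ^ a := by
  have h := (summable_nat_add_iff 1).2 (Real.summable_nat_rpow.2 ha)
  refine h.congr fun k => ?_
  push_cast
  rw [add_comm]

/-- The bound is independent of the parameter `c` of the weight. -/
theorem exists_sum_inv_weight_le : ∃ S : ℝ, 0 ≤ S ∧ ∀ c β : ℝ, 0 ≤ c → ∀ n : ℕ,
    ∑ j ∈ Finset.range n, (weight c β (2 * j))⁻¹ ≤ S := by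
  have hsum : Summable fun k : ℕ => (1 + k : ℝ) ^ (-(5 / 4) : ℝ) :=
    summable_one_add_rpow (by norm_num)
  refine ⟨∑' k : ℕ, (1 + k : ℝ) ^ (-(5 / 4) : ℝ), tsum_nonneg fun k => by positivity,
    fun c β hc n => ?_⟩
  refine le_trans (Finset.sum_le_sum fun j _ => ?_)
    (hsum.sum_le_tsum (Finset.range n) fun k _ => by positivity)
  rw [Real.rpow_neg (by positivity)]
  apply inv_anti₀ (by positivity)
  calc (1 + j : ℝ) ^ (5 / 4 : ℝ) ≤ (1 + (2 * j : ℕ) : ℝ) ^ (5 / 4 : ℝ) := by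
        gcongr
        omega
    _ ≤ weight c β (2 * j) := by
        unfold weight
        apply le_mul_of_one_le_right (by positivity)
        exact Real.one_le_exp (by positivity)

theorem summable_rpow_mul_exp_neg {a β : ℝ} (ha : 0 < a) (hβ : 0 < β) :
    Summable fun k : ℕ => (1 + k : ℝ) ^ (5 / 4 : ℝ) * Real.exp (-a * (1 + k : ℝ) ^ β) := by
  refine Summable.of_nonneg_of_le (fun k => by positivity) (fun k => ?_)
    ((summable_one_add_rpow (a := -(7 / 4)) (by norm_num)).mul_left ((3 / β / a) ^ (3 / β)))
  have hk : (0 : ℝ) < 1 + k := by positivity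
  have h := rpow_mul_exp_neg_le (X := (1 + k : ℝ) ^ β) (q := a) (t := 3 / β) (by positivity) ha
    (by positivity)
  rw [← Real.rpow_mul hk.le, mul_div_cancel₀ _ hβ.ne'] at h
  calc (1 + k : ℝ) ^ (5 / 4 : ℝ) * Real.exp (-a * (1 + k : ℝ) ^ β)
      = ((1 + k : ℝ) ^ (3 : ℝ) * Real.exp (-a * (1 + k : ℝ) ^ β)) *
        (1 + k : ℝ) ^ (-(7 / 4) : ℝ) := by
        rw [show (5 / 4 : ℝ) = 3 + -(7 / 4) by norm_num, Real.rpow_add hk]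
        ring
    _ ≤ _ := by gcongr

/-! ### Smallness of the perturbation -/

/-- The bound is uniform in `δ`. -/
theorem exists_norm_flatDiff_le {s κ ρ : ℝ} (hs : 0 < s) (hκ : 0 < κ) (hρ : 0 < ρ)
    (hρ2 : ρ ≤ 1 / 2)
    (hsec : ∀ w w' : ℂ, 0 < w.re → ‖w' - w‖ ≤ ρ * ‖w‖ →
      w' ∈ Complex.slitPlane ∧ 2 * κ * ‖w'‖ ^ (-s) ≤ (w' ^ (-(s : ℂ))).re) :
    ∃ C : ℝ, ∀ δ : ℝ, 0 < δ → 1 / 2 ≤ ‖profile κ δ‖ → ∀ k : ℕ,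
      ‖flatDiff s κ δ k‖ ≤ C * (1 + k : ℝ) ^ (-(5 / 2) : ℝ) := by
  set A : ℝ := 27 / ρ ^ 3 with hA
  have hA0 : 0 < A := by positivity
  refine ⟨(19 + 4 * A) * 2 ^ (5 / 2 : ℝ), fun δ hδ h0 k => ?_⟩
  have hB := fun z hz z' hzz => norm_flatFun_le hs hκ hρ hρ2 hsec hδ h0 (z := z) (z' := z') hz hzz
  have hexp : ∀ x : ℝ, 0 ≤ x →
      Real.exp (-(κ * δ * (3 / 2) ^ (-s)) * x ^ (-s)) ≤ 1 := fun x hx => by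
    apply Real.exp_le_one_iff.2
    have : 0 ≤ κ * δ * (3 / 2 : ℝ) ^ (-s) * x ^ (-s) := by positivity
    linarith
  have hB' : ∀ z ∈ Metric.ball (0 : ℂ) 1, ∀ z', ‖z' - z‖ ≤ ρ * ‖1 - z‖ →
      ‖flatFun s κ δ z'‖ ≤ 9 / 2 * ‖1 - z‖ ^ 2 := fun z hz z' hzz =>
    ((hB z hz z' hzz).2).trans (mul_le_of_le_one_right (by positivity) (hexp _ (norm_nonneg _)))
  have hdiff : DifferentiableOn ℂ (flatFun s κ δ) (Metric.ball 0 1) := fun z hz =>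
    (hB z hz z (by simp; positivity)).1.differentiableWithinAt
  have h18 : ∀ n, ‖taylorCoeff (flatFun s κ δ) n‖ ≤ 18 := by
    intro n
    have := norm_taylorCoeff_mul_le hdiff n 0 18 (fun z hz => by
      rw [iteratedDeriv_zero]
      refine (hB' z hz z (by simp; positivity)).trans ?_
      have h1 : ‖1 - z‖ ≤ 2 := by
        rw [mem_ball_zero_iff] at hz
        refine (norm_sub_le _ _).trans ?_
        rw [norm_one]
        linarith
      nlinarith [norm_nonneg (1 - z)])
    simpa using this
  have hk0 : (0 : ℝ) < 1 + k := by positivity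
  rcases lt_or_ge k 2 with hk | hk
  · have h1 : ‖flatDiff s κ δ k‖ ≤ 19 := by
      refine (norm_sub_le _ _).trans ?_
      have : ‖(if k = 0 then 1 else 0 : ℂ)‖ ≤ 1 := by split_ifs <;> simp
      linarith [h18 (k + 2)]
    have h2 : 1 ≤ 2 ^ (5 / 2 : ℝ) * (1 + k : ℝ) ^ (-(5 / 2) : ℝ) := by
      rw [Real.rpow_neg hk0.le, ← div_eq_mul_inv, one_le_div (by positivity)]
      gcongr
      have : (k : ℝ) ≤ 1 := by exact_mod_cast (by omega : k ≤ 1)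
      linarith
    rw [mul_assoc]
    nlinarith
  · obtain ⟨j, rfl⟩ := Nat.exists_eq_add_of_le' hk
    have hF := differentiableOn_iteratedDeriv Metric.isOpen_ball hdiff 3
    have h1 := norm_taylorCoeff_le_sqrt hF A (fun z hz => by
      refine (norm_iteratedDeriv_le_of_cone hρ (fun x => 9 / 2 * x ^ 2)
        (fun z hz z' hzz => (hB z hz z' hzz).1) hB' 3 hz).trans (le_of_eq ?_)
      have hw := one_sub_norm_pos hz
      rw [hA]
      simp only [Nat.factorial]
      push_cast
      field_simp
      norm_num) (j + 1) (by omega)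
    have h2 : taylorCoeff (iteratedDeriv 3 (flatFun s κ δ)) (j + 1)
        = ((j + 2) * (j + 3) * (j + 4) : ℝ) * taylorCoeff (flatFun s κ δ) (j + 2 + 2) := by
      rw [taylorCoeff, taylorCoeff, ← iteratedDeriv_add_apply]
      rw [show (j + 2 + 2).factorial = (j + 4) * ((j + 3) * ((j + 2) * (j + 1).factorial)) from rfl]
      have := Nat.factorial_ne_zero (j + 1)
      push_cast
      have h3 : ((j : ℂ) + 2) ≠ 0 := by exact_mod_cast (by omega : j + 2 ≠ 0)
      have h4 : ((j : ℂ) + 3) ≠ 0 := by exact_mod_cast (by omega : j + 3 ≠ 0)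
      have h5 : ((j : ℂ) + 4) ≠ 0 := by exact_mod_cast (by omega : j + 4 ≠ 0)
      have h6 : ((j + 1).factorial : ℂ) ≠ 0 := by exact_mod_cast this
      field_simp
    rw [h2, norm_mul, Complex.norm_real, Real.norm_of_nonneg (by positivity)] at h1
    have h3 : flatDiff s κ δ (j + 2) = taylorCoeff (flatFun s κ δ) (j + 2 + 2) := by
      rw [flatDiff, if_neg (by omega), sub_zero]
    rw [h3]
    set t := ‖taylorCoeff (flatFun s κ δ) (j + 2 + 2)‖ with ht
    have hx : (0 : ℝ) < j + 2 := by positivity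
    have h4 : t * (j + 2 : ℝ) ^ (5 / 2 : ℝ) ≤ 4 * A := by
      have h5 : Real.sqrt (((j + 1 : ℕ) : ℝ) + 1) = (j + 2 : ℝ) ^ (1 / 2 : ℝ) := by
        rw [Real.sqrt_eq_rpow]
        push_cast
        ring_nf
      rw [h5] at h1
      have h6 : (j + 2 : ℝ) ^ (5 / 2 : ℝ) * (j + 2 : ℝ) ^ (1 / 2 : ℝ) = (j + 2 : ℝ) ^ 3 := by
        rw [← Real.rpow_add hx, ← Real.rpow_natCast]
        norm_num
      have h7 : 0 < (j + 2 : ℝ) ^ (1 / 2 : ℝ) := by positivity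
      refine le_of_mul_le_mul_right ?_ h7
      calc t * (j + 2 : ℝ) ^ (5 / 2 : ℝ) * (j + 2 : ℝ) ^ (1 / 2 : ℝ) = (j + 2 : ℝ) ^ 3 * t := by
            rw [mul_assoc, h6, mul_comm]
        _ ≤ (j + 2) * (j + 3) * (j + 4) * t := by
            gcongr
            have hj : (0 : ℝ) ≤ j := Nat.cast_nonneg j
            nlinarith [mul_nonneg hj hj]
        _ ≤ _ := h1
    have h5 : (1 + (j + 2 : ℕ) : ℝ) ^ (5 / 2 : ℝ)
        ≤ 2 ^ (5 / 2 : ℝ) * (j + 2 : ℝ) ^ (5 / 2 : ℝ) := by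
      rw [← Real.mul_rpow (by norm_num) hx.le]
      gcongr
      push_cast
      linarith [(Nat.cast_nonneg j : (0 : ℝ) ≤ j)]
    rw [Real.rpow_neg hk0.le, ← div_eq_mul_inv, le_div_iff₀ (by positivity)]
    calc t * (1 + (j + 2 : ℕ) : ℝ) ^ (5 / 2 : ℝ)
        ≤ t * (2 ^ (5 / 2 : ℝ) * (j + 2 : ℝ) ^ (5 / 2 : ℝ)) := by gcongr
      _ = t * (j + 2 : ℝ) ^ (5 / 2 : ℝ) * 2 ^ (5 / 2 : ℝ) := by ring
      _ ≤ (19 + 4 * A) * 2 ^ (5 / 2 : ℝ) := by gcongr; linarith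

theorem tendsto_flatDiff {s κ ρ : ℝ} (hs : 0 < s) (hs1 : s < 1) (hκ : 0 < κ) (hρ : 0 < ρ)
    (hρ2 : ρ ≤ 1 / 2)
    (hsec : ∀ w w' : ℂ, 0 < w.re → ‖w' - w‖ ≤ ρ * ‖w‖ →
      w' ∈ Complex.slitPlane ∧ 2 * κ * ‖w'‖ ^ (-s) ≤ (w' ^ (-(s : ℂ))).re) (k : ℕ) :
    Tendsto (fun δ : ℝ => flatDiff s κ δ k) (𝓝[>] 0) (𝓝 0) := by
  have hdiv : Tendsto (fun q : ℂ × ℂ => profile κ q.1 / profile κ q.2) (𝓝 (0, 0)) (𝓝 1) := by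
    have h1 : Tendsto (fun q : ℂ × ℂ => profile κ q.1) (𝓝 (0, 0)) (𝓝 1) :=
      (tendsto_profile_one κ).comp (continuous_fst.tendsto' _ _ rfl)
    have h2 : Tendsto (fun q : ℂ × ℂ => profile κ q.2) (𝓝 (0, 0)) (𝓝 1) :=
      (tendsto_profile_one κ).comp (continuous_snd.tendsto' _ _ rfl)
    have := h1.div h2 one_ne_zero
    rwa [div_one] at this
  have hhalf : ∀ᶠ δ : ℝ in 𝓝[>] 0, 1 / 2 ≤ ‖profile κ δ‖ := by
    have h1 : Tendsto (fun δ : ℝ => ‖profile κ δ‖) (𝓝[>] 0) (𝓝 1) := by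
      have h2 : Tendsto (fun δ : ℝ => (δ : ℂ)) (𝓝[>] 0) (𝓝 0) :=
        (Complex.continuous_ofReal.tendsto' 0 0 (by simp)).mono_left nhdsWithin_le_nhds
      simpa using ((tendsto_profile_one κ).comp h2).norm
    filter_upwards [h1.eventually (lt_mem_nhds (by norm_num : (1 / 2 : ℝ) < 1))] with δ hδ
    exact hδ.le
  rw [Metric.tendsto_nhds]
  intro ε hε
  set e : ℝ := ε / (4 * (9 / 4) * 2 ^ (k + 2)) with he
  have he0 : 0 < e := by positivity
  obtain ⟨d, hd0, hd⟩ := Metric.tendsto_nhds_nhds.1 hdiv e he0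
  have hd' : ∀ᶠ δ : ℝ in 𝓝[>] 0, 2 * δ < d := by
    have : Tendsto (fun δ : ℝ => 2 * δ) (𝓝[>] 0) (𝓝 0) :=
      (Continuous.tendsto' (by fun_prop) 0 0 (by simp)).mono_left nhdsWithin_le_nhds
    exact this.eventually (gt_mem_nhds hd0)
  filter_upwards [hhalf, hd', self_mem_nhdsWithin] with δ h0 hδd hδ
  have hδ0 : 0 < δ := hδ
  set h : ℂ → ℂ := fun z => flatFun s κ δ z - (1 - z) ^ 2 with hh
  have hdiff : DifferentiableOn ℂ (flatFun s κ δ) (Metric.ball 0 1) := fun z hz =>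
    (norm_flatFun_le hs hκ hρ hρ2 hsec hδ0 h0 hz (z' := z)
      (by simp; positivity)).1.differentiableWithinAt
  have hsq : DifferentiableOn ℂ (fun z : ℂ => (1 - z) ^ 2) (Metric.ball 0 1) := by fun_prop
  have hball : Metric.ball (0 : ℂ) 1 ∈ 𝓝 (0 : ℂ) := Metric.ball_mem_nhds _ one_pos
  have hsub : flatDiff s κ δ k = taylorCoeff h (k + 2) := by
    rw [flatDiff, ← taylorCoeff_one_sub_sq, taylorCoeff, taylorCoeff, taylorCoeff, ← mul_sub]
    congr 1
    exact (iteratedDeriv_fun_sub (hdiff.analyticAt hball).contDiffAt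
      (hsq.analyticAt hball).contDiffAt).symm
  have hbd : ∀ z ∈ Metric.sphere (0 : ℂ) (1 / 2), ‖h z‖ ≤ 9 / 4 * e := by
    intro z hz
    rw [mem_sphere_zero_iff_norm] at hz
    have hw1 : 1 / 2 ≤ ‖1 - z‖ := by
      have := norm_sub_norm_le (1 : ℂ) z
      rw [norm_one] at this
      linarith
    have hw2 : ‖1 - z‖ ≤ 3 / 2 := by
      have := norm_sub_le (1 : ℂ) z
      rw [norm_one] at this
      linarith
    have h1 : h z = (1 - z) ^ 2 *
        (profile κ (δ * (1 - z) ^ (-(s : ℂ))) / profile κ δ - 1) := by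
      rw [hh]
      simp only [flatFun]
      ring
    have hW : ‖(δ : ℂ) * (1 - z) ^ (-(s : ℂ))‖ < d := by
      rw [norm_mul, ← Complex.ofReal_neg, Complex.norm_cpow_real, Complex.norm_real,
        Real.norm_of_nonneg hδ0.le]
      have h2 : ‖1 - z‖ ^ (-s) ≤ 2 := by
        calc ‖1 - z‖ ^ (-s) ≤ (1 / 2 : ℝ) ^ (-s) :=
              Real.rpow_le_rpow_of_nonpos (by norm_num) hw1 (by linarith)
          _ = 2 ^ s := by
              rw [Real.rpow_neg (by norm_num), one_div, Real.inv_rpow (by norm_num), inv_inv]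
          _ ≤ 2 ^ (1 : ℝ) := Real.rpow_le_rpow_of_exponent_le (by norm_num) hs1.le
          _ = 2 := Real.rpow_one 2
      nlinarith
    have hδn : ‖(δ : ℂ)‖ < d := by
      rw [Complex.norm_real, Real.norm_of_nonneg hδ0.le]
      linarith
    have h2 := hd (x := ((δ : ℂ) * (1 - z) ^ (-(s : ℂ)), (δ : ℂ))) (by
      rw [dist_eq_norm, Prod.norm_def]
      simp only [Prod.mk_sub_mk, sub_zero]
      exact max_lt hW hδn)
    rw [dist_eq_norm] at h2
    rw [h1, norm_mul, norm_pow]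
    have h3 : ‖1 - z‖ ^ 2 ≤ 9 / 4 := by nlinarith
    exact mul_le_mul h3 h2.le (norm_nonneg _) (by norm_num)
  have hcauchy := Complex.norm_iteratedDeriv_le_of_forall_mem_sphere_norm_le (k + 2)
    (by norm_num : (0 : ℝ) < 1 / 2) (diffContOnCl_ball (hdiff.sub hsq) (by norm_num)) hbd
  rw [dist_zero_right, hsub, taylorCoeff, norm_mul, norm_inv, RCLike.norm_natCast]
  have hfac : (0 : ℝ) < (k + 2).factorial := by exact_mod_cast Nat.factorial_pos _
  calc ((k + 2).factorial : ℝ)⁻¹ * ‖iteratedDeriv (k + 2) h 0‖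
      ≤ ((k + 2).factorial : ℝ)⁻¹ * ((k + 2).factorial * (9 / 4 * e) / (1 / 2) ^ (k + 2)) := by
        gcongr
        exact hcauchy
    _ = 9 / 4 * e * 2 ^ (k + 2) := by
        rw [one_div, inv_pow]
        field_simp
    _ = ε / 4 := by
        rw [he]
        field_simp
    _ < ε := by linarith

theorem flatFun_zero (s σ δ : ℝ) (h : profile σ δ ≠ 0) : flatFun s σ δ 0 = 1 := by
  simp [flatFun, h]

/-- The function on which the construction rests. The Taylor coefficients from the second one on
are close to those of `(1 - z) ^ 2` in a norm with a stretched exponential weight. -/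
theorem exists_flat_function (β η : ℝ) (hβ : 0 < β) (hβ2 : β < 1 / 2) (hη : 0 < η) :
    ∃ (f : ℂ → ℂ) (c : ℝ), 0 < c ∧ c ≤ 1 ∧ DifferentiableOn ℂ f (Metric.ball 0 1) ∧ f 0 = 1 ∧
      (∀ K, ∑ k ∈ Finset.range K,
        ‖taylorCoeff f (k + 2) - if k = 0 then 1 else 0‖ * weight c β k ≤ η) ∧
      {z : ℂ | z ∈ Metric.ball (0 : ℂ) 1 ∧ f z = 0}.Infinite ∧
      ∀ r, 0 < r → {z : ℂ | z ∈ Metric.ball (0 : ℂ) 1 ∧ f z = 0 ∧ r ≤ ‖1 - z‖}.Finite := by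
  set s := β / (1 - β) with hsdef
  have hs : 0 < s := div_pos hβ (by linarith)
  have hs1 : s < 1 := by rw [hsdef, div_lt_one (by linarith)]; linarith
  obtain ⟨ρ, κ, hρ, hρ2, hκ, hsec⟩ := exists_sector s hs hs1
  obtain ⟨C, hC⟩ := exists_norm_flatDiff_le hs hκ hρ hρ2 hsec
  have hhalf : ∀ᶠ δ : ℝ in 𝓝[>] 0, 1 / 2 ≤ ‖profile κ δ‖ := by
    have h1 : Tendsto (fun δ : ℝ => ‖profile κ δ‖) (𝓝[>] 0) (𝓝 1) := by
      have h2 : Tendsto (fun δ : ℝ => (δ : ℂ)) (𝓝[>] 0) (𝓝 0) :=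
        (Complex.continuous_ofReal.tendsto' 0 0 (by simp)).mono_left nhdsWithin_le_nhds
      simpa using ((tendsto_profile_one κ).comp h2).norm
    filter_upwards [h1.eventually (lt_mem_nhds (by norm_num : (1 / 2 : ℝ) < 1))] with δ hδ
    exact hδ.le
  -- the parameter `δ` makes the coefficients small in the norm with polynomial weight
  have hlim : Tendsto (fun δ : ℝ => ∑' k, ‖flatDiff s κ δ k‖ * (1 + k : ℝ) ^ (5 / 4 : ℝ))
      (𝓝[>] 0) (𝓝 (∑' k : ℕ, (0 : ℝ))) := by
    refine tendsto_tsum_of_dominated_convergence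
      (bound := fun k : ℕ => C * (1 + k : ℝ) ^ (-(5 / 4) : ℝ))
      ((summable_one_add_rpow (by norm_num)).mul_left C) (fun k => ?_) ?_
    · have := (tendsto_flatDiff hs hs1 hκ hρ hρ2 hsec k).norm.mul_const ((1 + k : ℝ) ^ (5 / 4 : ℝ))
      simpa using this
    · filter_upwards [hhalf, self_mem_nhdsWithin] with δ h0 hδ k
      rw [norm_mul, norm_norm, Real.norm_of_nonneg (by positivity)]
      calc ‖flatDiff s κ δ k‖ * (1 + k : ℝ) ^ (5 / 4 : ℝ)
          ≤ C * (1 + k : ℝ) ^ (-(5 / 2) : ℝ) * (1 + k : ℝ) ^ (5 / 4 : ℝ) := by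
            gcongr
            exact hC δ hδ h0 k
        _ = C * (1 + k : ℝ) ^ (-(5 / 4) : ℝ) := by
            rw [mul_assoc, ← Real.rpow_add (by positivity)]
            norm_num
  rw [tsum_zero] at hlim
  obtain ⟨δ, hδη, h0, hδ⟩ := ((hlim.eventually (gt_mem_nhds hη)).and
    (hhalf.and self_mem_nhdsWithin)).exists
  have hδ0 : 0 < δ := hδ
  have hpne : profile κ δ ≠ 0 := norm_pos_iff.1 (by linarith)
  have hB := fun z hz z' hzz => norm_flatFun_le hs hκ hρ hρ2 hsec hδ0 h0 (z := z) (z' := z') hz hzz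
  have hdiff : DifferentiableOn ℂ (flatFun s κ δ) (Metric.ball 0 1) := fun z hz =>
    (hB z hz z (by simp; positivity)).1.differentiableWithinAt
  obtain ⟨c₀, hc₀, hcoef⟩ := exists_norm_taylorCoeff_le_exp (f := flatFun s κ δ) (M := 18)
    (q := κ * δ * (3 / 2) ^ (-s)) (β := β) hρ (by norm_num) (by positivity) hβ (by linarith)
    (fun z hz z' hzz => (hB z hz z' hzz).1) (fun z hz z' hzz => by
      refine ((hB z hz z' hzz).2).trans ?_
      have h1 : ‖1 - z‖ ≤ 2 := by
        rw [mem_ball_zero_iff] at hz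
        refine (norm_sub_le _ _).trans ?_
        rw [norm_one]
        linarith
      gcongr
      nlinarith [norm_nonneg (1 - z)])
  set M := 18 * Real.exp 1 with hM
  have hM0 : 0 < M := by positivity
  have hdec : ∀ k : ℕ, ‖flatDiff s κ δ k‖
      ≤ (M + Real.exp c₀) * Real.exp (-c₀ * (1 + k : ℝ) ^ β) := by
    intro k
    have h1 : ‖taylorCoeff (flatFun s κ δ) (k + 2)‖ ≤ M * Real.exp (-c₀ * (1 + k : ℝ) ^ β) := by
      refine (hcoef (k + 2)).trans ?_
      have h2 : (1 + k : ℝ) ^ β ≤ ((k + 2 : ℕ) : ℝ) ^ β := by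
        gcongr
        push_cast
        linarith
      exact mul_le_mul_of_nonneg_left (Real.exp_le_exp.2 (by nlinarith)) hM0.le
    have h2 : ‖(if k = 0 then 1 else 0 : ℂ)‖ ≤ Real.exp c₀ * Real.exp (-c₀ * (1 + k : ℝ) ^ β) := by
      split_ifs with h
      · rw [h, ← Real.exp_add]
        simp
      · rw [norm_zero]
        positivity
    refine (norm_sub_le _ _).trans ?_
    linarith
  have hbsum : Summable fun k : ℕ => (M + Real.exp c₀) *
      ((1 + k : ℝ) ^ (5 / 4 : ℝ) * Real.exp (-(c₀ / 2) * (1 + k : ℝ) ^ β)) :=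
    (summable_rpow_mul_exp_neg (half_pos hc₀) hβ).mul_left _
  have hbound : ∀ᶠ c in 𝓝[>] (0 : ℝ), ∀ k : ℕ, ‖‖flatDiff s κ δ k‖ * weight c β k‖
      ≤ (M + Real.exp c₀) *
        ((1 + k : ℝ) ^ (5 / 4 : ℝ) * Real.exp (-(c₀ / 2) * (1 + k : ℝ) ^ β)) := by
    filter_upwards [Ioo_mem_nhdsGT (half_pos hc₀)] with c hc k
    have hw : 0 ≤ weight c β k := by
      unfold weight
      positivity
    rw [norm_mul, norm_norm, Real.norm_of_nonneg hw, weight]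
    have h1 : Real.exp (c * (1 + k : ℝ) ^ β) ≤ Real.exp (c₀ / 2 * (1 + k : ℝ) ^ β) := by
      gcongr
      exact hc.2.le
    calc _ ≤ (M + Real.exp c₀) * Real.exp (-c₀ * (1 + k : ℝ) ^ β) *
          ((1 + k : ℝ) ^ (5 / 4 : ℝ) * Real.exp (c₀ / 2 * (1 + k : ℝ) ^ β)) := by
          gcongr
          exact hdec k
      _ = (M + Real.exp c₀) * ((1 + k : ℝ) ^ (5 / 4 : ℝ) *
          (Real.exp (-c₀ * (1 + k : ℝ) ^ β) * Real.exp (c₀ / 2 * (1 + k : ℝ) ^ β))) := by ring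
      _ = _ := by
          rw [← Real.exp_add]
          ring_nf
  -- a small multiple of the decay rate in the exponent changes the norm only little
  have hlim2 : Tendsto (fun c : ℝ => ∑' k, ‖flatDiff s κ δ k‖ * weight c β k)
      (𝓝[>] 0) (𝓝 (∑' k, ‖flatDiff s κ δ k‖ * (1 + k : ℝ) ^ (5 / 4 : ℝ))) := by
    refine tendsto_tsum_of_dominated_convergence hbsum (fun k => ?_) (hbound.mono fun c hc k => ?_)
    · have h1 : Continuous fun c : ℝ => ‖flatDiff s κ δ k‖ * weight c β k := by
        unfold weight
        fun_prop
      have h2 := (h1.tendsto 0).mono_left (nhdsWithin_le_nhds (s := Set.Ioi 0))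
      simpa [weight] using h2
    · exact hc k
  have hsum2 : ∀ᶠ c in 𝓝[>] (0 : ℝ), Summable fun k => ‖flatDiff s κ δ k‖ * weight c β k :=
    hbound.mono fun c hc => hbsum.of_norm_bounded hc
  obtain ⟨c, hcη, hcs, hc0, hc1⟩ := ((hlim2.eventually (gt_mem_nhds hδη)).and
    (hsum2.and (Ioc_mem_nhdsGT (zero_lt_one (α := ℝ))))).exists
  refine ⟨flatFun s κ δ, c, hc0, hc1, hdiff, flatFun_zero s κ δ hpne, fun K => ?_,
    infinite_zeros_flatFun hs hκ hδ0, finite_zeros_flatFun hs hs1 hκ hδ0 hpne⟩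
  refine (hcs.sum_le_tsum _ fun k _ => ?_).trans hcη.le
  unfold weight
  positivity

/-! ### Interleaving the expansions -/

/-- The data of a continued fraction expansion of a function `F` on the punctured unit disc, for
the variable `z + z⁻¹`: the first level has the coefficients `b₀`, `d`, the later ones have
`A i` close to `1` and `B i` close to `0`, and the tails are `z * (1 + u i z)`, with `u i` close to
`0`. The deviations are bounded in terms of `x i`. -/
structure IsExpansion (x : ℕ → ℝ) (F : ℂ → ℂ) (b₀ d : ℂ) (A B : ℕ → ℂ) (u : ℕ → ℂ → ℂ) :
    Prop where
  ne_zero : d ≠ 0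
  norm_tail_le : ∀ i z, ‖z‖ ≤ 1 → ‖u i z‖ ≤ x i
  norm_sub_one_le : ∀ i, ‖A i - 1‖ ≤ x i
  norm_le : ∀ i, ‖B i‖ ≤ 3 * x i
  init : ∀ z, z ≠ 0 → ‖z‖ < 1 → z + z⁻¹ - b₀ - d * (z * (1 + u 0 z)) = F z
  step : ∀ i z, z ≠ 0 → ‖z‖ ≤ 1 →
    A i = (z + z⁻¹ - B i - z * (1 + u (i + 1) z)) * (z * (1 + u i z))

/-- The expansion of `f (ζ z) / z`, for `f` close to `(1 - z) ^ 2` in a weighted norm. The terms of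
degree at most `1` of `f (ζ z)` determine `b₀`, and for `f z = (1 - z) ^ 2` the remainder is
`ζ ^ 2 z ^ 2`, so that `d = 1 - ζ ^ 2` leaves exactly the free tail `m z = z`. -/
theorem exists_isExpansion {ω : ℕ → ℝ} (hω : IsGoodWeight ω) (S y : ℝ)
    (hS : ∀ n, ∑ j ∈ Finset.range n, (ω (2 * j))⁻¹ ≤ S) (hy0 : 0 ≤ y) (hy : y ≤ 1 / 8)
    (hyS : Real.exp (6 * y * S) ≤ 2) {f : ℂ → ℂ} (hf : DifferentiableOn ℂ f (Metric.ball 0 1))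
    (hf0 : f 0 = 1) {η : ℝ}
    (hη : ∀ K, ∑ k ∈ Finset.range K, ‖taylorCoeff f (k + 2) - if k = 0 then 1 else 0‖ * ω k ≤ η)
    {ζ : ℂ} (hζ : ‖ζ‖ = 1) (hζ1 : 1 - ζ ^ 2 ≠ 0) (hηy : η ≤ y * ‖1 - ζ ^ 2‖) :
    ∃ (A B : ℕ → ℂ) (u : ℕ → ℂ → ℂ), IsExpansion (fun i => 2 * y / ω (2 * i))
      (fun z => f (ζ * z) / z) (-ζ * taylorCoeff f 1) (1 - ζ ^ 2) A B u := by
  set d := 1 - ζ ^ 2 with hd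
  set ψ : ℕ → ℂ := fun k => taylorCoeff f (k + 2) - if k = 0 then 1 else 0 with hψ
  set g : PowerSeries ℂ := PowerSeries.mk fun j => -ζ ^ (j + 2) * ψ j / d with hg
  have hdpos : 0 < ‖d‖ := norm_pos_iff.2 hζ1
  have hωpos := hω.pos 0
  have hgn : ∀ j, ‖PowerSeries.coeff j g‖ = ‖ψ j‖ / ‖d‖ := fun j => by
    rw [hg, PowerSeries.coeff_mk, norm_div, norm_mul, norm_neg, norm_pow, hζ, one_pow, one_mul]
  have hgw : ∀ K, wnorm (shiftWeight ω 0) K g ≤ y / ω 0 := fun K => by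
    have h1 : wnorm (shiftWeight ω 0) K g = (∑ k ∈ Finset.range K, ‖ψ k‖ * ω k) / (‖d‖ * ω 0) := by
      rw [wnorm, Finset.sum_div]
      refine Finset.sum_congr rfl fun j _ => ?_
      rw [hgn, shiftWeight]
      simp only [mul_zero, add_zero]
      field_simp
    rw [h1, div_le_div_iff₀ (by positivity) hωpos]
    calc _ ≤ (y * ‖d‖) * ω 0 := by
          gcongr
          exact (hη K).trans hηy
      _ = _ := by ring
  obtain ⟨A, B, u, h0, h1, h2, h3, h4⟩ := hω.exists_expansion S y hS hy0 hy hyS g hgw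
  refine ⟨A, B, u, hζ1, h1, h2, fun i => (h3 i).trans (le_of_eq (by ring)), fun z hz hz1 => ?_, h4⟩
  have hmem : ζ * z ∈ Metric.ball (0 : ℂ) 1 := by simpa [hζ] using hz1
  have hT := Complex.hasSum_taylorSeries_on_ball hf hmem
  have hT' : HasSum (fun n => taylorCoeff f n * (ζ * z) ^ n) (f (ζ * z)) := by
    refine Eq.mp (congrArg (fun F => HasSum F _) (funext fun n => ?_)) hT
    simp only [taylorCoeff, sub_zero, smul_eq_mul]
    ring
  have hc0 : taylorCoeff f 0 = 1 := by simp [taylorCoeff, hf0]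
  have hT2 := (hasSum_nat_add_iff' 2).2 hT'
  have hone : HasSum (fun n => (if n = 0 then (1 : ℂ) else 0) * (ζ * z) ^ (n + 2))
      ((ζ * z) ^ 2) := by
    convert hasSum_ite_eq 0 ((ζ * z) ^ 2) using 2 with n
    by_cases hn : n = 0 <;> simp [hn]
  have hdiff := hT2.sub hone
  have hser : HasSum (fun j => PowerSeries.coeff j g * z ^ j)
      ((f (ζ * z) - (∑ i ∈ Finset.range 2, taylorCoeff f i * (ζ * z) ^ i) - (ζ * z) ^ 2)
        * (-1 / (d * z ^ 2))) := by
    refine Eq.mp (congrArg (fun F => HasSum F _) (funext fun j => ?_))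
      (hdiff.mul_right (-1 / (d * z ^ 2)))
    rw [hg, PowerSeries.coeff_mk, hψ]
    field_simp
    ring
  rw [h0, evalSeries, hser.tsum_eq]
  simp only [Finset.sum_range_succ, Finset.sum_range_zero, hc0]
  field_simp
  rw [hd]
  ring

section Interleave

variable {p : ℕ} {x : ℕ → ℝ} {F : ℕ → ℂ → ℂ} {b₀ d : ℕ → ℂ} {A B : ℕ → ℕ → ℂ}
  {u : ℕ → ℕ → ℂ → ℂ}

/-- The entries `p` below the diagonal, for row `n = p * i + k`. Those with `n < p` do not occur. -/
def lowerSeq (p : ℕ) (A : ℕ → ℕ → ℂ) (n : ℕ) : ℂ := A (n % p) (n / p - 1)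

/-- The entries on the diagonal: the first `p` of them are the `b₀`. -/
def diagSeq (p : ℕ) (b₀ : ℕ → ℂ) (B : ℕ → ℕ → ℂ) (n : ℕ) : ℂ :=
  if n < p then b₀ n else B (n % p) (n / p - 1)

/-- The entries `p` above the diagonal: the first `p` of them are the `d`, the others are `1`. -/
def upperSeq (p : ℕ) (d : ℕ → ℂ) (n : ℕ) : ℂ := if n < p then d n else 1

/-- The interleaved tails of the expansions. -/
def tailSeq (p : ℕ) (u : ℕ → ℕ → ℂ → ℂ) (z : ℂ) (n : ℕ) : ℂ := z * (1 + u (n % p) (n / p) z)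

/-- The diagonal `N` of the left factor in `D - (z + z⁻¹) = (c L - N) (1 - R M)`. -/
def pivotSeq (p : ℕ) (b₀ d : ℕ → ℂ) (B : ℕ → ℕ → ℂ) (u : ℕ → ℕ → ℂ → ℂ) (z : ℂ) (n : ℕ) : ℂ :=
  z + z⁻¹ - diagSeq p b₀ B n - upperSeq p d n * tailSeq p u z n

theorem pivotSeq_of_lt (hE : ∀ k, IsExpansion x (F k) (b₀ k) (d k) (A k) (B k) (u k)) {z : ℂ}
    (hz : z ≠ 0) (hz1 : ‖z‖ < 1) {n : ℕ} (hn : n < p) : pivotSeq p b₀ d B u z n = F n z := by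
  rw [← (hE n).init z hz hz1, pivotSeq, diagSeq, upperSeq, tailSeq, if_pos hn, if_pos hn,
    Nat.mod_eq_of_lt hn, Nat.div_eq_of_lt hn]

theorem lowerSeq_eq (hp : 1 ≤ p) (hE : ∀ k, IsExpansion x (F k) (b₀ k) (d k) (A k) (B k) (u k))
    {z : ℂ} (hz : z ≠ 0) (hz1 : ‖z‖ < 1) {n : ℕ} (hn : p ≤ n) :
    lowerSeq p A n = pivotSeq p b₀ d B u z n * tailSeq p u z (n - p) := by
  obtain ⟨j, rfl⟩ := Nat.exists_eq_add_of_le' hn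
  have h1 : (j + p) / p = j / p + 1 := Nat.add_div_right j hp
  rw [lowerSeq, pivotSeq, diagSeq, upperSeq, if_neg hn.not_gt, if_neg hn.not_gt, tailSeq, tailSeq,
    h1, Nat.add_mod_right, Nat.add_sub_cancel, Nat.add_sub_cancel, one_mul]
  exact (hE (j % p)).step (j / p) z hz hz1.le

theorem norm_tailSeq_le (hE : ∀ k, IsExpansion x (F k) (b₀ k) (d k) (A k) (B k) (u k)) {z : ℂ}
    (hz1 : ‖z‖ < 1) (n : ℕ) : ‖tailSeq p u z n‖ ≤ ‖z‖ * (1 + x (n / p)) := by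
  rw [tailSeq, norm_mul]
  gcongr
  refine (norm_add_le _ _).trans ?_
  rw [norm_one]
  gcongr
  exact (hE _).norm_tail_le _ z hz1.le

theorem one_sub_le_norm_lowerSeq (hE : ∀ k, IsExpansion x (F k) (b₀ k) (d k) (A k) (B k) (u k))
    (n : ℕ) : 1 - x (n / p - 1) ≤ ‖lowerSeq p A n‖ := by
  have h1 := (hE (n % p)).norm_sub_one_le (n / p - 1)
  have h2 := norm_sub_norm_le (1 : ℂ) (lowerSeq p A n)
  rw [norm_one, norm_sub_rev] at h2
  change ‖lowerSeq p A n - 1‖ ≤ _ at h1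
  linarith

/-- From row `p` on, the pivots are in norm not much less than `1 / ‖z‖`, also near the zeros of
the `F k`. -/
theorem norm_pivotSeq_ge (hp : 1 ≤ p)
    (hE : ∀ k, IsExpansion x (F k) (b₀ k) (d k) (A k) (B k) (u k)) (hx0 : ∀ i, 0 ≤ x i)
    (hx4 : ∀ i, x i ≤ 1 / 4) {z : ℂ} (hz : z ≠ 0) (hz1 : ‖z‖ < 1) {n : ℕ} (hn : p ≤ n) :
    Real.exp (-(4 * x (n / p - 1))) ≤ ‖z‖ * ‖pivotSeq p b₀ d B u z n‖ := by
  set i := n / p - 1 with hi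
  have h1 := one_sub_le_norm_lowerSeq (p := p) hE n
  rw [lowerSeq_eq hp hE hz hz1 hn, norm_mul, ← hi] at h1
  have h2 := norm_tailSeq_le (p := p) hE hz1 (n - p)
  have h3 : (n - p) / p = i := by rw [hi, Nat.div_eq_sub_div hp hn, Nat.add_sub_cancel]
  rw [h3] at h2
  have h4 := one_add_div_one_sub_le_exp (x i) (hx0 i) (by linarith [hx4 i])
  have h5 := hx0 i
  have h6 := hx4 i
  have h7 : Real.exp (-(3 * x i)) ≤ (1 - x i) / (1 + x i) := by
    rw [Real.exp_neg, ← inv_div]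
    exact inv_anti₀ (div_pos (by linarith) (by linarith)) h4
  have h8 : Real.exp (-(4 * x i)) ≤ Real.exp (-(3 * x i)) := Real.exp_le_exp.2 (by linarith)
  refine h8.trans (h7.trans ?_)
  rw [div_le_iff₀ (by linarith)]
  calc 1 - x i ≤ _ := h1
    _ ≤ ‖pivotSeq p b₀ d B u z n‖ * (‖z‖ * (1 + x i)) := by gcongr
    _ = _ := by ring

/-- The weight that makes the shift with the weights `tailSeq` a contraction. -/
def rightWeight (x : ℕ → ℝ) (p n : ℕ) : ℝ := Real.exp (4 * ∑ j ∈ Finset.range (n / p), x j)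

theorem one_le_rightWeight (hx0 : ∀ i, 0 ≤ x i) (n : ℕ) : 1 ≤ rightWeight x p n :=
  Real.one_le_exp (mul_nonneg (by norm_num) (Finset.sum_nonneg fun i _ => hx0 i))

theorem rightWeight_le (hx0 : ∀ i, 0 ≤ x i) (hxs : Summable x) (n : ℕ) :
    rightWeight x p n ≤ Real.exp (4 * ∑' i, x i) :=
  Real.exp_le_exp.2 (mul_le_mul_of_nonneg_left (hxs.sum_le_tsum _ fun i _ => hx0 i) (by norm_num))

theorem norm_tailSeq_mul_rightWeight_le (hp : 1 ≤ p)
    (hE : ∀ k, IsExpansion x (F k) (b₀ k) (d k) (A k) (B k) (u k)) (hx0 : ∀ i, 0 ≤ x i) {z : ℂ}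
    (hz1 : ‖z‖ < 1) (n : ℕ) :
    ‖tailSeq p u z n‖ * rightWeight x p n ≤ ‖z‖ * rightWeight x p (n + p) := by
  have h1 : 1 + x (n / p) ≤ Real.exp (4 * x (n / p)) := by
    linarith [Real.add_one_le_exp (4 * x (n / p)), hx0 (n / p)]
  rw [rightWeight, rightWeight, Nat.add_div_right n hp, Finset.sum_range_succ, mul_add,
    Real.exp_add]
  calc _ ≤ (‖z‖ * (1 + x (n / p))) * Real.exp (4 * ∑ j ∈ Finset.range (n / p), x j) := by
        gcongr
        exact norm_tailSeq_le hE hz1 n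
    _ ≤ (‖z‖ * Real.exp (4 * x (n / p))) * Real.exp (4 * ∑ j ∈ Finset.range (n / p), x j) := by
        gcongr
    _ = _ := by ring

theorem norm_tailSeq_le_two (hE : ∀ k, IsExpansion x (F k) (b₀ k) (d k) (A k) (B k) (u k))
    (hx4 : ∀ i, x i ≤ 1 / 4) {z : ℂ} (hz1 : ‖z‖ < 1) (n : ℕ) : ‖tailSeq p u z n‖ ≤ 2 := by
  refine (norm_tailSeq_le hE hz1 n).trans ?_
  have h1 := hx4 (n / p)
  have h2 := (norm_nonneg _).trans ((hE 0).norm_sub_one_le (n / p))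
  nlinarith [norm_nonneg z]

theorem norm_diagSeq_le (hE : ∀ k, IsExpansion x (F k) (b₀ k) (d k) (A k) (B k) (u k))
    (hx4 : ∀ i, x i ≤ 1 / 4) {M : ℝ} (hM : ∀ k, ‖b₀ k‖ ≤ M) (n : ℕ) :
    ‖diagSeq p b₀ B n‖ ≤ M + 1 := by
  rw [diagSeq]
  split_ifs
  · linarith [hM n]
  · linarith [(hE (n % p)).norm_le (n / p - 1), hx4 (n / p - 1), (norm_nonneg _).trans (hM 0)]

theorem norm_upperSeq_le {M : ℝ} (hM : ∀ k, ‖d k‖ ≤ M) (n : ℕ) : ‖upperSeq p d n‖ ≤ M + 1 := by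
  rw [upperSeq]
  split_ifs
  · linarith [hM n]
  · rw [norm_one]
    linarith [(norm_nonneg _).trans (hM 0)]

theorem norm_lowerSeq_le (hE : ∀ k, IsExpansion x (F k) (b₀ k) (d k) (A k) (B k) (u k))
    (hx4 : ∀ i, x i ≤ 1 / 4) (n : ℕ) : ‖lowerSeq p A n‖ ≤ 2 := by
  have h1 := (hE (n % p)).norm_sub_one_le (n / p - 1)
  have h2 := norm_sub_norm_le (lowerSeq p A n) 1
  change ‖lowerSeq p A n - 1‖ ≤ _ at h1
  rw [norm_one] at h2
  linarith [hx4 (n / p - 1)]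

variable {D : ℓ²(ℕ, ℂ) →L[ℂ] ℓ²(ℕ, ℂ)}

/-- Off the zeros of the `F k`, the resolvent exists and grows at most like `φ ^ (-2)`, where `φ`
is the smallest `‖F k z‖`. -/
theorem exists_resolvent_of_isExpansion (hp : 1 ≤ p)
    (hE : ∀ k, IsExpansion x (F k) (b₀ k) (d k) (A k) (B k) (u k)) (hx0 : ∀ i, 0 ≤ x i)
    (hx4 : ∀ i, x i ≤ 1 / 4) (hxs : Summable x) {M : ℝ} (hM : ∀ k, ‖b₀ k‖ ≤ M)
    (hM' : ∀ k, ‖d k‖ ≤ M)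
    (hD : IsThreeDiag p (lowerSeq p A) (diagSeq p b₀ B) (upperSeq p d) D) {z : ℂ} (hz : z ≠ 0)
    (hz1 : ‖z‖ < 1) {φ : ℝ} (hφ : 0 < φ) (hφ1 : φ ≤ 1 / 4) (hF : ∀ k < p, φ ≤ ‖F k z‖) :
    ∃ U : ℓ²(ℕ, ℂ) →L[ℂ] ℓ²(ℕ, ℂ), U * (D - (z + z⁻¹) • 1) = 1 ∧ (D - (z + z⁻¹) • 1) * U = 1 ∧
      ‖U‖ ≤ Real.exp (4 * ∑' i, x i) / (1 - ‖z‖) *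
        (Real.exp (4 * ∑' i, x i) * (1 + M / (‖z‖ * φ)) / (1 - ‖z‖)) * φ⁻¹ := by
  set X := ∑' i, x i with hX
  have hM0 : 0 ≤ M := (norm_nonneg _).trans (hM 0)
  have hr : 0 < ‖z‖ := norm_pos_iff.2 hz
  have hsum : ∀ n, ∑ j ∈ Finset.range n, x j ≤ X := fun n =>
    hxs.sum_le_tsum _ fun i _ => hx0 i
  have hpart : 1 ≤ 1 + M / (‖z‖ * φ) := le_add_of_nonneg_right (by positivity)
  have hX0 : 0 ≤ X := tsum_nonneg hx0
  have hge : ∀ n, p ≤ n → Real.exp (-(4 * x (n / p - 1))) ≤ ‖z‖ * ‖pivotSeq p b₀ d B u z n‖ :=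
    fun n hn => norm_pivotSeq_ge hp hE hx0 hx4 hz hz1 hn
  -- the weight for the left factor increases by `1 + M / (‖z‖ φ)` in the first `p` rows, where the
  -- pivots may be as small as `φ`
  refine hD.exists_resolvent (z + z⁻¹) (tailSeq p u z) (pivotSeq p b₀ d B u z) (fun n => rfl)
    (fun n hn => lowerSeq_eq hp hE hz hz1 hn) 2 (norm_tailSeq_le_two hE hx4 hz1)
    (rightWeight x p)
    (fun n => if n < p then Real.exp (4 * X) * (1 + M / (‖z‖ * φ))
      else Real.exp (4 * (X - ∑ j ∈ Finset.range (n / p - 1), x j)))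
    (Real.exp (4 * X)) (Real.exp (4 * X) * (1 + M / (‖z‖ * φ))) ‖z‖ φ (norm_nonneg z) hz1
    (one_le_rightWeight hx0) (rightWeight_le hx0 hxs) (fun n => ?_) (fun n => ?_)
    (norm_tailSeq_mul_rightWeight_le hp hE hx0 hz1) (fun n => ?_) hφ (fun n => ?_)
    (‖z + z⁻¹‖ + (M + 1) + (M + 1) * 2) (fun n => ?_)
  · split_ifs
    · exact one_le_mul_of_one_le_of_one_le (Real.one_le_exp (by positivity)) hpart
    · exact Real.one_le_exp (by linarith [hsum (n / p - 1)])
  · split_ifs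
    · exact le_rfl
    · refine le_trans (Real.exp_le_exp.2 ?_) (le_mul_of_one_le_right (Real.exp_pos _).le hpart)
      linarith [Finset.sum_nonneg fun i (_ : i ∈ Finset.range (n / p - 1)) => hx0 i]
  · rw [if_neg (by omega), upperSeq, Nat.add_div_right n hp, Nat.add_sub_cancel]
    by_cases hn : n < p
    · rw [if_pos hn, if_pos hn, pivotSeq_of_lt hE hz hz1 hn, Nat.div_eq_of_lt hn,
        Finset.sum_range_zero, sub_zero]
      have h1 : M ≤ ‖z‖ * (1 + M / (‖z‖ * φ)) * ‖F n z‖ := by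
        calc M = ‖z‖ * (M / (‖z‖ * φ)) * φ := by field_simp
          _ ≤ ‖z‖ * (1 + M / (‖z‖ * φ)) * ‖F n z‖ := by
            gcongr
            · linarith
            · exact hF n hn
      calc ‖d n‖ * Real.exp (4 * X) ≤ M * Real.exp (4 * X) := by gcongr; exact hM' n
        _ ≤ (‖z‖ * (1 + M / (‖z‖ * φ)) * ‖F n z‖) * Real.exp (4 * X) := by gcongr
        _ = _ := by ring
    · have hn' : p ≤ n := not_lt.1 hn
      rw [if_neg hn, if_neg hn, norm_one, one_mul]
      have h1 : n / p = (n / p - 1) + 1 := by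
        have := Nat.div_pos hn' hp
        omega
      calc _ = Real.exp (-(4 * x (n / p - 1))) *
            Real.exp (4 * (X - ∑ j ∈ Finset.range (n / p - 1), x j)) := by
            rw [← Real.exp_add]
            congr 1
            conv_lhs => rw [h1, Finset.sum_range_succ]
            ring
        _ ≤ (‖z‖ * ‖pivotSeq p b₀ d B u z n‖) *
            Real.exp (4 * (X - ∑ j ∈ Finset.range (n / p - 1), x j)) := by
            gcongr
            exact hge n hn'
        _ = _ := by ring
  · by_cases hn : n < p
    · rw [pivotSeq_of_lt hE hz hz1 hn]
      exact hF n hn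
    · have h1 := hge n (not_lt.1 hn)
      have h2 := Real.add_one_le_exp (-(3 * x (n / p - 1)))
      have h3 : ‖z‖ * ‖pivotSeq p b₀ d B u z n‖ ≤ ‖pivotSeq p b₀ d B u z n‖ :=
        mul_le_of_le_one_left (norm_nonneg _) hz1.le
      have h4 := Real.exp_le_exp.2 (show -(1 : ℝ) ≤ -(4 * x (n / p - 1)) by
        linarith [hx4 (n / p - 1)])
      have h5 : (1 / 4 : ℝ) ≤ Real.exp (-1) := by
        rw [Real.exp_neg, one_div]
        exact inv_anti₀ (Real.exp_pos _) (by linarith [Real.exp_one_lt_d9])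
      linarith
  · rw [pivotSeq]
    refine (norm_sub_le _ _).trans (add_le_add ((norm_sub_le _ _).trans ?_) ?_)
    · gcongr
      exact norm_diagSeq_le hE hx4 hM n
    · rw [norm_mul]
      exact mul_le_mul (norm_upperSeq_le hM' n) (norm_tailSeq_le_two hE hx4 hz1 n)
        (norm_nonneg _) (by linarith)

theorem exists_eigenvector_of_isExpansion (hp : 1 ≤ p)
    (hE : ∀ k, IsExpansion x (F k) (b₀ k) (d k) (A k) (B k) (u k)) (hx0 : ∀ i, 0 ≤ x i)
    (hx4 : ∀ i, x i ≤ 1 / 4) (hxs : Summable x)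
    (hD : IsThreeDiag p (lowerSeq p A) (diagSeq p b₀ B) (upperSeq p d) D) {z : ℂ} (hz : z ≠ 0)
    (hz1 : ‖z‖ < 1) {k : ℕ} (hk : k < p) (hF : F k z = 0) :
    ∃ v : ℓ²(ℕ, ℂ), v ≠ 0 ∧ D v = (z + z⁻¹) • v :=
  hD.exists_eigenvector (z + z⁻¹) (tailSeq p u z) (pivotSeq p b₀ d B u z) (fun _ => rfl)
    (fun _ hn => lowerSeq_eq hp hE hz hz1 hn) 2 (norm_tailSeq_le_two hE hx4 hz1)
    (rightWeight x p) (Real.exp (4 * ∑' i, x i)) ‖z‖ (norm_nonneg z) hz1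
    (one_le_rightWeight hx0) (rightWeight_le hx0 hxs)
    (norm_tailSeq_mul_rightWeight_le hp hE hx0 hz1) k hk
    ((pivotSeq_of_lt hE hz hz1 hk).trans hF)

end Interleave

/-! ### The map `z ↦ z + z⁻¹` -/

theorem eq_or_mul_eq_one {z w : ℂ} (hz : z ≠ 0) (hw : w ≠ 0) (h : z + z⁻¹ = w + w⁻¹) :
    z = w ∨ z * w = 1 := by
  have h1 : (z - w) * (z * w - 1) = 0 := by
    field_simp at h
    linear_combination h
  rcases mul_eq_zero.1 h1 with h2 | h2
  · exact Or.inl (sub_eq_zero.1 h2)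
  · exact Or.inr (sub_eq_zero.1 h2)

/-- The segment `[-2, 2]` of the real axis. -/
def realSegment : Set ℂ := (fun t : ℝ => (t : ℂ)) '' Set.Icc (-2) 2

theorem isClosed_realSegment : IsClosed realSegment :=
  (isCompact_Icc.image Complex.continuous_ofReal).isClosed

theorem preperfect_realSegment : Preperfect realSegment := by
  refine (isPreconnected_Icc.image _
    Complex.continuous_ofReal.continuousOn).preperfect_of_nontrivial
    ⟨(-2 : ℝ), ⟨-2, by norm_num, rfl⟩, (2 : ℝ), ⟨2, by norm_num, rfl⟩, fun h => ?_⟩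
  have := Complex.ofReal_injective h
  norm_num at this

theorem exists_norm_eq_one_of_mem_Icc {t : ℝ} (ht : t ∈ Set.Icc (-2 : ℝ) 2) :
    ∃ ξ : ℂ, ‖ξ‖ = 1 ∧ ξ + ξ⁻¹ = t := by
  have h1 : 0 ≤ 1 - (t / 2) ^ 2 := by nlinarith [ht.1, ht.2]
  have h2 := Real.sq_sqrt h1
  set ξ : ℂ := ⟨t / 2, Real.sqrt (1 - (t / 2) ^ 2)⟩ with hξ
  have hn : Complex.normSq ξ = 1 := by
    rw [hξ, Complex.normSq_mk]
    nlinarith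
  refine ⟨ξ, ?_, ?_⟩
  · rw [Complex.norm_def, hn, Real.sqrt_one]
  · rw [Complex.inv_def, hn, inv_one, Complex.ofReal_one, mul_one, Complex.add_conj, hξ]
    push_cast
    ring

theorem add_inv_mem_realSegment {z : ℂ} (hz : ‖z‖ = 1) : z + z⁻¹ ∈ realSegment := by
  have hn : Complex.normSq z = 1 := by rw [Complex.normSq_eq_norm_sq, hz, one_pow]
  refine ⟨2 * z.re, ?_, ?_⟩
  · have := (abs_le.1 (Complex.abs_re_le_norm z))
    rw [hz] at this
    constructor <;> linarith [this.1, this.2]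
  · simp only
    rw [Complex.inv_def, hn, inv_one, Complex.ofReal_one, mul_one, Complex.add_conj]

theorem add_inv_notMem_realSegment {z : ℂ} (hz : z ≠ 0) (hz1 : ‖z‖ < 1) :
    z + z⁻¹ ∉ realSegment := by
  rintro ⟨t, ht, h⟩
  obtain ⟨ξ, hξ, hξt⟩ := exists_norm_eq_one_of_mem_Icc ht
  have hξ0 : ξ ≠ 0 := norm_pos_iff.1 (by rw [hξ]; exact one_pos)
  rcases eq_or_mul_eq_one hz hξ0 (h.symm.trans hξt.symm) with h1 | h1
  · rw [h1, hξ] at hz1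
    exact lt_irrefl _ hz1
  · have := congrArg norm h1
    rw [norm_mul, hξ, norm_one, mul_one] at this
    exact hz1.ne this

theorem exists_add_inv_eq {lam : ℂ} (h : lam ∉ realSegment) :
    ∃ z : ℂ, z ≠ 0 ∧ ‖z‖ < 1 ∧ z + z⁻¹ = lam := by
  obtain ⟨w, hw⟩ := IsAlgClosed.exists_pow_nat_eq (lam ^ 2 - 4) (n := 2) (by norm_num)
  set z := (lam + w) / 2 with hz
  have h1 : z * (lam - z) = 1 := by rw [hz]; linear_combination (-1 / 4) * hw
  have hz0 : z ≠ 0 := left_ne_zero_of_mul_eq_one h1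
  have h2 : z + z⁻¹ = lam := by
    rw [inv_eq_of_mul_eq_one_right h1]
    ring
  rcases lt_trichotomy ‖z‖ 1 with h3 | h3 | h3
  · exact ⟨z, hz0, h3, h2⟩
  · exact absurd (h2 ▸ add_inv_mem_realSegment h3) h
  · refine ⟨z⁻¹, inv_ne_zero hz0, ?_, ?_⟩
    · rw [norm_inv]
      exact inv_lt_one_of_one_lt₀ h3
    · rw [inv_inv, add_comm, h2]

/-- If `ζ * z` is close to `1`, then `z + z⁻¹` is close to `ζ + ζ⁻¹`. -/
theorem norm_add_inv_sub_le {z ζ : ℂ} (hζ : ‖ζ‖ = 1) {r : ℝ} (hr : r ≤ 1 / 2)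
    (h : ‖1 - ζ * z‖ < r) : ‖z + z⁻¹ - (ζ + ζ⁻¹)‖ ≤ 3 * r := by
  have hζ0 : ζ ≠ 0 := norm_pos_iff.1 (by rw [hζ]; exact one_pos)
  have h1 : 1 / 2 ≤ ‖z‖ := by
    have := norm_sub_norm_le (1 : ℂ) (1 - ζ * z)
    rw [sub_sub_cancel, norm_one, norm_mul, hζ, one_mul] at this
    linarith
  have hz0 : z ≠ 0 := norm_pos_iff.1 (by linarith)
  have h2 : z + z⁻¹ - (ζ + ζ⁻¹) = -(ζ⁻¹ * (1 - ζ * z)) + z⁻¹ * (1 - ζ * z) := by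
    field_simp
    ring
  have h3 : ‖z‖⁻¹ ≤ 2 := by
    rw [inv_le_comm₀ (by linarith) (by norm_num)]
    linarith
  rw [h2]
  refine (norm_add_le _ _).trans ?_
  rw [norm_neg, norm_mul, norm_mul, norm_inv, norm_inv, hζ, inv_one, one_mul]
  nlinarith [norm_nonneg (1 - ζ * z)]

/-! ### The essential spectrum -/

theorem IsThreeDiag.apply_single {p : ℕ} {α b c : ℕ → ℂ} {D : ℓ²(ℕ, ℂ) →L[ℂ] ℓ²(ℕ, ℂ)}
    (hD : IsThreeDiag p α b c D) (j : ℕ) :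
    D (lp.single 2 (j + p) (1 : ℂ)) = c j • lp.single 2 j (1 : ℂ) +
      b (j + p) • lp.single 2 (j + p) (1 : ℂ) +
      α (j + p + p) • lp.single 2 (j + p + p) (1 : ℂ) := by
  have hs : ∀ i n : ℕ, (lp.single 2 i (1 : ℂ) : ℓ²(ℕ, ℂ)) n = if n = i then 1 else 0 :=
    fun i n => by
      rw [lp.single_apply, Pi.single_apply]
  ext n
  rw [hD]
  change _ = c j * (lp.single 2 j (1 : ℂ) : ℓ²(ℕ, ℂ)) n +
    b (j + p) * (lp.single 2 (j + p) (1 : ℂ) : ℓ²(ℕ, ℂ)) n +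
    α (j + p + p) * (lp.single 2 (j + p + p) (1 : ℂ) : ℓ²(ℕ, ℂ)) n
  simp only [hs]
  have h1 : (if p ≤ n then α n * (if n - p = j + p then (1 : ℂ) else 0) else 0) =
      α (j + p + p) * if n = j + p + p then 1 else 0 := by
    by_cases h : n = j + p + p
    · subst h
      simp
    · rw [if_neg h, mul_zero]
      split_ifs with h2 h3
      · omega
      · rw [mul_zero]
      · rfl
  have h2 : b n * (if n = j + p then (1 : ℂ) else 0) = b (j + p) * if n = j + p then 1 else 0 := by
    by_cases h : n = j + p
    · rw [h]
    · rw [if_neg h, mul_zero, mul_zero]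
  have h3 : c n * (if n + p = j + p then (1 : ℂ) else 0) = c j * if n = j then 1 else 0 := by
    by_cases h : n = j
    · rw [h, if_pos rfl, if_pos rfl]
    · rw [if_neg h, if_neg (by omega), mul_zero, mul_zero]
  rw [h1, h2, h3]
  ring

/-- If the deviations of the coefficients from those of the free matrix are summable along the
multiples of `p`, then the vectors `∑_{i < K} ξ ^ i e_{p (i + 1)}` of norm `√K` are approximate
eigenvectors for `ξ + ξ⁻¹`, `‖ξ‖ = 1`: their images under `D - (ξ + ξ⁻¹)` remain bounded. -/
theorem IsThreeDiag.mem_spectrum {p : ℕ} {α b c : ℕ → ℂ} {D : ℓ²(ℕ, ℂ) →L[ℂ] ℓ²(ℕ, ℂ)}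
    (hD : IsThreeDiag p α b c D) (hp : 1 ≤ p) (C : ℝ)
    (hC : ∀ K, ∑ i ∈ Finset.range K, (‖c (p * i) - 1‖ + ‖b (p * i + p)‖ +
      ‖α (p * i + p + p) - 1‖) ≤ C) {lam : ℂ} (hlam : lam ∈ realSegment) :
    lam ∈ spectrum ℂ D := by
  obtain ⟨t, ht, rfl⟩ := hlam
  obtain ⟨ξ, hξ, hξt⟩ := exists_norm_eq_one_of_mem_Icc ht
  have hξ0 : ξ ≠ 0 := norm_pos_iff.1 (by rw [hξ]; exact one_pos)
  simp only
  rw [← hξt]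
  intro hunit
  obtain ⟨U, hU⟩ := hunit
  set G : ℕ → ℓ²(ℕ, ℂ) := fun i => lp.single 2 (p * i) (1 : ℂ) with hG
  have hGn : ∀ i, ‖G i‖ = 1 := fun i => by
    rw [hG]
    simp
  -- for the free matrix the images telescope
  set H : ℕ → ℓ²(ℕ, ℂ) := fun i => ξ ^ i • G i - (ξ⁻¹ * ξ ^ i) • G (i + 1) with hH
  have hHn : ∀ i, ‖H i‖ ≤ 2 := fun i => by
    refine (norm_sub_le _ _).trans ?_
    rw [norm_smul, norm_smul, hGn, hGn, norm_mul, norm_inv, norm_pow, hξ]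
    norm_num
  set R : ℕ → ℓ²(ℕ, ℂ) := fun i => (c (p * i) - 1) • G i + b (p * i + p) • G (i + 1) +
    (α (p * i + p + p) - 1) • G (i + 2) with hR
  have hRn : ∀ i, ‖R i‖ ≤ ‖c (p * i) - 1‖ + ‖b (p * i + p)‖ + ‖α (p * i + p + p) - 1‖ := fun i => by
    refine (norm_add₃_le).trans ?_
    rw [norm_smul, norm_smul, norm_smul, hGn, hGn, hGn, mul_one, mul_one, mul_one]
  have hstep : ∀ i, D (ξ ^ i • G (i + 1)) - (ξ + ξ⁻¹) • ξ ^ i • G (i + 1) =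
      (H i - H (i + 1)) + ξ ^ i • R i := fun i => by
    have h1 : G (i + 1) = lp.single 2 (p * i + p) (1 : ℂ) := by rw [hG, ← Nat.mul_succ]
    have h2 : G (i + 2) = lp.single 2 (p * i + p + p) (1 : ℂ) := by
      simp only [hG]
      rw [← Nat.mul_succ, ← Nat.mul_succ]
    rw [map_smul, h1, hD.apply_single, ← h1, ← h2]
    change ξ ^ i • (c (p * i) • G i + _ + _) - _ = _
    simp only [hH, hR]
    have h3 : ξ⁻¹ * ξ ^ (i + 1) = ξ ^ i := by rw [pow_succ]; field_simp
    rw [h3, pow_succ]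
    module
  set x : ℕ → ℓ²(ℕ, ℂ) := fun K => ∑ i ∈ Finset.range K, ξ ^ i • G (i + 1) with hx
  have hxD : ∀ K, ‖D (x K) - (ξ + ξ⁻¹) • x K‖ ≤ 4 + C := fun K => by
    rw [hx]
    simp only
    rw [map_sum, Finset.smul_sum, ← Finset.sum_sub_distrib,
      Finset.sum_congr rfl fun i _ => hstep i, Finset.sum_add_distrib, Finset.sum_range_sub']
    refine (norm_add_le _ _).trans (add_le_add ?_ ?_)
    · exact (norm_sub_le _ _).trans (by linarith [hHn 0, hHn K])
    · refine (norm_sum_le _ _).trans (le_trans (Finset.sum_le_sum fun i _ => ?_) (hC K))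
      rw [norm_smul, norm_pow, hξ, one_pow, one_mul]
      exact hRn i
  have hxn : ∀ K : ℕ, ‖x K‖ ^ 2 = K := fun K => by
    have hinj : Set.InjOn (fun i => p * (i + 1)) (Finset.range K : Set ℕ) := fun i _ j _ hij => by
      have := Nat.eq_of_mul_eq_mul_left hp hij
      omega
    have h1 : x K = ∑ j ∈ (Finset.range K).image (fun i => p * (i + 1)),
        lp.single 2 j (ξ ^ (j / p - 1)) := by
      rw [Finset.sum_image hinj]
      refine Finset.sum_congr rfl fun i _ => ?_
      rw [Nat.mul_div_cancel_left _ hp, Nat.add_sub_cancel, hG]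
      simp only
      rw [← lp.single_smul, smul_eq_mul, mul_one]
    have h2 := lp.norm_sum_single (p := 2) (E := fun _ : ℕ => ℂ) (by norm_num)
      (fun j => ξ ^ (j / p - 1)) ((Finset.range K).image (fun i => p * (i + 1)))
    rw [← h1] at h2
    simp only [norm_pow, hξ, one_pow] at h2
    simpa [Finset.card_image_of_injOn hinj] using h2
  have hxU : ∀ K, ‖x K‖ ≤ ‖(↑U⁻¹ : ℓ²(ℕ, ℂ) →L[ℂ] ℓ²(ℕ, ℂ))‖ * (4 + C) := fun K => by
    have h1 : x K = (↑U⁻¹ : ℓ²(ℕ, ℂ) →L[ℂ] ℓ²(ℕ, ℂ)) ((U : ℓ²(ℕ, ℂ) →L[ℂ] ℓ²(ℕ, ℂ)) (x K)) := by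
      change _ = ((↑U⁻¹ : ℓ²(ℕ, ℂ) →L[ℂ] ℓ²(ℕ, ℂ)) * (U : ℓ²(ℕ, ℂ) →L[ℂ] ℓ²(ℕ, ℂ))) (x K)
      rw [Units.inv_mul]
      rfl
    have h2 : ‖(U : ℓ²(ℕ, ℂ) →L[ℂ] ℓ²(ℕ, ℂ)) (x K)‖ ≤ 4 + C := by
      rw [hU]
      change ‖(ξ + ξ⁻¹) • x K - D (x K)‖ ≤ _
      rw [norm_sub_rev]
      exact hxD K
    conv_lhs => rw [h1]
    exact (ContinuousLinearMap.le_opNorm _ _).trans (by gcongr)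
  obtain ⟨K, hK⟩ := exists_nat_gt ((‖(↑U⁻¹ : ℓ²(ℕ, ℂ) →L[ℂ] ℓ²(ℕ, ℂ))‖ * (4 + C)) ^ 2)
  have := pow_le_pow_left₀ (norm_nonneg _) (hxU K) 2
  rw [hxn] at this
  linarith

section Spectrum

/-! ### The spectrum -/

/-- The spectral properties of `D` that its construction gives: `[-2, 2]` is in the spectrum, and
off `[-2, 2]` the resolvent at `z + z⁻¹` is controlled by the values `f (ζ k * z)` for `k < p`,
where a zero gives an eigenvector. -/
structure HasZeros (p : ℕ) (ζ : ℕ → ℂ) (f : ℂ → ℂ) (D : ℓ²(ℕ, ℂ) →L[ℂ] ℓ²(ℕ, ℂ)) : Prop where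
  segment : realSegment ⊆ spectrum ℂ D
  finite_ker : ∀ lam : ℂ, FiniteDimensional ℂ
    (LinearMap.ker ((D - lam • 1 : ℓ²(ℕ, ℂ) →L[ℂ] ℓ²(ℕ, ℂ)) : Module.End ℂ ℓ²(ℕ, ℂ)))
  eigenvector : ∀ z, z ≠ 0 → ‖z‖ < 1 → ∀ k < p, f (ζ k * z) = 0 →
    ∃ v : ℓ²(ℕ, ℂ), v ≠ 0 ∧ D v = (z + z⁻¹) • v
  resolvent : ∀ z, z ≠ 0 → ‖z‖ < 1 → (∀ k < p, f (ζ k * z) ≠ 0) → z + z⁻¹ ∉ spectrum ℂ D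
  lower_bound : ∀ z₁, z₁ ≠ 0 → ‖z₁‖ < 1 → ∃ C : ℝ, 0 ≤ C ∧
    ∀ᶠ z in 𝓝 z₁, ∀ φ : ℝ, 0 < φ → φ ≤ 1 / 4 → (∀ k < p, φ ≤ ‖f (ζ k * z)‖) →
    ∀ v : ℓ²(ℕ, ℂ), φ ^ 2 * ‖v‖ ≤ C * ‖(D - (z + z⁻¹) • 1) v‖

/-- The image under `z ↦ z + z⁻¹` of the zeros of the functions `f (ζ k * z)` for `k < p`. -/
def zeroImage (p : ℕ) (ζ : ℕ → ℂ) (f : ℂ → ℂ) : Set ℂ :=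
  {lam | ∃ z, z ≠ 0 ∧ ‖z‖ < 1 ∧ z + z⁻¹ = lam ∧ ∃ k < p, f (ζ k * z) = 0}

variable {p : ℕ} {ζ : ℕ → ℂ} {f : ℂ → ℂ} {D : ℓ²(ℕ, ℂ) →L[ℂ] ℓ²(ℕ, ℂ)}

theorem zeroImage_disjoint {lam : ℂ} (h : lam ∈ zeroImage p ζ f) : lam ∉ realSegment := by
  obtain ⟨z, hz, hz1, rfl, -⟩ := h
  exact add_inv_notMem_realSegment hz hz1

theorem mem_spectrum_of_eigenvector {lam : ℂ} {v : ℓ²(ℕ, ℂ)} (hv : v ≠ 0) (h : D v = lam • v) :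
    lam ∈ spectrum ℂ D := by
  rintro ⟨U, hU⟩
  have h1 : (U : ℓ²(ℕ, ℂ) →L[ℂ] ℓ²(ℕ, ℂ)) v = 0 := by
    rw [hU]
    change lam • v - D v = 0
    rw [h, sub_self]
  have h2 : ((↑U⁻¹ : ℓ²(ℕ, ℂ) →L[ℂ] ℓ²(ℕ, ℂ)) * (U : ℓ²(ℕ, ℂ) →L[ℂ] ℓ²(ℕ, ℂ))) v = 0 := by
    change (↑U⁻¹ : ℓ²(ℕ, ℂ) →L[ℂ] ℓ²(ℕ, ℂ)) ((U : ℓ²(ℕ, ℂ) →L[ℂ] ℓ²(ℕ, ℂ)) v) = 0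
    rw [h1, map_zero]
  rw [Units.inv_mul] at h2
  exact hv h2

theorem HasZeros.spectrum_eq (hD : HasZeros p ζ f D) :
    spectrum ℂ D = realSegment ∪ zeroImage p ζ f := by
  refine Set.Subset.antisymm (fun lam h => ?_) (Set.union_subset hD.segment ?_)
  · by_contra hn
    rw [Set.mem_union, not_or] at hn
    obtain ⟨z, hz, hz1, rfl⟩ := exists_add_inv_eq hn.1
    exact hD.resolvent z hz hz1 (fun k hk h0 => hn.2 ⟨z, hz, hz1, rfl, k, hk, h0⟩) h
  · rintro lam ⟨z, hz, hz1, rfl, k, hk, h0⟩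
    obtain ⟨v, hv, hDv⟩ := hD.eigenvector z hz hz1 k hk h0
    exact mem_spectrum_of_eigenvector hv hDv

/-- The points of `zeroImage` cannot accumulate off the points `ζ k + (ζ k)⁻¹`. -/
theorem not_accPt_zeroImage (hζ : ∀ k, ‖ζ k‖ = 1)
    (hfin : ∀ r > 0, {z | z ∈ Metric.ball (0 : ℂ) 1 ∧ f z = 0 ∧ r ≤ ‖1 - z‖}.Finite)
    {lam : ℂ} (h : ∀ k < p, lam ≠ ζ k + (ζ k)⁻¹) :
    ¬ AccPt lam (𝓟 (zeroImage p ζ f)) := by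
  have hcl : IsClosed ((fun k => ζ k + (ζ k)⁻¹) '' (Finset.range p : Set ℕ)) :=
    ((Finset.finite_toSet _).image _).isClosed
  have hmem : lam ∈ ((fun k => ζ k + (ζ k)⁻¹) '' (Finset.range p : Set ℕ))ᶜ := by
    rintro ⟨k, hk, rfl⟩
    exact h k (by simpa using hk) rfl
  obtain ⟨e, he, hball⟩ := Metric.isOpen_iff.1 hcl.isOpen_compl lam hmem
  set r := min (1 / 2) (e / 6) with hr
  have hr0 : 0 < r := by positivity
  have hr1 : r ≤ 1 / 2 := min_le_left _ _
  have hr2 : 3 * r ≤ e / 2 := by linarith [min_le_right (1 / 2) (e / 6)]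
  intro hacc
  have h2 := hacc.nhds_inter (Metric.ball_mem_nhds lam (half_pos he))
  refine Set.Infinite.of_accPt h2 (Set.Finite.subset (Set.Finite.biUnion (Finset.finite_toSet
    (Finset.range p)) fun k _ => ((hfin r hr0).image fun w => (ζ k)⁻¹ * w + ((ζ k)⁻¹ * w)⁻¹)) ?_)
  rintro mu ⟨hmu, z, hz, hz1, rfl, k, hk, h0⟩
  have hζ0 : ζ k ≠ 0 := norm_pos_iff.1 (by rw [hζ]; exact one_pos)
  simp only [Set.mem_iUnion]
  refine ⟨k, by simpa using hk, ζ k * z, ⟨by simpa [hζ] using hz1, h0, ?_⟩, ?_⟩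
  · by_contra hlt
    have h3 := norm_add_inv_sub_le (hζ k) hr1 (not_le.1 hlt)
    have h4 : ζ k + (ζ k)⁻¹ ∈ Metric.ball lam e := by
      rw [Metric.mem_ball, dist_comm]
      rw [Metric.mem_ball, dist_comm] at hmu
      refine (dist_triangle _ (z + z⁻¹) _).trans_lt ?_
      rw [dist_eq_norm (z + z⁻¹)]
      linarith
    exact hball h4 ⟨k, by simpa using hk, rfl⟩
  · simp only
    rw [inv_mul_cancel_left₀ hζ0]

theorem accPt_zeroImage (hζ : ∀ k, ‖ζ k‖ = 1)
    (hfin : ∀ r > 0, {z | z ∈ Metric.ball (0 : ℂ) 1 ∧ f z = 0 ∧ r ≤ ‖1 - z‖}.Finite)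
    (hf0 : f 0 ≠ 0) (hinf : {z | z ∈ Metric.ball (0 : ℂ) 1 ∧ f z = 0}.Infinite)
    {k : ℕ} (hk : k < p) : AccPt (ζ k + (ζ k)⁻¹) (𝓟 (zeroImage p ζ f)) := by
  have hζ0 : ζ k ≠ 0 := norm_pos_iff.1 (by rw [hζ]; exact one_pos)
  rw [accPt_iff_nhds]
  intro V hV
  obtain ⟨e, he, hball⟩ := Metric.mem_nhds_iff.1 hV
  set r := min (1 / 2) (e / 6) with hr
  have hr0 : 0 < r := by positivity
  have hr1 : r ≤ 1 / 2 := min_le_left _ _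
  have hr2 : 3 * r < e := by linarith [min_le_right (1 / 2) (e / 6)]
  obtain ⟨w, ⟨hw, hw0⟩, hw2⟩ := hinf.exists_notMem_finite (hfin r hr0)
  have hw3 : ‖1 - w‖ < r := by
    by_contra hn
    exact hw2 ⟨hw, hw0, not_lt.1 hn⟩
  have hwz : w ≠ 0 := by
    rintro rfl
    exact hf0 hw0
  have hz0 : (ζ k)⁻¹ * w ≠ 0 := mul_ne_zero (inv_ne_zero hζ0) hwz
  have hz1 : ‖(ζ k)⁻¹ * w‖ < 1 := by
    rw [norm_mul, norm_inv, hζ, inv_one, one_mul]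
    simpa using hw
  have hcancel : ζ k * ((ζ k)⁻¹ * w) = w := mul_inv_cancel_left₀ hζ0 w
  refine ⟨(ζ k)⁻¹ * w + ((ζ k)⁻¹ * w)⁻¹, ⟨hball ?_, (ζ k)⁻¹ * w, hz0, hz1, rfl, k, hk, ?_⟩, ?_⟩
  · rw [Metric.mem_ball, dist_eq_norm]
    exact (norm_add_inv_sub_le (hζ k) hr1 (by rwa [hcancel])).trans_lt hr2
  · rw [hcancel, hw0]
  · intro h
    exact add_inv_notMem_realSegment hz0 hz1 (h ▸ add_inv_mem_realSegment (hζ k))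

/-- The points `ζ k + (ζ k)⁻¹` lie in `[-2, 2]`, so the spectrum is discrete off `[-2, 2]`. -/
theorem HasZeros.not_accPt_spectrum (hD : HasZeros p ζ f D) (hζ : ∀ k, ‖ζ k‖ = 1)
    (hfin : ∀ r > 0, {z | z ∈ Metric.ball (0 : ℂ) 1 ∧ f z = 0 ∧ r ≤ ‖1 - z‖}.Finite)
    {lam : ℂ} (h : lam ∉ realSegment) :
    ¬ AccPt lam (𝓟 (spectrum ℂ D)) := by
  rw [hD.spectrum_eq, ← sup_principal, accPt_sup, not_or]
  refine ⟨fun hacc => h ?_, not_accPt_zeroImage hζ hfin fun k _ hk => h ?_⟩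
  · exact isClosed_realSegment.closure_eq ▸ hacc.clusterPt.mem_closure
  · rw [hk]
    exact add_inv_mem_realSegment (hζ k)

/-- The zeros of the functions `f (ζ k * z)` at `z₁` have finite order. -/
theorem eventually_lower_bound (hζ : ∀ k, ‖ζ k‖ = 1)
    (hf : DifferentiableOn ℂ f (Metric.ball 0 1)) (hf0 : f 0 ≠ 0) {z₁ : ℂ} (hz₁ : ‖z₁‖ < 1)
    (q : ℕ) : ∃ (m : ℕ) (c : ℝ), 0 < c ∧ c ≤ 1 / 4 ∧
      ∀ᶠ z in 𝓝 z₁, ∀ k < q, c * ‖z - z₁‖ ^ m ≤ ‖f (ζ k * z)‖ := by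
  induction q with
  | zero => exact ⟨0, 1 / 4, by norm_num, le_rfl, Eventually.of_forall fun z k hk => by omega⟩
  | succ q ih =>
    obtain ⟨m, c, hc, hc1, hev⟩ := ih
    have hmem : ζ q * z₁ ∈ Metric.ball (0 : ℂ) 1 := by simpa [hζ] using hz₁
    have hfa : AnalyticOnNhd ℂ f (Metric.ball 0 1) := hf.analyticOnNhd Metric.isOpen_ball
    have hζ0 : ζ q ≠ 0 := norm_pos_iff.1 (by rw [hζ]; exact one_pos)
    have hne : ¬ ∀ᶠ w in 𝓝 (ζ q * z₁), f w = 0 := fun h =>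
      hf0 (hfa.eqOn_zero_of_preconnected_of_eventuallyEq_zero
        (convex_ball (0 : ℂ) 1).isPreconnected hmem h (Metric.mem_ball_self one_pos))
    obtain ⟨n, g, hg, hg0, hgf⟩ :=
      ((hfa _ hmem).exists_eventuallyEq_pow_smul_nonzero_iff).2 hne
    have hcont : Tendsto (fun z => ζ q * z) (𝓝 z₁) (𝓝 (ζ q * z₁)) :=
      (continuous_const_mul (ζ q)).tendsto z₁
    have hg1 : ∀ᶠ w in 𝓝 (ζ q * z₁), ‖g (ζ q * z₁)‖ / 2 < ‖g w‖ :=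
      hg.continuousAt.norm.eventually_const_lt (half_lt_self (norm_pos_iff.2 hg0))
    have hball : ∀ᶠ z in 𝓝 z₁, ‖z - z₁‖ < 1 := by
      filter_upwards [Metric.ball_mem_nhds z₁ one_pos] with z hz
      rwa [← dist_eq_norm]
    refine ⟨max m n, min c (‖g (ζ q * z₁)‖ / 2), lt_min hc (half_pos (norm_pos_iff.2 hg0)),
      (min_le_left _ _).trans hc1, ?_⟩
    filter_upwards [hev, hcont.eventually hgf, hcont.eventually hg1, hball] with z h1 h2 h3 h4 k hk
    rcases Nat.lt_succ_iff_lt_or_eq.1 hk with hk | rfl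
    · refine le_trans ?_ (h1 k hk)
      gcongr ?_ * ?_
      · exact min_le_left _ _
      · exact pow_le_pow_of_le_one (norm_nonneg _) h4.le (le_max_left _ _)
    · rw [h2, norm_smul, norm_pow, ← mul_sub, norm_mul, hζ, one_mul, mul_comm]
      gcongr ?_ * ?_
      · exact pow_le_pow_of_le_one (norm_nonneg _) h4.le (le_max_right _ _)
      · exact (min_le_right _ _).trans h3.le

/-- Since `z ↦ z + z⁻¹` is locally Lipschitz and the zeros of `f` have finite order, the bound on
the resolvent makes the algebraic multiplicities finite. -/
theorem HasZeros.finiteDimensional_maxGenEigenspace (hD : HasZeros p ζ f D)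
    (hζ : ∀ k, ‖ζ k‖ = 1) (hf : DifferentiableOn ℂ f (Metric.ball 0 1)) (hf0 : f 0 ≠ 0) {z₁ : ℂ}
    (hz₀ : z₁ ≠ 0) (hz₁ : ‖z₁‖ < 1) :
    FiniteDimensional ℂ
      (Module.End.maxGenEigenspace (D : Module.End ℂ ℓ²(ℕ, ℂ)) (z₁ + z₁⁻¹)) := by
  obtain ⟨m, c, hc, hc1, hev⟩ := eventually_lower_bound hζ hf hf0 hz₁ p
  obtain ⟨C, hC, hlow⟩ := hD.lower_bound z₁ hz₀ hz₁
  set L : ℝ := ‖1 - (z₁ * z₁)⁻¹‖ + 1 with hL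
  have hcts : ContinuousAt (fun z : ℂ => ‖1 - (z * z₁)⁻¹‖) z₁ := by
    have : z₁ * z₁ ≠ 0 := mul_ne_zero hz₀ hz₀
    fun_prop (disch := assumption)
  have hLev : ∀ᶠ z in 𝓝 z₁, ‖1 - (z * z₁)⁻¹‖ < L := hcts.eventually_lt_const (lt_add_one _)
  have hz0 : ∀ᶠ z in 𝓝 z₁, z ≠ 0 := continuousAt_id.eventually_ne hz₀
  have hzb : ∀ᶠ z in 𝓝 z₁, ‖z‖ < 1 := continuous_norm.continuousAt.eventually_lt_const hz₁
  have hball : ∀ᶠ z in 𝓝 z₁, ‖z - z₁‖ < 1 := by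
    filter_upwards [Metric.ball_mem_nhds z₁ one_pos] with z hz
    rwa [← dist_eq_norm]
  have hmain : ∀ᶠ z in 𝓝[≠] z₁, ∀ v : ℓ²(ℕ, ℂ), ‖z + z⁻¹ - (z₁ + z₁⁻¹)‖ ^ (2 * m) * ‖v‖ ≤
      (L ^ (2 * m) * C / c ^ 2) * ‖(D - (z + z⁻¹) • 1) v‖ := by
    filter_upwards [hev.filter_mono nhdsWithin_le_nhds, hlow.filter_mono nhdsWithin_le_nhds,
      hLev.filter_mono nhdsWithin_le_nhds, hz0.filter_mono nhdsWithin_le_nhds,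
      hball.filter_mono nhdsWithin_le_nhds, self_mem_nhdsWithin] with z h1 h2 h3 h4 h5 h6 v
    have h7 : 0 < ‖z - z₁‖ := norm_pos_iff.2 (sub_ne_zero.2 h6)
    have h8 := h2 (c * ‖z - z₁‖ ^ m) (by positivity)
      ((mul_le_of_le_one_right hc.le (pow_le_one₀ h7.le h5.le)).trans hc1) h1 v
    have h9 : ‖z + z⁻¹ - (z₁ + z₁⁻¹)‖ ≤ L * ‖z - z₁‖ := by
      have : z + z⁻¹ - (z₁ + z₁⁻¹) = (1 - (z * z₁)⁻¹) * (z - z₁) := by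
        field_simp
        ring
      rw [this, norm_mul]
      gcongr
    calc ‖z + z⁻¹ - (z₁ + z₁⁻¹)‖ ^ (2 * m) * ‖v‖ ≤ (L * ‖z - z₁‖) ^ (2 * m) * ‖v‖ := by gcongr
      _ = L ^ (2 * m) / c ^ 2 * ((c * ‖z - z₁‖ ^ m) ^ 2 * ‖v‖) := by
        rw [mul_pow, mul_pow, ← pow_mul, mul_comm m 2]
        field_simp
      _ ≤ L ^ (2 * m) / c ^ 2 * (C * ‖(D - (z + z⁻¹) • 1) v‖) := by gcongr
      _ = _ := by ring
  have htend : Tendsto (fun z : ℂ => z + z⁻¹) (𝓝[≠] z₁) (𝓝[≠] (z₁ + z₁⁻¹)) := by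
    refine tendsto_nhdsWithin_iff.2 ⟨?_, ?_⟩
    · exact (continuousAt_id.add (continuousAt_inv₀ hz₀)).tendsto.mono_left nhdsWithin_le_nhds
    · filter_upwards [hz0.filter_mono nhdsWithin_le_nhds, hzb.filter_mono nhdsWithin_le_nhds,
        self_mem_nhdsWithin] with z h1 h2 h3 h4
      rcases eq_or_mul_eq_one h1 hz₀ h4 with h5 | h5
      · exact h3 h5
      · have := congrArg norm h5
        rw [norm_mul, norm_one] at this
        nlinarith [norm_nonneg z, norm_nonneg z₁]
  exact BandedOperator.finiteDimensional_maxGenEigenspace D _ (hD.finite_ker _) (2 * m) _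
    (htend.frequently (p := fun mu => ∀ v : ℓ²(ℕ, ℂ), ‖mu - (z₁ + z₁⁻¹)‖ ^ (2 * m) * ‖v‖ ≤
      (L ^ (2 * m) * C / c ^ 2) * ‖(D - mu • 1) v‖) hmain.frequently)

/-- The points of `[-2, 2]` are not isolated in the spectrum, and all other points of the spectrum
are isolated eigenvalues of finite algebraic multiplicity. -/
theorem HasZeros.discreteSpectrum_eq (hD : HasZeros p ζ f D) (hζ : ∀ k, ‖ζ k‖ = 1)
    (hf : DifferentiableOn ℂ f (Metric.ball 0 1)) (hf0 : f 0 ≠ 0)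
    (hfin : ∀ r > 0, {z | z ∈ Metric.ball (0 : ℂ) 1 ∧ f z = 0 ∧ r ≤ ‖1 - z‖}.Finite) :
    discreteSpectrum D = zeroImage p ζ f := by
  refine Set.Subset.antisymm ?_ ?_
  · rintro lam ⟨h1, h2, -, -⟩
    rw [hD.spectrum_eq] at h1
    refine h1.resolve_left fun h => h2 ?_
    exact (preperfect_realSegment lam h).mono (principal_mono.2 hD.segment)
  · intro lam h
    have hnot := zeroImage_disjoint h
    obtain ⟨z, hz, hz1, rfl, k, hk, h0⟩ := h
    obtain ⟨v, hv, hDv⟩ := hD.eigenvector z hz hz1 k hk h0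
    exact ⟨mem_spectrum_of_eigenvector hv hDv, hD.not_accPt_spectrum hζ hfin hnot,
      Module.End.hasEigenvalue_of_hasEigenvector (x := v)
        ⟨Module.End.mem_eigenspace_iff.2 hDv, hv⟩,
      hD.finiteDimensional_maxGenEigenspace hζ hf hf0 hz hz1⟩

theorem HasZeros.limitSet_eq (hD : HasZeros p ζ f D) (hζ : ∀ k, ‖ζ k‖ = 1)
    (hf : DifferentiableOn ℂ f (Metric.ball 0 1)) (hf0 : f 0 ≠ 0)
    (hinf : {z | z ∈ Metric.ball (0 : ℂ) 1 ∧ f z = 0}.Infinite)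
    (hfin : ∀ r > 0, {z | z ∈ Metric.ball (0 : ℂ) 1 ∧ f z = 0 ∧ r ≤ ‖1 - z‖}.Finite) :
    limitSet D = {lam | ∃ k < p, lam = ζ k + (ζ k)⁻¹} := by
  ext lam
  rw [limitSet, hD.discreteSpectrum_eq hζ hf hf0 hfin, mem_derivedSet]
  refine ⟨fun h => ?_, ?_⟩
  · by_contra hn
    exact not_accPt_zeroImage hζ hfin (fun k hk he => hn ⟨k, hk, he⟩) h
  · rintro ⟨k, hk, rfl⟩
    exact accPt_zeroImage hζ hfin hf0 hinf hk

theorem HasZeros.infinite_discreteSpectrum (hD : HasZeros p ζ f D) (hp : 1 ≤ p)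
    (hζ : ∀ k, ‖ζ k‖ = 1)
    (hf : DifferentiableOn ℂ f (Metric.ball 0 1)) (hf0 : f 0 ≠ 0)
    (hinf : {z | z ∈ Metric.ball (0 : ℂ) 1 ∧ f z = 0}.Infinite)
    (hfin : ∀ r > 0, {z | z ∈ Metric.ball (0 : ℂ) 1 ∧ f z = 0 ∧ r ≤ ‖1 - z‖}.Finite) :
    (discreteSpectrum D).Infinite := by
  rw [hD.discreteSpectrum_eq hζ hf hf0 hfin]
  exact Set.Infinite.of_accPt (accPt_zeroImage hζ hfin hf0 hinf (k := 0) hp)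

end Spectrum

/-! ### Operators with three diagonals in the class `𝒫_p(β)` -/

section ThreeDiag

variable {p : ℕ} {α b c : ℕ → ℂ} {D : ℓ²(ℕ, ℂ) →L[ℂ] ℓ²(ℕ, ℂ)}

theorem IsThreeDiag.entry_eq (hD : IsThreeDiag p α b c D) (hp : 1 ≤ p) (i j : ℕ) :
    entry D i j =
      if i = j + p then α i else if i = j then b i else if j = i + p then c i else 0 := by
  have hs : ∀ n : ℕ, (lp.single 2 j (1 : ℂ) : ℓ²(ℕ, ℂ)) n = if n = j then 1 else 0 :=
    fun n => by
      rw [lp.single_apply, Pi.single_apply]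
  rw [entry, hD, hs, hs, hs]
  split_ifs <;> first | omega | simp

theorem IsThreeDiag.extEntry_upper (hD : IsThreeDiag p α b c D) (hp : 1 ≤ p) (n : ℕ) :
    extEntry p D n (n + p) = c n := by
  rw [extEntry, if_pos (by omega), hD.entry_eq hp]
  have h1 : ((n : ℤ) + p).toNat = n + p := by omega
  rw [Int.toNat_natCast, h1, if_neg (by omega), if_neg (by omega), if_pos rfl]

theorem IsThreeDiag.extEntry_lower (hD : IsThreeDiag p α b c D) (hp : 1 ≤ p) (n : ℕ) :
    extEntry p D n (n - p) = if p ≤ n then α n else 1 := by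
  rw [extEntry]
  by_cases h : p ≤ n
  · rw [if_pos (by omega), if_pos h, hD.entry_eq hp, if_pos (by omega), Int.toNat_natCast]
  · rw [if_neg (by omega), if_neg h, if_pos (by rw [sub_sub_cancel, Nat.abs_cast])]

theorem IsThreeDiag.extEntry_inner (hD : IsThreeDiag p α b c D) (hp : 1 ≤ p) (n : ℕ) {r : ℤ}
    (hr : |r| < p) : extEntry p D n (n + r) = if r = 0 then b n else 0 := by
  rw [abs_lt] at hr
  rw [extEntry]
  by_cases h : 0 ≤ (n : ℤ) ∧ 0 ≤ (n : ℤ) + r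
  · rw [if_pos h, hD.entry_eq hp, if_neg (by omega)]
    by_cases hr0 : r = 0
    · rw [if_pos (by omega), if_pos hr0, Int.toNat_natCast]
    · rw [if_neg (by omega), if_neg (by omega), if_neg hr0]
  · rw [if_neg h, if_neg, if_neg (by omega)]
    rw [sub_add_cancel_left, abs_neg]
    intro h1
    have := abs_lt.2 hr
    omega

theorem IsThreeDiag.deviation_eq (hD : IsThreeDiag p α b c D) (hp : 1 ≤ p) (n : ℕ) :
    deviation p D n = (if p ≤ n then ‖α n - 1‖ else 0) + ‖b n‖ + ‖c n - 1‖ := by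
  have h1 : ∑ r ∈ Finset.Ioo (-(p : ℤ)) p, ‖extEntry p D n (n + r)‖ =
      ∑ r ∈ Finset.Ioo (-(p : ℤ)) p, if r = 0 then ‖b n‖ else 0 := by
    refine Finset.sum_congr rfl fun r hr => ?_
    rw [hD.extEntry_inner hp n (abs_lt.2 (Finset.mem_Ioo.1 hr)), apply_ite norm, norm_zero]
  rw [deviation, h1, hD.extEntry_lower hp, hD.extEntry_upper hp, Finset.sum_ite_eq',
    if_pos (Finset.mem_Ioo.2 (by omega))]
  by_cases h : p ≤ n
  · rw [if_pos h, if_pos h]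
  · rw [if_neg h, if_neg h, sub_self, norm_zero]

theorem IsThreeDiag.isBanded (hD : IsThreeDiag p α b c D) (hp : 1 ≤ p)
    (hα0 : ∀ n, p ≤ n → α n ≠ 0) (hc0 : ∀ n, c n ≠ 0) (hα : Tendsto α atTop (𝓝 1))
    (hb : Tendsto b atTop (𝓝 0)) (hc : Tendsto c atTop (𝓝 1)) : IsBanded p D where
  eq_zero i j h := by
    rw [lt_abs] at h
    rw [hD.entry_eq hp, if_neg (by omega), if_neg (by omega), if_neg (by omega)]
  ne_zero i j h := by
    rw [hD.entry_eq hp]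
    rcases (abs_eq (by omega)).1 h with h | h
    · rw [if_pos (by omega)]
      exact hα0 i (by omega)
    · rw [if_neg (by omega), if_neg (by omega), if_pos (by omega)]
      exact hc0 i
  tendsto_upper := by
    simp only [hD.extEntry_upper hp]
    exact hc
  tendsto_lower := by
    simp only [hD.extEntry_lower hp]
    refine hα.congr' ?_
    filter_upwards [eventually_ge_atTop p] with n hn
    rw [if_pos hn]
  tendsto_inner r hr := by
    simp only [hD.extEntry_inner hp _ hr]
    split_ifs
    · exact hb
    · exact tendsto_const_nhds

/-- The first `p` rows do not matter for the decay, since the constant `C₁` is arbitrary. -/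
theorem IsThreeDiag.classP (hD : IsThreeDiag p α b c D) (hp : 1 ≤ p)
    (hα0 : ∀ n, p ≤ n → α n ≠ 0) (hc0 : ∀ n, c n ≠ 0) {β β' κ : ℝ} (hβ : β ≤ β') (hβ' : 0 < β')
    (hκ : 0 < κ) (h : ∀ n, p ≤ n →
      ‖α n - 1‖ + ‖b n‖ + ‖c n - 1‖ ≤ Real.exp (-κ * ((n : ℝ) + 1) ^ β')) : ClassP p β D := by
  have hlim : Tendsto (fun n : ℕ => Real.exp (-κ * ((n : ℝ) + 1) ^ β')) atTop (𝓝 0) := by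
    refine Real.tendsto_exp_atBot.comp (Tendsto.const_mul_atTop_of_neg (by linarith) ?_)
    exact (tendsto_rpow_atTop hβ').comp
      (tendsto_atTop_add_const_right _ _ tendsto_natCast_atTop_atTop)
  have hsub : ∀ (s : ℕ → ℂ) (a : ℂ), (∀ n, p ≤ n → ‖s n - a‖ ≤
      ‖α n - 1‖ + ‖b n‖ + ‖c n - 1‖) → Tendsto s atTop (𝓝 a) := fun s a hs => by
    rw [tendsto_iff_norm_sub_tendsto_zero]
    refine squeeze_zero' (Eventually.of_forall fun n => norm_nonneg _) ?_ hlim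
    filter_upwards [eventually_ge_atTop p] with n hn
    exact (hs n hn).trans (h n hn)
  refine ⟨hD.isBanded hp hα0 hc0 (hsub _ _ fun n _ => ?_) (hsub _ _ fun n _ => ?_)
    (hsub _ _ fun n _ => ?_), ?_⟩
  · linarith [norm_nonneg (b n), norm_nonneg (c n - 1)]
  · rw [sub_zero]
    linarith [norm_nonneg (α n - 1), norm_nonneg (c n - 1)]
  · linarith [norm_nonneg (b n), norm_nonneg (α n - 1)]
  set Q := ∑ n ∈ Finset.range p, deviation p D n with hQ
  have hdev0 : ∀ n, 0 ≤ deviation p D n := fun n => by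
    rw [hD.deviation_eq hp]
    split_ifs <;> positivity
  have hQ0 : 0 ≤ Q := Finset.sum_nonneg fun n _ => hdev0 n
  refine ⟨(1 + Q) * Real.exp (κ * (p : ℝ) ^ β'), κ, by positivity, hκ, fun n => ?_⟩
  have hn1 : (1 : ℝ) ≤ (n : ℝ) + 1 := by linarith [n.cast_nonneg (α := ℝ)]
  have hmono : Real.exp (-κ * ((n : ℝ) + 1) ^ β') ≤ Real.exp (-κ * ((n : ℝ) + 1) ^ β) := by
    have := Real.rpow_le_rpow_of_exponent_le hn1 hβ
    exact Real.exp_le_exp.2 (by nlinarith)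
  suffices hs : deviation p D n ≤
      (1 + Q) * Real.exp (κ * (p : ℝ) ^ β') * Real.exp (-κ * ((n : ℝ) + 1) ^ β') from
    hs.trans (by gcongr)
  by_cases hn : p ≤ n
  · have h1 : 1 ≤ Real.exp (κ * (p : ℝ) ^ β') := Real.one_le_exp (by positivity)
    have h2 : deviation p D n ≤ Real.exp (-κ * ((n : ℝ) + 1) ^ β') := by
      rw [hD.deviation_eq hp, if_pos hn]
      exact h n hn
    refine h2.trans (le_mul_of_one_le_left (Real.exp_pos _).le ?_)
    exact one_le_mul_of_one_le_of_one_le (by linarith) h1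
  · have h1 : deviation p D n ≤ Q :=
      Finset.single_le_sum (f := fun n => deviation p D n) (fun n _ => hdev0 n)
        (Finset.mem_range.2 (not_le.1 hn))
    have h2 : 1 ≤ Real.exp (κ * (p : ℝ) ^ β') * Real.exp (-κ * ((n : ℝ) + 1) ^ β') := by
      rw [← Real.exp_add]
      refine Real.one_le_exp ?_
      have h3 : ((n : ℝ) + 1) ^ β' ≤ (p : ℝ) ^ β' := by
        refine Real.rpow_le_rpow (by linarith) ?_ hβ'.le
        exact_mod_cast not_le.1 hn
      nlinarith
    rw [mul_assoc]
    exact h1.trans ((by linarith : Q ≤ 1 + Q).trans (le_mul_of_one_le_right (by linarith) h2))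

end ThreeDiag

/-! ### The operator built from a flat function -/

theorem exists_pos_le_norm (g : ℕ → ℂ) (q : ℕ) (h : ∀ k < q, g k ≠ 0) :
    ∃ φ : ℝ, 0 < φ ∧ φ ≤ 1 / 4 ∧ ∀ k < q, φ ≤ ‖g k‖ := by
  induction q with
  | zero => exact ⟨1 / 4, by norm_num, le_rfl, fun k hk => by omega⟩
  | succ q ih =>
    obtain ⟨φ, h1, h2, h3⟩ := ih fun k hk => h k (by omega)
    refine ⟨min φ ‖g q‖, lt_min h1 (norm_pos_iff.2 (h q (by omega))), (min_le_left _ _).trans h2,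
      fun k hk => ?_⟩
    rcases Nat.lt_succ_iff_lt_or_eq.1 hk with hk | rfl
    · exact (min_le_left _ _).trans (h3 k hk)
    · exact min_le_right _ _

section Operator

variable {p : ℕ} {x : ℕ → ℝ} {f : ℂ → ℂ} {ζ : ℕ → ℂ} {b₀ d : ℕ → ℂ} {A B : ℕ → ℕ → ℂ}
  {u : ℕ → ℕ → ℂ → ℂ} {D : ℓ²(ℕ, ℂ) →L[ℂ] ℓ²(ℕ, ℂ)}

theorem hasZeros_of_isExpansion (hp : 1 ≤ p)
    (hE : ∀ k, IsExpansion x (fun z => f (ζ k * z) / z) (b₀ k) (d k) (A k) (B k) (u k))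
    (hx0 : ∀ i, 0 ≤ x i) (hx4 : ∀ i, x i ≤ 1 / 4) (hxs : Summable x) {M : ℝ}
    (hM : ∀ k, ‖b₀ k‖ ≤ M) (hM' : ∀ k, ‖d k‖ ≤ M)
    (hD : IsThreeDiag p (lowerSeq p A) (diagSeq p b₀ B) (upperSeq p d) D) : HasZeros p ζ f D where
  segment lam hlam := by
    refine hD.mem_spectrum hp ((M + 1) + 3 * ∑' i, x i + ∑' i, x i) (fun K => ?_) hlam
    have hM0 : 0 ≤ M := (norm_nonneg _).trans (hM 0)
    have h1 : ∀ i, ‖upperSeq p d (p * i) - 1‖ ≤ if i = 0 then M + 1 else 0 := fun i => by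
      split_ifs with hi
      · rw [hi, mul_zero, upperSeq, if_pos (Nat.lt_of_lt_of_le zero_lt_one hp)]
        refine (norm_sub_le _ _).trans ?_
        rw [norm_one]
        gcongr
        exact hM' 0
      · rw [upperSeq, if_neg, sub_self, norm_zero]
        exact not_lt.2 (Nat.le_mul_of_pos_right p (Nat.pos_of_ne_zero hi))
    have h2 : ∀ i, ‖diagSeq p b₀ B (p * i + p)‖ ≤ 3 * x i := fun i => by
      rw [diagSeq, if_neg (by omega), Nat.add_div_right _ hp, Nat.mul_div_cancel_left _ hp,
        Nat.add_sub_cancel]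
      exact (hE _).norm_le i
    have h3 : ∀ i, ‖lowerSeq p A (p * i + p + p) - 1‖ ≤ x (i + 1) := fun i => by
      rw [lowerSeq, Nat.add_div_right _ hp, Nat.add_div_right _ hp, Nat.mul_div_cancel_left _ hp,
        Nat.add_sub_cancel]
      exact (hE _).norm_sub_one_le (i + 1)
    rw [Finset.sum_add_distrib, Finset.sum_add_distrib]
    refine add_le_add (add_le_add ?_ ?_) ?_
    · refine (Finset.sum_le_sum fun i _ => h1 i).trans ?_
      rw [Finset.sum_ite_eq']
      split_ifs <;> linarith
    · refine (Finset.sum_le_sum fun i _ => h2 i).trans ?_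
      rw [← Finset.mul_sum]
      gcongr
      exact hxs.sum_le_tsum _ fun i _ => hx0 i
    · refine (Finset.sum_le_sum fun i _ => h3 i).trans ?_
      have h4 := hxs.sum_le_tsum (Finset.range (K + 1)) fun i _ => hx0 i
      rw [Finset.sum_range_succ'] at h4
      linarith [hx0 0]
  finite_ker lam := hD.finiteDimensional_ker hp (fun n => by
    rw [upperSeq]
    split_ifs
    · exact (hE n).ne_zero
    · exact one_ne_zero) lam
  eigenvector z hz hz1 k hk h0 :=
    exists_eigenvector_of_isExpansion hp hE hx0 hx4 hxs hD hz hz1 hk (by simp only [h0, zero_div])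
  resolvent z hz hz1 h0 := by
    obtain ⟨φ, h1, h2, h3⟩ := exists_pos_le_norm (fun k => f (ζ k * z) / z) p
      fun k hk => div_ne_zero (h0 k hk) hz
    obtain ⟨U, hU, hU', -⟩ :=
      exists_resolvent_of_isExpansion hp hE hx0 hx4 hxs hM hM' hD hz hz1 h1 h2 h3
    rw [spectrum.notMem_iff, Algebra.algebraMap_eq_smul_one, ← neg_sub, IsUnit.neg_iff]
    exact ⟨⟨_, U, hU', hU⟩, rfl⟩
  lower_bound z₁ hz₀ hz₁ := by
    have hM0 : 0 ≤ M := (norm_nonneg _).trans (hM 0)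
    set E := Real.exp (4 * ∑' i, x i) with hEdef
    set ρ := ‖z₁‖ / 2 with hρ
    set τ := (1 - ‖z₁‖) / 2 with hτ
    have hρ0 : 0 < ρ := half_pos (norm_pos_iff.2 hz₀)
    have hτ0 : 0 < τ := half_pos (by linarith)
    refine ⟨E / τ * (E * (1 + M / ρ) / τ), by positivity, ?_⟩
    have hev1 : ∀ᶠ z in 𝓝 z₁, ρ < ‖z‖ :=
      continuous_norm.continuousAt.eventually_const_lt (half_lt_self (norm_pos_iff.2 hz₀))
    have hev2 : ∀ᶠ z in 𝓝 z₁, ‖z‖ < 1 - τ :=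
      continuous_norm.continuousAt.eventually_lt_const (by rw [hτ]; linarith)
    filter_upwards [hev1, hev2] with z h1 h2 φ hφ hφ4 hF v
    have hz0 : z ≠ 0 := norm_pos_iff.1 (hρ0.trans h1)
    have hz1 : ‖z‖ < 1 := by linarith
    obtain ⟨U, hU, -, hn⟩ :=
      exists_resolvent_of_isExpansion hp hE hx0 hx4 hxs hM hM' hD hz0 hz1 hφ hφ4 fun k hk => by
        rw [norm_div, le_div_iff₀ (norm_pos_iff.2 hz0)]
        exact (mul_le_of_le_one_right hφ.le hz1.le).trans (hF k hk)
    have hn' : ‖U‖ ≤ E / τ * (E * ((1 + M / ρ) / φ) / τ) * φ⁻¹ := by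
      refine hn.trans ?_
      have h3 : τ ≤ 1 - ‖z‖ := by linarith
      have h4 : 1 + M / (‖z‖ * φ) ≤ (1 + M / ρ) / φ := by
        rw [add_div, div_div]
        gcongr
        rw [le_div_iff₀ hφ]
        linarith
      gcongr
    have hv : v = U ((D - (z + z⁻¹) • 1) v) := by
      change v = (U * (D - (z + z⁻¹) • 1)) v
      rw [hU]
      rfl
    calc φ ^ 2 * ‖v‖ ≤ φ ^ 2 * (‖U‖ * ‖(D - (z + z⁻¹) • 1) v‖) := by
          gcongr
          conv_lhs => rw [hv]
          exact U.le_opNorm _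
      _ ≤ φ ^ 2 * ((E / τ * (E * ((1 + M / ρ) / φ) / τ) * φ⁻¹) * ‖(D - (z + z⁻¹) • 1) v‖) := by
          gcongr
      _ = _ := by
          field_simp

/-- The rows `p * i + k` with `k < p` have deviation at most `4 * x (i - 1)`, for `i ≥ 1`. The
constant `c / (3 * p) ^ β'` comes from `(n + 1) / (3 p) ≤ 1 + 2 (i - 1)` for `n = p * i + k`. -/
theorem classP_of_isExpansion (hp : 1 ≤ p) {F : ℕ → ℂ → ℂ}
    (hE : ∀ k, IsExpansion x (F k) (b₀ k) (d k) (A k) (B k) (u k))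
    (hx4 : ∀ i, x i ≤ 1 / 4) {β β' c : ℝ} (hc : 0 < c) (hβ : β ≤ β') (hβ' : 0 < β')
    (hx : ∀ i : ℕ, 4 * x i ≤ Real.exp (-(c * (1 + 2 * i : ℝ) ^ β')))
    (hD : IsThreeDiag p (lowerSeq p A) (diagSeq p b₀ B) (upperSeq p d) D) : ClassP p β D := by
  have hp0 : (0 : ℝ) < p := by exact_mod_cast hp
  refine hD.classP hp (fun n hn h0 => ?_) (fun n => ?_) hβ hβ' (κ := c / (3 * p : ℝ) ^ β')
    (by positivity) fun n hn => ?_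
  · have h1 := one_sub_le_norm_lowerSeq (p := p) hE n
    rw [h0, norm_zero] at h1
    linarith [hx4 (n / p - 1)]
  · rw [upperSeq]
    split_ifs
    · exact (hE n).ne_zero
    · exact one_ne_zero
  · have h1 : ‖lowerSeq p A n - 1‖ ≤ x (n / p - 1) := (hE _).norm_sub_one_le _
    have h2 : ‖diagSeq p b₀ B n‖ ≤ 3 * x (n / p - 1) := by
      rw [diagSeq, if_neg hn.not_gt]
      exact (hE _).norm_le _
    rw [upperSeq, if_neg hn.not_gt, sub_self, norm_zero, add_zero]
    have h3 : ((n : ℝ) + 1) / (3 * p) ≤ 1 + 2 * ((n / p - 1 : ℕ) : ℝ) := by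
      rw [div_le_iff₀ (by positivity)]
      obtain ⟨i, hi⟩ : ∃ i, n / p = i + 1 := ⟨n / p - 1, by have := Nat.div_pos hn hp; omega⟩
      have h4 : n + 1 ≤ p * (i + 2) := by
        have h5 := Nat.lt_mul_div_succ n hp
        rw [hi] at h5
        exact h5
      have h6 : ((n : ℝ) + 1) ≤ p * (i + 2) := by exact_mod_cast h4
      rw [hi, Nat.add_sub_cancel]
      nlinarith [mul_nonneg hp0.le (Nat.cast_nonneg (α := ℝ) i)]
    calc _ ≤ 4 * x (n / p - 1) := by linarith
      _ ≤ Real.exp (-(c * (1 + 2 * ((n / p - 1 : ℕ) : ℝ)) ^ β')) := hx _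
      _ ≤ _ := by
        refine Real.exp_le_exp.2 ?_
        have h4 := Real.rpow_le_rpow (by positivity) h3 hβ'.le
        rw [Real.div_rpow (by positivity) (by positivity)] at h4
        rw [neg_mul, neg_le_neg_iff, div_mul_eq_mul_div, mul_div_assoc]
        gcongr

end Operator

end BandedOperator

end

theorem theorem2 (p : ℕ) (hp : 1 ≤ p) (ε : ℝ) (hε : 0 < ε) (ν : Fin p → ℝ)
    (hν : ∀ i, ν i ∈ Set.Ioo (-2 : ℝ) 2) :
    ∃ D : ℓ²(ℕ, ℂ) →L[ℂ] ℓ²(ℕ, ℂ),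
      BandedOperator.ClassP p (1 / 2 - ε) D ∧
      (BandedOperator.discreteSpectrum D).Infinite ∧
      BandedOperator.limitSet D = Set.range (fun i => (ν i : ℂ)) := by
  open BandedOperator in
  -- the flat function needs a positive exponent, while `1 / 2 - ε` may be negative
  set β' : ℝ := max (1 / 2 - ε) (1 / 4) with hβ'
  have hβ0 : 0 < β' := lt_max_of_lt_right (by norm_num)
  have hβ1 : β' < 1 / 2 := max_lt (by linarith) (by norm_num)
  choose Z hZ hZν using fun i => exists_norm_eq_one_of_mem_Icc (Set.Ioo_subset_Icc_self (hν i))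
  have hZ2 : ∀ i, 1 - Z i ^ 2 ≠ 0 := fun i h => by
    have h1 : (Z i)⁻¹ = Z i := inv_eq_of_mul_eq_one_right (by linear_combination -h)
    have h2 := hZν i
    rw [h1] at h2
    have h3 : (ν i : ℂ) ^ 2 = ((4 : ℝ) : ℂ) := by
      rw [← h2]
      push_cast
      linear_combination (-4) * h
    have h4 : ν i ^ 2 = 4 := by exact_mod_cast h3
    nlinarith [(hν i).1, (hν i).2]
  set ζ : ℕ → ℂ := fun k => Z ⟨k % p, Nat.mod_lt k hp⟩ with hζdef
  have hζ : ∀ k, ‖ζ k‖ = 1 := fun k => hZ _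
  have hζν : ∀ k, ζ k + (ζ k)⁻¹ = ν ⟨k % p, Nat.mod_lt k hp⟩ := fun k => hZν _
  -- the step from `f` to the first tail divides by `1 - ζ k ^ 2`, so `f` is chosen after `δ`
  obtain ⟨δ, hδ, -, hδ'⟩ := exists_pos_le_norm (fun k => 1 - ζ k ^ 2) p fun k _ => hZ2 _
  have hδζ : ∀ k, δ ≤ ‖1 - ζ k ^ 2‖ := fun k => by
    have h1 := hδ' (k % p) (Nat.mod_lt k hp)
    simp only [hζdef, Nat.mod_mod] at h1 ⊢
    exact h1
  obtain ⟨S, hS0, hS⟩ := exists_sum_inv_weight_le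
  -- the sum `S` bounds the accumulated error of the recursion, uniformly in the parameter `c`
  set y : ℝ := min (1 / 8) (Real.log 2 / (6 * (S + 1))) with hy
  have hlog : 0 < Real.log 2 := Real.log_pos (by norm_num)
  have hy0 : 0 < y := lt_min (by norm_num) (by positivity)
  have hy8 : y ≤ 1 / 8 := min_le_left _ _
  have hyS : Real.exp (6 * y * S) ≤ 2 := by
    rw [← Real.le_log_iff_exp_le (by norm_num)]
    have h1 := (le_div_iff₀ (by positivity)).1 (min_le_right (1 / 8) (Real.log 2 / (6 * (S + 1))))
    rw [← hy] at h1
    nlinarith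
  obtain ⟨f, c, hc0, -, hf, hf0, hη, hinf, hfin⟩ :=
    exists_flat_function β' (y * δ) hβ0 hβ1 (by positivity)
  have hω := isGoodWeight_weight hc0.le hβ0.le (by linarith : β' ≤ 1)
  choose A B u hE using fun k => exists_isExpansion hω S y (hS c β' hc0.le) hy0.le hy8 hyS hf hf0 hη
    (hζ k) (hZ2 _) (mul_le_mul_of_nonneg_left (hδζ k) hy0.le)
  have hf0' : f 0 ≠ 0 := by rw [hf0]; exact one_ne_zero
  set x : ℕ → ℝ := fun i => 2 * y / weight c β' (2 * i) with hx
  have hx0 : ∀ i, 0 ≤ x i := fun i => div_nonneg (by linarith) (hω.pos _).le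
  have hx4 : ∀ i, x i ≤ 1 / 4 := fun i => by
    refine (div_le_self (by linarith) (hω.one_le _)).trans ?_
    linarith
  have hxs : Summable x := by
    refine summable_of_sum_range_le (c := 2 * y * S) hx0 fun n => ?_
    simp only [hx, div_eq_mul_inv]
    rw [← Finset.mul_sum]
    exact mul_le_mul_of_nonneg_left (hS c β' hc0.le n) (by linarith)
  have hxe : ∀ i : ℕ, 4 * x i ≤ Real.exp (-(c * (1 + 2 * i : ℝ) ^ β')) := fun i => by
    have h1 : Real.exp (c * (1 + 2 * i : ℝ) ^ β') ≤ weight c β' (2 * i) := by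
      rw [weight]
      push_cast
      exact le_mul_of_one_le_left (Real.exp_pos _).le
        (Real.one_le_rpow (by linarith [i.cast_nonneg (α := ℝ)]) (by norm_num))
    rw [Real.exp_neg, hx]
    calc 4 * (2 * y / weight c β' (2 * i)) = (8 * y) * (weight c β' (2 * i))⁻¹ := by ring
      _ ≤ 1 * (Real.exp (c * (1 + 2 * i : ℝ) ^ β'))⁻¹ :=
        mul_le_mul (by linarith) (inv_anti₀ (Real.exp_pos _) h1) (inv_nonneg.2 (hω.pos _).le)
          zero_le_one
      _ = _ := one_mul _
  set M : ℝ := ‖taylorCoeff f 1‖ + 2 with hM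
  have hMb : ∀ k, ‖-ζ k * taylorCoeff f 1‖ ≤ M := fun k => by
    rw [norm_mul, norm_neg, hζ, one_mul, hM]
    linarith
  have hMd : ∀ k, ‖1 - ζ k ^ 2‖ ≤ M := fun k => by
    refine (norm_sub_le _ _).trans ?_
    rw [norm_pow, hζ, norm_one, one_pow, hM]
    linarith [norm_nonneg (taylorCoeff f 1)]
  have hM0 : 0 ≤ M := (norm_nonneg _).trans (hMb 0)
  obtain ⟨D, hD⟩ := exists_isThreeDiag p (lowerSeq p A)
    (diagSeq p (fun k => -ζ k * taylorCoeff f 1) B) (upperSeq p fun k => 1 - ζ k ^ 2) (M + 2)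
    (fun n => (norm_lowerSeq_le hE hx4 n).trans (by linarith))
    (fun n => (norm_diagSeq_le hE hx4 hMb n).trans (by linarith))
    (fun n => (norm_upperSeq_le hMd n).trans (by linarith))
  have hDZ : HasZeros p ζ f D := hasZeros_of_isExpansion hp hE hx0 hx4 hxs hMb hMd hD
  refine ⟨D, classP_of_isExpansion hp hE hx4 hc0 (le_max_left _ _) hβ0 hxe hD,
    hDZ.infinite_discreteSpectrum hp hζ hf hf0' hinf hfin, ?_⟩
  rw [hDZ.limitSet_eq hζ hf hf0' hinf hfin]
  ext lam
  constructor
  · rintro ⟨k, hk, rfl⟩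
    exact ⟨_, (hζν k).symm⟩
  · rintro ⟨i, rfl⟩
    refine ⟨i, i.2, ?_⟩
    rw [hζν]
    simp only [Nat.mod_eq_of_lt i.2]
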